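/- **Theorem (Quantum Miura transformation).** Let $\lambda$ be a partition of $n$ with Young diagram having rows of lengths $n_1\ge n_2\ge\dots$, and label the rows and columns of $n\times n$ matrices by the cells $(l,k)$ (row $l$, column $k$) of the diagram. Let $g=sl_n(\mathbb C)$, let $t_+=\sum E_{(l,k),(l,k+1)}$, $t_0=\sum(\tfrac{n_l+1}{2}-k)E_{(l,k),(l,k)}$, $t_-=\sum k(n_l-k)E_{(l,k+1),(l,k)}$ (with $l,k\ge 1$) be the corresponding embedded $sl_2$, and grade $g=\bigoplus_{m\in\mathbb Z} g_m$ by giving $E_{ij}$ the degree $\mathrm{col}(j)-\mathrm{col}(i)$; put $g_\pm=\bigoplus_{\pm m>0}g_m$. Let $t_\alpha$ run over the matrix units $E_{ij}\in g_+$ and let $t^\alpha=E_{ji}\in g_-$ be the dual basis for the trace form; write $J(x)$ for $x\in g$ regarded as an element of $\mathcal U g$, $J^\alpha=J(t^\alpha)$, and let $\chi(J^\alpha)$ be the $t_\alpha$-coordinate of $t_+$. For $x\in g$ let $f(x)^{\beta}{}_\gamma$ be the coefficient of $t^\gamma$ in $[x,t^\beta]$ and $f^{\alpha\beta}{}_\gamma=f(t^\alpha)^\beta{}_\gamma$.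 Let $\Omega=\mathcal Ug\otimes Cl(g_+\oplus g_+^*)$, where the Clifford algebra is generated by $c_\alpha,b^\alpha$ with $b^\alpha c_\beta+c_\beta b^\alpha=\delta^\alpha_\beta$ and all other anticommutators zero, and let $d(X)=[Q,X]$ (graded commutator) with $$Q=\sum_\alpha (J^\alpha-\chi(J^\alpha))c_\alpha-\tfrac12\sum_{\alpha,\beta,\gamma} f^{\alpha\beta}{}_\gamma\, b^\gamma c_\alpha c_\beta .$$ The algebra $\Omega$ is bigraded by $\deg J(x)=(m,-m)$ for $x\in g_m$, $\deg c_\alpha=(k,1-k)$ and $\deg b^\alpha=(-k,k-1)$ for $t_\alpha\in g_k$; $\Omega^k$ is the piece of total degree $k$, and $X^{0,0}$ is the component of $X$ of bidegree $(0,0)$. The quantum finite $W$ algebra of $\lambda$ is $H^0(\Omega;d)=\{X\in\Omega^0: dX=0\}/d(\Omega^{-1})$. Put $\hat J(x)=J(x)+\sum_{\beta,\gamma} f(x)^{\beta}{}_\gamma\, b^\gamma c_\beta$, and let $\Omega_{red}\subset\Omega$ be the subalgebra generated by the $c_\alpha$ and the $\hat J(x)$ with $x\in\bigoplus_{m\ge0}g_m$.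 Then: 1. Every class in $H^0(\Omega;d)$ has exactly one representing cocycle $W$ in $\Omega_{red}$. 2. The set $H^0(\Omega;d)^{0,0}$ of the components $W^{0,0}$ of all cocycles $W\in\Omega_{red}$ of degree $0$ is a subalgebra of $\Omega$, and $[W]\mapsto W^{0,0}$ ($W\in\Omega_{red}$) is an isomorphism of algebras $H^0(\Omega;d)\to H^0(\Omega;d)^{0,0}$. 3. $H^0(\Omega;d)^{0,0}$ is contained in the subalgebra of $\Omega$ generated by the $\hat J(x)$, $x\in g_0$; and $x\mapsto\hat J(x)$ induces an isomorphism of $\mathcal U(g_0)$ onto that subalgebra. Hence $[W]\mapsto W^{0,0}$ gives an injective algebra homomorphism $\psi: H^0(\Omega;d)\to\mathcal U(g_0)$. 4. If the embedding is principal, that is, if $\mathbb C^n$ is irreducible under the embedded $sl_2$, then $H^0(\Omega;d)$ is commutative. 5. Every $g_0$-module $V$ becomes an $H^0(\Omega;d)$-module by letting $w$ act as $\psi(w)\in\mathcal U(g_0)$. -/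

import Mathlib

open scoped TensorProduct

noncomputable section

namespace FiniteW

/-! ### The Lie algebra `sl_n`, its `sl₂` embedding and its grading

A partition of `n` is given by its Young diagram `μ`; the cell `(l, k)` (row `l`, column `k`,
both counted from `0`) is the label of the basis vector number `(l + 1) + s_k` of the fundamental
representation, where `s_k` is the total size of the first `k` columns. -/

variable (μ : YoungDiagram)

/-- `sl_n`, `n = |μ|`: traceless complex matrices, with rows and columns labelled by the cells. -/
abbrev G := LieAlgebra.SpecialLinear.sl μ.cells ℂ

variable {μ} in
/-- The column of a cell. -/
abbrev col (i : μ.cells) : ℕ := i.1.2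

variable {μ} in
/-- The row of a cell. -/
abbrev row (i : μ.cells) : ℕ := i.1.1

/-- `t₊ = ∑ E_{(l,k),(l,k+1)}`. -/
def tPlus : Matrix μ.cells μ.cells ℂ :=
  Matrix.of fun i j => if row i = row j ∧ col j = col i + 1 then 1 else 0

/-- `t₀`: the cell in column `k = 0, …, r - 1` of a row of length `r` has weight
`(r + 1) / 2 - (k + 1)`. -/
def tZero : Matrix μ.cells μ.cells ℂ :=
  Matrix.diagonal fun i => ((μ.rowLen (row i) : ℂ) + 1) / 2 - ((col i : ℂ) + 1)

/-- `t₋ = ∑ (k + 1) (r - (k + 1)) E_{(l,k+1),(l,k)}`, `r` the length of row `l`. -/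
def tMinus : Matrix μ.cells μ.cells ℂ :=
  Matrix.of fun i j => if row i = row j ∧ col i = col j + 1 then
    ((col j : ℂ) + 1) * ((μ.rowLen (row j) : ℂ) - ((col j : ℂ) + 1)) else 0

/-- The embedding is principal: the fundamental representation `ℂⁿ` is irreducible under the
embedded `sl₂`. -/
def IsPrincipal : Prop :=
  Nonempty μ.cells ∧ ∀ V : Submodule ℂ (μ.cells → ℂ),
    (∀ v ∈ V, (tPlus μ).mulVec v ∈ V ∧ (tZero μ).mulVec v ∈ V ∧ (tMinus μ).mulVec v ∈ V) →
      V = ⊥ ∨ V = ⊤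

/-- The piece `g_m`: the `m`-eigenspace of `ad δ`, where `δ` is diagonal with entry
`const - k` on cells of column `k`; thus `E_{ij}` has grade `col j - col i`. -/
def grade (m : ℤ) : Submodule ℂ (G μ) where
  carrier := {x | ∀ i j, x.1 i j ≠ 0 → (col j : ℤ) - col i = m}
  zero_mem' := by intro i j h; simp at h
  add_mem' := by
    intro x y hx hy i j h
    by_cases h1 : x.1 i j = 0
    · exact hy i j (by intro h2; apply h; simp [h1, h2])
    · exact hx i j h1
  smul_mem' := by
    intro c x hx i j h
    exact hx i j (by intro h2; apply h; simp [h2])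

theorem grade_bracket {a b : ℤ} {x y : G μ} (hx : x ∈ grade μ a) (hy : y ∈ grade μ b) :
    ⁅x, y⁆ ∈ grade μ (a + b) := by
  intro i j h
  rw [LieAlgebra.SpecialLinear.sl_bracket, Matrix.sub_apply, Matrix.mul_apply,
    Matrix.mul_apply] at h
  by_contra hne
  apply h
  rw [Finset.sum_eq_zero, Finset.sum_eq_zero, sub_zero]
  · intro k _
    by_contra h0
    have h1 := hy i k (left_ne_zero_of_mul h0)
    have h2 := hx k j (right_ne_zero_of_mul h0)
    omega
  · intro k _
    by_contra h0
    have h1 := hx i k (left_ne_zero_of_mul h0)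
    have h2 := hy k j (right_ne_zero_of_mul h0)
    omega

/-- The subalgebra `g_0` of grade `0`. -/
def G0 : LieSubalgebra ℂ (G μ) where
  __ := grade μ 0
  lie_mem' := by
    intro x y hx hy
    simpa using grade_bracket μ hx hy

/-- The index set of the basis `t_α = E_{ij}` (`α = (i, j)`, `col i < col j`) of `g_+`. -/
abbrev Pos := {α : μ.cells × μ.cells // col α.1 < col α.2}

variable {μ} in
/-- The grade of `t_α`. -/
abbrev ht (α : Pos μ) : ℤ := (col α.1.2 : ℤ) - col α.1.1

variable {μ} in
theorem Pos.ne (α : Pos μ) : α.1.2 ≠ α.1.1 := by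
  intro h
  have := α.2
  rw [h] at this
  exact lt_irrefl _ this

variable {μ} in
/-- For `t_α = E_{ij}`, the element `t^α = E_{ji}` of `g_-`, dual to `t_α` with respect to the
trace form `(x, y) = Tr (x y)`: the coordinate function `J^α` is `x ↦ Tr (t^α x)`. -/
def dualRoot (α : Pos μ) : G μ := LieAlgebra.SpecialLinear.single α.1.2 α.1.1 α.ne 1

variable {μ} in
/-- `χ(J^α)`: the `α`-coordinate of `t₊`. -/
def chi (α : Pos μ) : ℂ := tPlus μ α.1.1 α.1.2

/-! ### The BRST algebra -/

/-- The Clifford algebra `Cl(g_+ ⊕ g_+^*)`, in the coordinates on `g_+` given by the `t_α`. -/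
abbrev Ghost := CliffordAlgebra (QuadraticForm.dualProd ℂ (Pos μ → ℂ))

/-- `Ω = U g ⊗ Cl(g_+ ⊕ g_+^*)`. -/
abbrev Omega := UniversalEnvelopingAlgebra ℂ (G μ) ⊗[ℂ] Ghost μ

variable {μ}

/-- The generators `J`, for all elements of `g`; in this notation `J^a` is `J (t^a)`. -/
def J (x : G μ) : Omega μ := UniversalEnvelopingAlgebra.ι ℂ x ⊗ₜ 1

/-- The ghosts `c_α`. -/
def c (α : Pos μ) : Omega μ :=
  1 ⊗ₜ CliffordAlgebra.ι (QuadraticForm.dualProd ℂ (Pos μ → ℂ)) (0, Pi.single α 1)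

/-- The antighosts `b^α`. -/
def b (α : Pos μ) : Omega μ :=
  1 ⊗ₜ CliffordAlgebra.ι (QuadraticForm.dualProd ℂ (Pos μ → ℂ)) (LinearMap.proj α, 0)

/-- For `x = t^a` and `α, β`: the structure constant `f^{aβ}_γ`, that is, the coefficient
of `J^γ` in `[J^a, J^β]`. -/
def structConst (x : G μ) (β γ : Pos μ) : ℂ := (⁅x, dualRoot β⁆ : G μ).1 γ.1.2 γ.1.1

variable (μ) in
/-- The BRST charge
`Q = (J^α - χ(J^α)) c_α - ½ f^{αβ}_γ b^γ c_α c_β` (summation over repeated indices). -/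
def Q : Omega μ :=
  ∑ α : Pos μ, (J (dualRoot α) - algebraMap ℂ (Omega μ) (chi α)) * c α -
    (1 / 2 : ℂ) • ∑ α : Pos μ, ∑ β : Pos μ, ∑ γ : Pos μ,
      structConst (dualRoot α) β γ • (b γ * c α * c β)

/-- The hatted generators `Ĵ^a = J^a + f^{aβ}_γ b^γ c_β`. -/
def Jhat (x : G μ) : Omega μ :=
  J x + ∑ β : Pos μ, ∑ γ : Pos μ, structConst x β γ • (b γ * c β)

/-- The homogeneous generators of `Ω` and their bidegrees: `(m, -m)` for `J x`, `x ∈ g_m` (so that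
`J^a` has bidegree `(-k, k)` if `t_a ∈ g_k`), and `(k, 1 - k)`, `(-k, k - 1)` for `c_α`, `b^α` with
`t_α ∈ g_k`. -/
inductive IsGen : ℤ × ℤ → Omega μ → Prop
  | J (m : ℤ) (x : G μ) (hx : x ∈ grade μ m) : IsGen (m, -m) (J x)
  | c (α : Pos μ) : IsGen (ht α, 1 - ht α) (c α)
  | b (α : Pos μ) : IsGen (-ht α, ht α - 1) (b α)

/-- Products of homogeneous generators, with their bidegrees. -/
inductive IsMonomial : ℤ × ℤ → Omega μ → Prop
  | one : IsMonomial 0 1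
  | cons {p q : ℤ × ℤ} {x y : Omega μ} (hx : IsGen p x) (hy : IsMonomial q y) :
      IsMonomial (p + q) (x * y)

variable (μ) in
/-- The bigraded piece `Ω^{k,l}`. -/
def bideg (p : ℤ × ℤ) : Submodule ℂ (Omega μ) := Submodule.span ℂ {X | IsMonomial p X}

theorem IsMonomial.mul {p q : ℤ × ℤ} {x y : Omega μ} (hx : IsMonomial p x)
    (hy : IsMonomial q y) : IsMonomial (p + q) (x * y) := by
  induction hx with
  | one => simpa using hy
  | cons h _ ih => rw [add_assoc, mul_assoc]; exact IsMonomial.cons h ih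

theorem IsGen.isMonomial {p : ℤ × ℤ} {x : Omega μ} (hx : IsGen p x) : IsMonomial p x := by
  simpa using IsMonomial.cons hx IsMonomial.one

theorem bideg_mul {p q : ℤ × ℤ} {x y : Omega μ} (hx : x ∈ bideg μ p) (hy : y ∈ bideg μ q) :
    x * y ∈ bideg μ (p + q) := by
  have h := Submodule.mul_mem_mul hx hy
  rw [bideg, bideg, Submodule.span_mul_span] at h
  refine Submodule.span_mono ?_ h
  rintro _ ⟨u, hu, v, hv, rfl⟩
  exact hu.mul hv

instance bideg_gradedMonoid : SetLike.GradedMonoid (bideg μ) where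
  one_mem := Submodule.subset_span IsMonomial.one
  mul_mem _ _ _ _ hx hy := bideg_mul hx hy

/-! #### The bigrading is a direct sum decomposition -/

/-- The component of grade `m` of an element of `g`. -/
def gradePart (m : ℤ) (x : G μ) : G μ :=
  ⟨Matrix.of fun i j => if (col j : ℤ) - col i = m then x.1 i j else 0, by
    have hx : Matrix.trace x.1 = 0 := x.2
    change Matrix.trace _ = 0
    by_cases hm : m = 0
    · simpa [Matrix.trace, hm] using hx
    · simp [Matrix.trace, Ne.symm hm]⟩

theorem gradePart_mem (m : ℤ) (x : G μ) : gradePart m x ∈ grade μ m := by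
  intro i j h
  by_contra h2
  exact h (by simp [gradePart, h2])

theorem sum_gradePart (x : G μ) :
    ∑ m ∈ (Finset.univ : Finset (μ.cells × μ.cells)).image
      (fun ij => (col ij.2 : ℤ) - col ij.1), gradePart m x = x := by
  apply Subtype.ext
  rw [AddSubmonoidClass.coe_finsetSum]
  ext i j
  rw [Matrix.sum_apply]
  simp only [gradePart, Matrix.of_apply]
  rw [Finset.sum_ite_eq, if_pos]
  exact Finset.mem_image.2 ⟨(i, j), Finset.mem_univ _, rfl⟩

theorem gens_span (S : Subalgebra ℂ (Omega μ)) (hJ : ∀ x, J x ∈ S) (hc : ∀ α, c α ∈ S)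
    (hb : ∀ α, b α ∈ S) : S = ⊤ := by
  have hU : ∀ u : UniversalEnvelopingAlgebra ℂ (G μ), u ⊗ₜ[ℂ] (1 : Ghost μ) ∈ S := by
    let : LieRing (Omega μ) := LieRing.ofAssociativeRing
    let : LieRing (UniversalEnvelopingAlgebra ℂ (G μ)) := LieRing.ofAssociativeRing
    let inc : UniversalEnvelopingAlgebra ℂ (G μ) →ₐ[ℂ] Omega μ :=
      Algebra.TensorProduct.includeLeft
    let T : Subalgebra ℂ (UniversalEnvelopingAlgebra ℂ (G μ)) := S.comap inc
    let : LieRing T := LieRing.ofAssociativeRing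
    let f : G μ →ₗ⁅ℂ⁆ T :=
      { toFun := fun x => ⟨UniversalEnvelopingAlgebra.ι ℂ x, hJ x⟩
        map_add' := fun x y => Subtype.ext (by simp)
        map_smul' := fun r x => Subtype.ext (by simp)
        map_lie' := fun {x y} => Subtype.ext (by
          simp [LieRing.of_associative_ring_bracket]) }
    have h : T.val.comp (UniversalEnvelopingAlgebra.lift ℂ f) = AlgHom.id ℂ _ := by
      apply UniversalEnvelopingAlgebra.hom_ext
      ext x
      change ((UniversalEnvelopingAlgebra.lift ℂ f (UniversalEnvelopingAlgebra.ι ℂ x) : T) :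
        UniversalEnvelopingAlgebra ℂ (G μ)) = UniversalEnvelopingAlgebra.ι ℂ x
      rw [UniversalEnvelopingAlgebra.lift_ι_apply]
      rfl
    intro u
    have h2 := (UniversalEnvelopingAlgebra.lift ℂ f u).2
    have h3 := DFunLike.congr_fun h u
    change ((UniversalEnvelopingAlgebra.lift ℂ f u : T) :
        UniversalEnvelopingAlgebra ℂ (G μ)) = u at h3
    rw [h3] at h2
    exact h2
  have hG : ∀ v : Ghost μ, (1 : UniversalEnvelopingAlgebra ℂ (G μ)) ⊗ₜ[ℂ] v ∈ S := by
    intro v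
    induction v using CliffordAlgebra.induction with
    | algebraMap r =>
      rw [Algebra.algebraMap_eq_smul_one, TensorProduct.tmul_smul]
      exact S.smul_mem S.one_mem r
    | ι x =>
      obtain ⟨f, x⟩ := x
      have h1 : (f, x) = ∑ α : Pos μ, f (Pi.single α 1) • ((LinearMap.proj α, 0) :
            Module.Dual ℂ (Pos μ → ℂ) × (Pos μ → ℂ)) +
          ∑ α : Pos μ, x α • ((0, Pi.single α 1) :
            Module.Dual ℂ (Pos μ → ℂ) × (Pos μ → ℂ)) := by
        apply Prod.ext
        · apply LinearMap.pi_ext'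
          intro β
          ext
          simp [Prod.fst_sum, Pi.single_apply]
        · simp only [Prod.snd_add, Prod.snd_sum, Prod.smul_snd, smul_zero,
            Finset.sum_const_zero, zero_add]
          ext β
          simp [Finset.sum_apply, Pi.single_apply]
      rw [h1, map_add, map_sum, map_sum, TensorProduct.tmul_add, TensorProduct.tmul_sum,
        TensorProduct.tmul_sum]
      refine S.add_mem (S.sum_mem fun α _ => ?_) (S.sum_mem fun α _ => ?_)
      · rw [map_smul, TensorProduct.tmul_smul]
        exact S.smul_mem (hb α) _
      · rw [map_smul, TensorProduct.tmul_smul]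
        exact S.smul_mem (hc α) _
    | mul a b ha hb =>
      have := S.mul_mem ha hb
      rwa [Algebra.TensorProduct.tmul_mul_tmul, one_mul] at this
    | add a b ha hb =>
      rw [TensorProduct.tmul_add]
      exact S.add_mem ha hb
  rw [eq_top_iff]
  intro X hX
  clear hX
  induction X using TensorProduct.induction_on with
  | zero => exact S.zero_mem
  | tmul u v =>
    have := S.mul_mem (hU u) (hG v)
    rwa [Algebra.TensorProduct.tmul_mul_tmul, one_mul, mul_one] at this
  | add x y hx hy => exact S.add_mem hx hy

theorem iSup_bideg : ⨆ p, bideg μ p = ⊤ := by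
  let S : Subalgebra ℂ (Omega μ) := (⨆ p, bideg μ p).toSubalgebra
    (Submodule.mem_iSup_of_mem 0 (Submodule.subset_span IsMonomial.one)) (by
      intro x y hx hy
      have h := Submodule.mul_mem_mul hx hy
      rw [Submodule.iSup_mul] at h
      simp_rw [Submodule.mul_iSup] at h
      refine (iSup_le fun p => iSup_le fun q => ?_ : _ ≤ ⨆ p, bideg μ p) h
      refine le_trans ?_ (le_iSup _ (p + q))
      rw [Submodule.mul_le]
      intro x hx y hy
      exact bideg_mul hx hy)
  have hgen : ∀ {p} {x : Omega μ}, IsGen p x → x ∈ S := fun h =>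
    Submodule.mem_iSup_of_mem _ (Submodule.subset_span h.isMonomial)
  have h : S = ⊤ := gens_span S (fun x => by
      have h : J x = ∑ m ∈ (Finset.univ : Finset (μ.cells × μ.cells)).image
          (fun ij => (col ij.2 : ℤ) - col ij.1), J (gradePart m x) := by
        conv_lhs => rw [← sum_gradePart x]
        simp only [J, map_sum, TensorProduct.sum_tmul]
      rw [h]
      exact S.sum_mem fun m _ => hgen (IsGen.J m _ (gradePart_mem m x)))
    (fun α => hgen (IsGen.c α)) (fun α => hgen (IsGen.b α))
  rw [eq_top_iff]
  intro X _
  have : X ∈ S := by rw [h]; trivial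
  exact this

theorem c_mul_b_add (α β : Pos μ) :
    b α * c β + c β * b α = if α = β then 1 else 0 := by
  rw [b, c, Algebra.TensorProduct.tmul_mul_tmul, Algebra.TensorProduct.tmul_mul_tmul,
    ← TensorProduct.tmul_add, CliffordAlgebra.ι_mul_ι_add_swap]
  have h : QuadraticMap.polar (QuadraticForm.dualProd ℂ (Pos μ → ℂ))
      ((LinearMap.proj α, 0) : Module.Dual ℂ (Pos μ → ℂ) × (Pos μ → ℂ)) (0, Pi.single β 1) =
        if α = β then 1 else 0 := by
    simp [QuadraticMap.polar, Pi.single_apply]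
  rw [h]
  split_ifs
  · simp [Algebra.TensorProduct.one_def]
  · simp

theorem c_mul_c_add (α β : Pos μ) : c α * c β + c β * c α = 0 := by
  rw [c, c, Algebra.TensorProduct.tmul_mul_tmul, Algebra.TensorProduct.tmul_mul_tmul,
    ← TensorProduct.tmul_add, CliffordAlgebra.ι_mul_ι_add_swap]
  simp [QuadraticMap.polar]

theorem b_mul_b_add (α β : Pos μ) : b α * b β + b β * b α = 0 := by
  rw [b, b, Algebra.TensorProduct.tmul_mul_tmul, Algebra.TensorProduct.tmul_mul_tmul,
    ← TensorProduct.tmul_add, CliffordAlgebra.ι_mul_ι_add_swap]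
  simp [QuadraticMap.polar]

/-- The grading element `δ` of `sl_n`. -/
def delta (μ : YoungDiagram) : G μ :=
  ⟨Matrix.diagonal fun i =>
      (∑ j : μ.cells, (col j : ℂ)) / (Fintype.card μ.cells : ℂ) - (col i : ℂ), by
    change Matrix.trace _ = 0
    rw [Matrix.trace_diagonal, Finset.sum_sub_distrib, Finset.sum_const, Finset.card_univ,
      nsmul_eq_mul]
    by_cases h : Fintype.card μ.cells = 0
    · have := Fintype.card_eq_zero_iff.1 h
      simp
    · have h2 : (Fintype.card μ.cells : ℂ) ≠ 0 := by exact_mod_cast h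
      rw [mul_div_cancel₀ _ h2, sub_self]⟩

theorem delta_bracket {m : ℤ} {x : G μ} (hx : x ∈ grade μ m) : ⁅delta μ, x⁆ = (m : ℂ) • x := by
  apply Subtype.ext
  rw [LieAlgebra.SpecialLinear.sl_bracket]
  ext i j
  rw [Matrix.sub_apply, delta, Matrix.diagonal_mul, Matrix.mul_diagonal]
  change _ = (m : ℂ) * x.1 i j
  by_cases h : x.1 i j = 0
  · simp [h]
  · have := hx i j h
    rw [← this]
    push_cast
    ring

theorem J_mul_sub (x y : G μ) : J x * J y - J y * J x = J ⁅x, y⁆ := by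
  let _ : LieRing (UniversalEnvelopingAlgebra ℂ (G μ)) := LieRing.ofAssociativeRing
  rw [J, J, J, Algebra.TensorProduct.tmul_mul_tmul, Algebra.TensorProduct.tmul_mul_tmul,
    ← TensorProduct.sub_tmul, LieHom.map_lie, LieRing.of_associative_ring_bracket, one_mul]

theorem J_mul_c (x : G μ) (α : Pos μ) : J x * c α = c α * J x := by
  simp [J, c]

theorem J_mul_b (x : G μ) (α : Pos μ) : J x * b α = b α * J x := by
  simp [J, b]

/-- An element of `Ω` whose adjoint action has `Ω^{k,l}` as eigenspace, with eigenvalue `k + i l`. -/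
def bigradingElement (μ : YoungDiagram) : Omega μ :=
  (1 - Complex.I) • J (delta μ) +
    ∑ α : Pos μ, ((ht α : ℂ) + Complex.I * (1 - (ht α : ℂ))) • (c α * b α)

/-- The eigenvalue attached to a bidegree. -/
def eigenval (p : ℤ × ℤ) : ℂ := (p.1 : ℂ) + Complex.I * (p.2 : ℂ)

theorem eigenval_injective : Function.Injective eigenval := by
  intro p q h
  have h1 := congrArg Complex.re h
  have h2 := congrArg Complex.im h
  simp [eigenval] at h1 h2
  exact Prod.ext h1 h2

theorem comm_c (β α : Pos μ) :
    c β * b β * c α - c α * (c β * b β) = if β = α then c α else 0 := by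
  have h1 := c_mul_b_add β α
  have h2 := c_mul_c_add α β
  have h3 : c β * b β * c α - c α * (c β * b β) =
      c β * (b β * c α + c α * b β) - (c α * c β + c β * c α) * b β := by noncomm_ring
  rw [h3, h1, h2]
  split_ifs with h
  · simp [h]
  · simp

theorem comm_b (β α : Pos μ) :
    c β * b β * b α - b α * (c β * b β) = if β = α then - b α else 0 := by
  have h1 := c_mul_b_add α β
  have h2 := b_mul_b_add α β
  have h3 : c β * b β * b α - b α * (c β * b β) =
      c β * (b α * b β + b β * b α) - (b α * c β + c β * b α) * b β := by noncomm_ring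
  rw [h3, h1, h2]
  by_cases h : β = α
  · simp [h]
  · simp [h, Ne.symm h]

theorem comm_gen {p : ℤ × ℤ} {x : Omega μ} (hx : IsGen p x) :
    bigradingElement μ * x - x * bigradingElement μ = eigenval p • x := by
  rw [bigradingElement, add_mul, mul_add, Finset.sum_mul, Finset.mul_sum, add_sub_add_comm,
    ← Finset.sum_sub_distrib]
  simp_rw [smul_mul_assoc, mul_smul_comm, ← smul_sub]
  cases hx with
  | J m x hx =>
    rw [J_mul_sub, delta_bracket hx]
    have h : J ((m : ℂ) • x) = (m : ℂ) • J x := by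
      simp [J, TensorProduct.smul_tmul']
    rw [h, Finset.sum_eq_zero, add_zero, smul_smul, eigenval]
    · push_cast
      congr 1
      ring
    · intro α _
      rw [mul_assoc, ← J_mul_b, ← mul_assoc, ← J_mul_c, mul_assoc, sub_self, smul_zero]
  | c α =>
    simp_rw [comm_c]
    simp [J_mul_c, eigenval]
  | b α =>
    simp_rw [comm_b]
    simp only [J_mul_b, sub_self, smul_zero, zero_add, smul_ite, Finset.sum_ite_eq',
      Finset.mem_univ, if_true, eigenval]
    rw [smul_neg, ← neg_smul]
    push_cast
    congr 1
    ring

theorem comm_monomial {p : ℤ × ℤ} {x : Omega μ} (hx : IsMonomial p x) :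
    bigradingElement μ * x - x * bigradingElement μ = eigenval p • x := by
  induction hx with
  | one => simp [eigenval]
  | @cons p q x y hx _ ih =>
    have h1 := comm_gen hx
    have h : bigradingElement μ * (x * y) - x * y * bigradingElement μ =
        (bigradingElement μ * x - x * bigradingElement μ) * y +
          x * (bigradingElement μ * y - y * bigradingElement μ) := by noncomm_ring
    rw [h, h1, ih, smul_mul_assoc, mul_smul_comm, ← add_smul]
    congr 1
    simp only [eigenval, Prod.fst_add, Prod.snd_add]
    push_cast
    ring

theorem bideg_isInternal : DirectSum.IsInternal (bideg μ) := by
  rw [DirectSum.isInternal_submodule_iff_iSupIndep_and_iSup_eq_top]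
  refine ⟨?_, iSup_bideg⟩
  let f : Module.End ℂ (Omega μ) :=
    LinearMap.mulLeft ℂ (bigradingElement μ) - LinearMap.mulRight ℂ (bigradingElement μ)
  refine ((Module.End.eigenspaces_iSupIndep f).comp eigenval_injective).mono fun p => ?_
  rw [bideg, Submodule.span_le]
  intro x hx
  exact Module.End.mem_eigenspace_iff.2 (comm_monomial hx)

/-- `Ω = ⨁ Ω^{k,l}` is a bigraded algebra. -/
instance bideg_gradedAlgebra : GradedAlgebra (bideg μ) where
  __ := bideg_gradedMonoid
  toDecomposition := bideg_isInternal.chooseDecomposition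

/-- The component `X^{k,l}` of `X` of bidegree `p = (k, l)`. -/
def component (p : ℤ × ℤ) (X : Omega μ) : Omega μ := DirectSum.decompose (bideg μ) X p

/-! ### The BRST differential and its zeroth cohomology -/

variable (μ) in
/-- The piece `Ω^k` of (total) degree `k`, where `J`, `c` and `b` have degrees `0`, `1`, `-1`. -/
def degPiece (k : ℤ) : Submodule ℂ (Omega μ) := ⨆ p : ℤ, bideg μ (p, k - p)

variable (μ) in
/-- The sign automorphism `X ↦ (-1)^{deg X} X`. -/
def parity : Omega μ →ₐ[ℂ] Omega μ :=
  Algebra.TensorProduct.map (AlgHom.id ℂ _) CliffordAlgebra.involute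

variable (μ) in
/-- The differential `d X = [Q, X] = Q X - (-1)^{deg X} X Q`. -/
def d : Omega μ →ₗ[ℂ] Omega μ :=
  LinearMap.mulLeft ℂ (Q μ) - (LinearMap.mulRight ℂ (Q μ)).comp (parity μ).toLinearMap

theorem d_apply (X : Omega μ) : d μ X = Q μ * X - parity μ X * Q μ := rfl

theorem parity_gen {p : ℤ × ℤ} {x : Omega μ} (hx : IsGen p x) :
    parity μ x = ((p.1 + p.2).negOnePow : ℤ) • x := by
  cases hx with
  | J m x hx => simp [parity, J]
  | c α => simp [parity, c, TensorProduct.tmul_neg]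
  | b α =>
    have h : -ht α + (ht α - 1) = -1 := by ring
    rw [h]
    simp [parity, b, TensorProduct.tmul_neg]

theorem parity_monomial {p : ℤ × ℤ} {x : Omega μ} (hx : IsMonomial p x) :
    parity μ x = ((p.1 + p.2).negOnePow : ℤ) • x := by
  induction hx with
  | one => simp
  | @cons p q x y hx _ ih =>
    rw [map_mul, ih, parity_gen hx, smul_mul_smul_comm]
    congr 1
    rw [Prod.fst_add, Prod.snd_add, add_add_add_comm, Int.negOnePow_add (p.1 + p.2),
      Units.val_mul]

theorem parity_degPiece {k : ℤ} {X : Omega μ} (hX : X ∈ degPiece μ k) :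
    parity μ X = (k.negOnePow : ℤ) • X := by
  let T : Submodule ℂ (Omega μ) :=
    LinearMap.ker ((parity μ).toLinearMap - (k.negOnePow : ℤ) • LinearMap.id)
  have h : degPiece μ k ≤ T := by
    refine iSup_le fun p => ?_
    rw [bideg, Submodule.span_le]
    intro x hx
    change _ = _
    have := parity_monomial hx
    simp only [add_sub_cancel] at this
    rw [LinearMap.sub_apply, LinearMap.smul_apply, LinearMap.id_apply, sub_eq_zero]
    exact this
  exact sub_eq_zero.1 (LinearMap.mem_ker.1 (h hX))

theorem degPiece_mul {k l : ℤ} {X Y : Omega μ} (hX : X ∈ degPiece μ k) (hY : Y ∈ degPiece μ l) :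
    X * Y ∈ degPiece μ (k + l) := by
  have h := Submodule.mul_mem_mul hX hY
  rw [degPiece, degPiece, Submodule.iSup_mul] at h
  simp_rw [Submodule.mul_iSup] at h
  refine (iSup_le fun p => iSup_le fun q => ?_ : _ ≤ degPiece μ (k + l)) h
  refine le_trans ?_ (le_iSup _ (p + q))
  rw [Submodule.mul_le]
  intro x hx y hy
  have := bideg_mul hx hy
  rwa [Prod.mk_add_mk, sub_add_sub_comm] at this

variable (μ) in
/-- The cocycles of degree `0`. -/
def cocycles : Subalgebra ℂ (Omega μ) where
  carrier := {X | X ∈ degPiece μ 0 ∧ d μ X = 0}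
  mul_mem' := by
    rintro X Y ⟨hX, hdX⟩ ⟨hY, hdY⟩
    refine ⟨by simpa using degPiece_mul hX hY, ?_⟩
    rw [d_apply, sub_eq_zero] at hdX hdY ⊢
    rw [map_mul, ← mul_assoc, hdX, mul_assoc, hdY, mul_assoc]
  add_mem' := by
    rintro X Y ⟨hX, hdX⟩ ⟨hY, hdY⟩
    exact ⟨add_mem hX hY, by rw [map_add, hdX, hdY, add_zero]⟩
  algebraMap_mem' := by
    intro r
    refine ⟨?_, ?_⟩
    · rw [Algebra.algebraMap_eq_smul_one]
      refine Submodule.smul_mem _ _ (Submodule.mem_iSup_of_mem 0 ?_)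
      exact Submodule.subset_span IsMonomial.one
    · rw [d_apply, AlgHom.commutes, Algebra.commutes, sub_self]

variable (μ) in
/-- The coboundaries `d(Ω^{-1})`, an ideal of the algebra of cocycles of degree `0`. -/
def coboundaries : Ideal (cocycles μ) where
  carrier := {Z | ∃ Y ∈ degPiece μ (-1), d μ Y = Z}
  add_mem' := by
    rintro Z Z' ⟨Y, hY, h⟩ ⟨Y', hY', h'⟩
    exact ⟨Y + Y', add_mem hY hY', by rw [map_add, h, h']; rfl⟩
  zero_mem' := ⟨0, zero_mem _, by simp⟩
  smul_mem' := by
    rintro ⟨X, hX, hdX⟩ Z ⟨Y, hY, h⟩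
    refine ⟨X * Y, by simpa using degPiece_mul hX hY, ?_⟩
    change _ = X * (Z : Omega μ)
    have hp : parity μ X = X := by simpa using parity_degPiece hX
    rw [d_apply, hp, sub_eq_zero] at hdX
    rw [← h, d_apply, d_apply, map_mul, hp, mul_sub, ← mul_assoc, hdX, mul_assoc, mul_assoc]

instance coboundaries_isTwoSided : (coboundaries μ).IsTwoSided where
  mul_mem_of_left := by
    rintro Z ⟨X, hX, hdX⟩ ⟨Y, hY, h⟩
    refine ⟨Y * X, by simpa using degPiece_mul hY hX, ?_⟩
    change _ = (Z : Omega μ) * X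
    rw [d_apply, sub_eq_zero] at hdX
    rw [← h, d_apply, d_apply, map_mul, sub_mul, mul_assoc, mul_assoc, mul_assoc, hdX]

variable (μ) in
/-- The quantum finite `W` algebra `H^0(Ω; d)`. -/
abbrev W := cocycles μ ⧸ coboundaries μ

/-- The cohomology class of a cocycle. -/
def cls : cocycles μ →ₐ[ℂ] W μ := Ideal.Quotient.mkₐ ℂ (coboundaries μ)

/-! ### The reduced complex -/

variable (μ) in
/-- The subalgebra `Ω_red`, generated by the `Ĵ^a` with `t_a ∈ g_0 ⊕ g_-` (so that the dual
element `t^a` has grade `≥ 0`) and the `c_α`. -/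
def OmegaRed : Subalgebra ℂ (Omega μ) :=
  Algebra.adjoin ℂ ({X | ∃ m : ℤ, 0 ≤ m ∧ ∃ x ∈ grade μ m, X = Jhat x} ∪ Set.range c)

variable (μ) in
/-- The subalgebra of `Ω_red` generated by the `Ĵ^a` with `t_a ∈ g_0`. -/
def OmegaRedZero : Subalgebra ℂ (Omega μ) :=
  Algebra.adjoin ℂ (Set.range fun x : G0 μ => Jhat (x : G μ))

variable (μ) in
/-- The set `H^0(Ω; d)^{0,0}` of the bidegree `(0,0)` components of the cocycles in `Ω_red` of
degree `0`. -/
def miuraImage : Set (Omega μ) :=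
  {Y | ∃ X ∈ cocycles μ, X ∈ OmegaRed μ ∧ component (0, 0) X = Y}

end FiniteW

end

open scoped TensorProduct

noncomputable section

namespace FiniteW

/-! The cohomology is computed by a Koszul argument. On generators, `d b^α` is the constraint `Ĵ^α -
χ(J^α)`, constraints are closed, and `d` maps `Ω_red` into itself (`d_b`, `d_constraint`, `d_Jhat`,
`d_c`). Reordering shows that `Ω` is spanned by products of an element of `Ω_red` with a word in
constraints and antighosts (`kosSpan_eq_top`). Give such a word the sum of the heights `ht` of its
letters as weight. An operator `homot`, which turns constraints into antighosts, satisfies `d h + h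
d = ν` in weight `ν` (`IsKos.laplace_eq`). So the weight pieces are independent, and only weight
`0`, that is `Ω_red`, contributes to cohomology. Since `Ω_red` has nothing in degree `-1`, every
class of degree `0` has exactly one reduced representative. The identity `d² = 0` is never needed.

The homotopy must be defined on all of `Ω` although the spanning products are not known to be free.
It comes from geometry: `g` acts by vector fields on the polynomial functions on the unipotent group
of `g_-`, the big cell of a flag manifold. A function `f` yields the operator `u ↦ u₁ · (u₂ f)(1)`
on `U g`, where `u₁ ⊗ u₂` stands for the coproduct of `u`. It is left linear over `U(g_{≥0})`,
because `g_{≥0}` is the isotropy algebra at the identity. For the coordinates `eps α` of the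
logarithmic derivative along dilations, the rule `vf_eps` produces exactly the homotopy
(`hop_mul_constraint`).

In degree `0`, `Ω_red` is generated by the `Ĵ(x)` with `x ∈ g_{≥0}`. These obey the relations of
`g_{≥0}` and lie in bidegrees `(p, -p)` with `p ≥ 0`, so taking the part `p = 0` is multiplicative.
It is injective on cocycles (`red_cocycle_eq_zero`): write a cocycle as an ordered polynomial in the
`Ĵ`, with top homogeneous part `T`. The top symbol of `d` is the action of `g_-` on `g / g_-` by
derivations, hence these kill `T`. They kill the variables of grade `0`, and on those of `g_+` their
matrix has nonzero determinant (`pairingMatrix_det_ne_zero`). So `T` involves only variables of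
grade `0`, and the `(0,0)` component detects it.

Independence of ordered monomials, needed there and for `U(g_0)`, follows by letting `U g` act
through left invariant differential operators on powers of affine functions (`symU_uWord`). For a
principal embedding the diagram is a single row, so `g_0` is diagonal and `U(g_0)` is commutative.
-/

variable {μ : YoungDiagram}

/-! ### Projections onto `g_-` and `g_{≥ 0}` -/

/-- The coefficient of `t^γ`. -/
def coef (γ : Pos μ) : G μ →ₗ[ℂ] ℂ where
  toFun x := x.1 γ.1.2 γ.1.1
  map_add' _ _ := rfl
  map_smul' _ _ := rfl

theorem coef_dualRoot (γ β : Pos μ) : coef γ (dualRoot β) = if γ = β then 1 else 0 := by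
  change Matrix.single β.1.2 β.1.1 (1 : ℂ) γ.1.2 γ.1.1 = _
  rw [Matrix.single_apply]
  refine if_congr ⟨fun h => Subtype.ext (Prod.ext h.2.symm h.1.symm), ?_⟩ rfl rfl
  rintro rfl
  exact ⟨rfl, rfl⟩

/-- The projection onto `g_-` along `g_{≥ 0}`. -/
def projNeg : G μ →ₗ[ℂ] G μ := ∑ γ, (coef γ).smulRight (dualRoot γ)

theorem projNeg_eq (x : G μ) : projNeg x = ∑ γ, coef γ x • dualRoot γ := by
  simp [projNeg, LinearMap.sum_apply]

/-- The projection onto `g_{≥ 0}` along `g_-`. -/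
def projPar : G μ →ₗ[ℂ] G μ := LinearMap.id - projNeg

theorem projPar_eq (x : G μ) : projPar x = x - projNeg x := rfl

theorem projPar_add_projNeg (x : G μ) : projPar x + projNeg x = x := sub_add_cancel _ _

theorem projNeg_apply (x : G μ) (i j : μ.cells) :
    (projNeg x).1 i j = if col j < col i then x.1 i j else 0 := by
  rw [projNeg_eq, AddSubmonoidClass.coe_finsetSum, Matrix.sum_apply]
  have h : ∀ γ : Pos μ, ((coef γ x • dualRoot γ : G μ) : Matrix μ.cells μ.cells ℂ) i j =
      if γ.1 = (j, i) then x.1 i j else 0 := by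
    intro γ
    change x.1 γ.1.2 γ.1.1 * Matrix.single γ.1.2 γ.1.1 (1 : ℂ) i j = _
    rw [Matrix.single_apply]
    by_cases h : γ.1 = (j, i)
    · simp [h]
    · rw [if_neg h, if_neg (fun h2 => h (Prod.ext h2.2 h2.1)), mul_zero]
  simp_rw [h]
  split_ifs with hc
  · rw [Finset.sum_eq_single ⟨(j, i), hc⟩]
    · simp
    · intro γ _ hγ
      rw [if_neg]
      intro h2
      exact hγ (Subtype.ext h2)
    · simp
  · refine Finset.sum_eq_zero fun γ _ => if_neg fun h2 => hc ?_
    have := γ.2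
    rwa [h2] at this

theorem projPar_apply (x : G μ) (i j : μ.cells) :
    (projPar x).1 i j = if col j < col i then 0 else x.1 i j := by
  change x.1 i j - (projNeg x).1 i j = _
  rw [projNeg_apply]
  split_ifs <;> simp

theorem coef_projNeg (γ : Pos μ) (x : G μ) : coef γ (projNeg x) = coef γ x := by
  change (projNeg x).1 _ _ = _
  rw [projNeg_apply, if_pos γ.2]
  rfl

theorem coef_projPar (γ : Pos μ) (x : G μ) : coef γ (projPar x) = 0 := by
  rw [projPar_eq, map_sub, coef_projNeg, sub_self]

theorem projNeg_dualRoot (γ : Pos μ) : projNeg (dualRoot γ) = dualRoot γ := by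
  rw [projNeg_eq]
  simp [coef_dualRoot]

theorem projPar_projPar (x : G μ) : projPar (projPar x) = projPar x := by
  rw [projPar_eq (projPar x), sub_eq_self, projNeg_eq]
  simp [coef_projPar]

theorem projPar_eq_self_iff (x : G μ) :
    projPar x = x ↔ ∀ i j, col j < col i → x.1 i j = 0 := by
  constructor
  · intro h i j hij
    rw [← h, projPar_apply, if_pos hij]
  · intro h
    apply Subtype.ext
    ext i j
    rw [projPar_apply]
    split_ifs with hij
    · exact (h i j hij).symm
    · rfl

theorem projPar_of_mem_grade {m : ℤ} (hm : 0 ≤ m) {x : G μ} (hx : x ∈ grade μ m) :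
    projPar x = x := by
  rw [projPar_eq_self_iff]
  intro i j hij
  by_contra h
  have := hx i j h
  omega

theorem projPar_lie_projPar (x y : G μ) :
    projPar ⁅projPar x, projPar y⁆ = ⁅projPar x, projPar y⁆ := by
  rw [projPar_eq_self_iff]
  intro i j hij
  rw [LieAlgebra.SpecialLinear.sl_bracket, Matrix.sub_apply, Matrix.mul_apply, Matrix.mul_apply,
    Finset.sum_eq_zero, Finset.sum_eq_zero, sub_zero]
  all_goals
    intro k _
    rw [projPar_apply, projPar_apply]
    by_cases h : col k < col i
    · rw [if_pos h, zero_mul]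
    · rw [if_pos (by omega : col j < col k), mul_zero]

theorem coef_lie_projPar (γ : Pos μ) (x y : G μ) : coef γ ⁅projPar x, projPar y⁆ = 0 := by
  rw [← projPar_lie_projPar, coef_projPar]

theorem projPar_lie_dualRoot (α β : Pos μ) : projPar ⁅dualRoot α, dualRoot β⁆ = 0 := by
  apply Subtype.ext
  ext i j
  rw [projPar_apply]
  split_ifs with h
  · rfl
  · rw [LieAlgebra.SpecialLinear.sl_bracket, Matrix.sub_apply, Matrix.mul_apply, Matrix.mul_apply,
      Finset.sum_eq_zero, Finset.sum_eq_zero, sub_zero]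
    · rfl
    all_goals
      intro k _
      have h1 := α.2
      have h2 := β.2
      change Matrix.single _ _ (1 : ℂ) i k * Matrix.single _ _ (1 : ℂ) k j = 0
      rw [Matrix.single_apply, Matrix.single_apply]
      split_ifs with h3 h4
      · obtain ⟨rfl, rfl⟩ := h3
        have h5 := congrArg col h4.1
        rw [← h4.2] at h
        omega
      all_goals simp

/-! ### Ghost bilinears -/

/-- `J` as a linear map. -/
def JLin : G μ →ₗ[ℂ] Omega μ where
  toFun := J
  map_add' x y := by simp [J, TensorProduct.add_tmul]
  map_smul' r x := by simp [J, TensorProduct.smul_tmul']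

theorem JLin_apply (x : G μ) : JLin x = J x := rfl

/-- The antighost attached to the `g_-`-part of an element of `g`. -/
def bHat : G μ →ₗ[ℂ] Omega μ := ∑ γ, (coef γ).smulRight (b γ)

theorem bHat_eq (x : G μ) : bHat x = ∑ γ, coef γ x • b γ := by
  simp [bHat, LinearMap.sum_apply]

theorem bHat_dualRoot (γ : Pos μ) : bHat (dualRoot γ) = b γ := by
  simp [bHat_eq, coef_dualRoot]

/-- The ghost part of `Ĵ`. -/
def gh : G μ →ₗ[ℂ] Omega μ where
  toFun x := ∑ β, bHat ⁅x, dualRoot β⁆ * c β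
  map_add' x y := by simp [add_mul, Finset.sum_add_distrib]
  map_smul' r x := by simp [Finset.smul_sum]

theorem gh_eq (x : G μ) : gh x = ∑ β, bHat ⁅x, dualRoot β⁆ * c β := rfl

theorem Jhat_eq (x : G μ) : Jhat x = J x + gh x := by
  rw [Jhat, gh_eq]
  congr 1
  refine Finset.sum_congr rfl fun β _ => ?_
  rw [bHat_eq, Finset.sum_mul]
  refine Finset.sum_congr rfl fun γ _ => ?_
  rw [smul_mul_assoc]
  rfl

/-- `Ĵ` as a linear map. -/
def JhatLin : G μ →ₗ[ℂ] Omega μ := JLin + gh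

theorem JhatLin_apply (x : G μ) : JhatLin x = Jhat x := (Jhat_eq x).symm

theorem bHat_c (y : G μ) (α : Pos μ) : bHat y * c α + c α * bHat y = coef α y • 1 := by
  rw [bHat_eq, Finset.sum_mul, Finset.mul_sum, ← Finset.sum_add_distrib]
  simp_rw [smul_mul_assoc, mul_smul_comm, ← smul_add, c_mul_b_add]
  simp

theorem bHat_bHat (x y : G μ) : bHat x * bHat y + bHat y * bHat x = 0 := by
  rw [bHat_eq, bHat_eq, Finset.sum_mul_sum, Finset.sum_mul_sum, Finset.sum_comm,
    ← Finset.sum_add_distrib]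
  refine Finset.sum_eq_zero fun i _ => ?_
  rw [← Finset.sum_add_distrib]
  refine Finset.sum_eq_zero fun j _ => ?_
  rw [smul_mul_smul_comm, smul_mul_smul_comm, mul_comm, ← smul_add, b_mul_b_add, smul_zero]

theorem commutator_bc_c {R : Type*} [Ring R] (u v w : R) :
    u * v * w - w * (u * v) = u * (v * w + w * v) - (u * w + w * u) * v := by noncomm_ring

theorem commutator_mul {R : Type*} [Ring R] (u v w : R) :
    u * (v * w) - v * w * u = (u * v - v * u) * w + v * (u * w - w * u) := by noncomm_ring

theorem anticommutator_mul {R : Type*} [Ring R] (u v w : R) :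
    u * v * w + w * (u * v) = u * (v * w + w * v) - (u * w - w * u) * v := by noncomm_ring

theorem gh_c (x : G μ) (α : Pos μ) :
    gh x * c α - c α * gh x = - ∑ β, coef α ⁅x, dualRoot β⁆ • c β := by
  rw [gh_eq, Finset.sum_mul, Finset.mul_sum, ← Finset.sum_sub_distrib, ← Finset.sum_neg_distrib]
  refine Finset.sum_congr rfl fun β _ => ?_
  rw [commutator_bc_c, c_mul_c_add, bHat_c, mul_zero, zero_sub, smul_mul_assoc, one_mul]

/-- Antighosts transform under `gh x` like `g / g_{≥0}` written on `g_-`: `bHat` sees only the `g_-`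
part before and after the bracket. This is a representation of `g_{≥0}` but not of `g`, whence the
correction terms in `Jhat_Jhat`. -/
theorem gh_bHat (x y : G μ) :
    gh x * bHat y - bHat y * gh x = bHat ⁅x, projNeg y⁆ := by
  rw [gh_eq, Finset.sum_mul, Finset.mul_sum, ← Finset.sum_sub_distrib, projNeg_eq, lie_sum,
    map_sum]
  refine Finset.sum_congr rfl fun β _ => ?_
  rw [commutator_bc_c, bHat_bHat, zero_mul, sub_zero, add_comm, bHat_c, lie_smul, map_smul,
    mul_smul_comm, mul_one]

theorem gh_gh (x y : G μ) : gh x * gh y - gh y * gh x =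
    ∑ β, bHat (⁅x, projNeg ⁅y, dualRoot β⁆⁆ - ⁅y, projNeg ⁅x, dualRoot β⁆⁆) * c β := by
  have h : gh x * gh y - gh y * gh x =
      ∑ β, bHat ⁅x, projNeg ⁅y, dualRoot β⁆⁆ * c β -
        ∑ α, bHat ⁅y, dualRoot α⁆ * ∑ β, coef α ⁅x, dualRoot β⁆ • c β := by
    conv_lhs => rw [gh_eq y]
    rw [Finset.mul_sum, Finset.sum_mul, ← Finset.sum_sub_distrib, ← Finset.sum_sub_distrib]
    refine Finset.sum_congr rfl fun β _ => ?_
    rw [commutator_mul, gh_bHat, gh_c, mul_neg, sub_eq_add_neg]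
  rw [h]
  simp_rw [Finset.mul_sum]
  rw [Finset.sum_comm, ← Finset.sum_sub_distrib]
  refine Finset.sum_congr rfl fun β _ => ?_
  rw [map_sub, sub_mul, projNeg_eq ⁅x, dualRoot β⁆, lie_sum, map_sum, Finset.sum_mul]
  congr 1
  refine Finset.sum_congr rfl fun α _ => ?_
  rw [lie_smul, map_smul, smul_mul_assoc, mul_smul_comm]

theorem J_comm_bHat (x y : G μ) : J x * bHat y = bHat y * J x := by
  rw [bHat_eq, Finset.sum_mul, Finset.mul_sum]
  refine Finset.sum_congr rfl fun β _ => ?_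
  rw [smul_mul_assoc, mul_smul_comm, J_mul_b]

theorem J_comm_gh (x y : G μ) : J x * gh y = gh y * J x := by
  rw [gh_eq, Finset.sum_mul, Finset.mul_sum]
  refine Finset.sum_congr rfl fun β _ => ?_
  rw [← mul_assoc, J_comm_bHat, mul_assoc, J_mul_c, mul_assoc]

theorem Jhat_c (x : G μ) (α : Pos μ) :
    Jhat x * c α - c α * Jhat x = - ∑ β, coef α ⁅x, dualRoot β⁆ • c β := by
  rw [← gh_c, Jhat_eq, add_mul, mul_add, J_mul_c, add_sub_add_left_eq_sub]

theorem Jhat_bHat (x y : G μ) :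
    Jhat x * bHat y - bHat y * Jhat x = bHat ⁅x, projNeg y⁆ := by
  rw [← gh_bHat, Jhat_eq, add_mul, mul_add, J_comm_bHat, add_sub_add_left_eq_sub]

theorem Jhat_b (x : G μ) (α : Pos μ) :
    Jhat x * b α - b α * Jhat x = bHat ⁅x, dualRoot α⁆ := by
  rw [← bHat_dualRoot, Jhat_bHat, projNeg_dualRoot]

/-- The commutator of two hatted generators. -/
theorem Jhat_Jhat (x y : G μ) : Jhat x * Jhat y - Jhat y * Jhat x = Jhat ⁅x, y⁆ +
    ∑ β, bHat (⁅y, projPar ⁅x, dualRoot β⁆⁆ - ⁅x, projPar ⁅y, dualRoot β⁆⁆) * c β := by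
  have h : Jhat x * Jhat y - Jhat y * Jhat x =
      (J x * J y - J y * J x) + (gh x * gh y - gh y * gh x) := by
    rw [Jhat_eq, Jhat_eq, mul_add, mul_add, add_mul, add_mul, add_mul, add_mul, ← J_comm_gh y x,
      J_comm_gh x y]
    abel
  rw [h, J_mul_sub, gh_gh, Jhat_eq, gh_eq, add_assoc, ← Finset.sum_add_distrib]
  congr 1
  refine Finset.sum_congr rfl fun β _ => ?_
  rw [← add_mul, ← map_add]
  congr 2
  -- Writing `projPar` as identity minus `projNeg`, the Jacobi identity absorbs the full double
  -- brackets into the ghost part of `Ĵ[x, y]`.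
  rw [projPar_eq, projPar_eq, lie_sub, lie_sub, lie_lie]
  abel

/-! ### The differential on generators -/

/-- Exchanging the two ghosts of the cubic term turns it into half of `∑ gh(t^α) c_α`, and that
ghost part completes half of the `J` to `Ĵ`. Commutators with `Q` then reduce to the commutation
rules of `Ĵ`. -/
theorem Q_eq : Q μ = (1 / 2 : ℂ) • (∑ α, J (dualRoot α) * c α + ∑ α, Jhat (dualRoot α) * c α) -
    ∑ α : Pos μ, chi α • c α := by
  have h1 : ∑ α : Pos μ, ∑ β : Pos μ, ∑ γ : Pos μ,
      structConst (dualRoot α) β γ • (b γ * c α * c β) = - ∑ α, gh (dualRoot α) * c α := by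
    rw [← Finset.sum_neg_distrib]
    refine Finset.sum_congr rfl fun α _ => ?_
    rw [gh_eq, Finset.sum_mul, ← Finset.sum_neg_distrib]
    refine Finset.sum_congr rfl fun β _ => ?_
    rw [bHat_eq, Finset.sum_mul, Finset.sum_mul, ← Finset.sum_neg_distrib]
    refine Finset.sum_congr rfl fun γ _ => ?_
    rw [smul_mul_assoc, smul_mul_assoc, ← smul_neg, mul_assoc, mul_assoc,
      eq_neg_of_add_eq_zero_left (c_mul_c_add α β), mul_neg]
    rfl
  have h2 : ∑ α : Pos μ, (J (dualRoot α) - algebraMap ℂ (Omega μ) (chi α)) * c α =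
      ∑ α, J (dualRoot α) * c α - ∑ α : Pos μ, chi α • c α := by
    rw [← Finset.sum_sub_distrib]
    refine Finset.sum_congr rfl fun α _ => ?_
    rw [sub_mul, Algebra.smul_def]
  have h3 : ∑ α : Pos μ, Jhat (dualRoot α) * c α =
      ∑ α, J (dualRoot α) * c α + ∑ α, gh (dualRoot α) * c α := by
    rw [← Finset.sum_add_distrib]
    refine Finset.sum_congr rfl fun α _ => ?_
    rw [Jhat_eq, add_mul]
  rw [Q, h1, h2, h3]
  module

theorem parity_J (x : G μ) : parity μ (J x) = J x := by simp [parity, J]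

theorem parity_c (α : Pos μ) : parity μ (c α) = - c α := by
  simp [parity, c, TensorProduct.tmul_neg]

theorem parity_b (α : Pos μ) : parity μ (b α) = - b α := by
  simp [parity, b, TensorProduct.tmul_neg]

theorem parity_bHat (x : G μ) : parity μ (bHat x) = - bHat x := by
  simp [bHat_eq, parity_b]

theorem parity_gh (x : G μ) : parity μ (gh x) = gh x := by
  simp [gh_eq, parity_c, parity_bHat]

theorem parity_Jhat (x : G μ) : parity μ (Jhat x) = Jhat x := by
  rw [Jhat_eq, map_add, parity_J, parity_gh]

theorem parity_Q : parity μ (Q μ) = - Q μ := by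
  simp only [Q_eq, map_sub, map_smul, map_add, map_sum, map_mul, parity_J, parity_Jhat, parity_c,
    mul_neg, smul_neg, Finset.sum_neg_distrib]
  module

theorem parity_parity (X : Omega μ) : parity μ (parity μ X) = X := by
  have h : (parity μ).comp (parity μ) = AlgHom.id ℂ _ := by
    rw [parity, ← Algebra.TensorProduct.map_comp, CliffordAlgebra.involute_comp_involute]
    exact Algebra.TensorProduct.map_id
  exact DFunLike.congr_fun h X

theorem d_mul (X Y : Omega μ) : d μ (X * Y) = d μ X * Y + parity μ X * d μ Y := by
  rw [d_apply, d_apply, d_apply, map_mul]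
  noncomm_ring

theorem parity_d (X : Omega μ) : parity μ (d μ X) = - d μ (parity μ X) := by
  rw [d_apply, d_apply, map_sub, map_mul, map_mul, parity_Q]
  noncomm_ring

theorem d_one : d μ 1 = 0 := by simp [d_apply]

/-- The action of `Ĵ x` on the ghosts is dual to its action on `g_-`, so it cancels the `g_-` part
of `[x, t^α]`. -/
theorem Jhat_sum_J_c (x : G μ) :
    Jhat x * ∑ α, J (dualRoot α) * c α - (∑ α, J (dualRoot α) * c α) * Jhat x =
      ∑ α, J (projPar ⁅x, dualRoot α⁆) * c α := by
  have h : Jhat x * ∑ α, J (dualRoot α) * c α - (∑ α, J (dualRoot α) * c α) * Jhat x =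
      ∑ α, J ⁅x, dualRoot α⁆ * c α -
        ∑ α, J (dualRoot α) * ∑ β, coef α ⁅x, dualRoot β⁆ • c β := by
    rw [Finset.mul_sum, Finset.sum_mul, ← Finset.sum_sub_distrib, ← Finset.sum_sub_distrib]
    refine Finset.sum_congr rfl fun α _ => ?_
    rw [commutator_mul, Jhat_c, mul_neg, ← sub_eq_add_neg, Jhat_eq, add_mul, mul_add,
      J_comm_gh, add_sub_add_right_eq_sub, J_mul_sub]
  rw [h]
  simp_rw [Finset.mul_sum]
  rw [Finset.sum_comm, ← Finset.sum_sub_distrib]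
  refine Finset.sum_congr rfl fun α _ => ?_
  rw [projPar_eq, ← JLin_apply (_ - _), map_sub, sub_mul, projNeg_eq, map_sum, Finset.sum_mul,
    JLin_apply]
  congr 1
  refine Finset.sum_congr rfl fun β _ => ?_
  rw [map_smul, smul_mul_assoc, mul_smul_comm, JLin_apply]

/-- Two signs cancel, one from exchanging the ghosts and one from the skew symmetry of the bracket.
The correction term of `Jhat_Jhat` thereby becomes the ghost part of a hatted generator. -/
theorem sum_bHat_lie_projPar (x : G μ) :
    ∑ α : Pos μ, ∑ β, bHat ⁅dualRoot α, projPar ⁅x, dualRoot β⁆⁆ * c β * c α =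
      ∑ α, gh (projPar ⁅x, dualRoot α⁆) * c α := by
  rw [Finset.sum_comm]
  refine Finset.sum_congr rfl fun β _ => ?_
  rw [gh_eq, Finset.sum_mul]
  refine Finset.sum_congr rfl fun α _ => ?_
  rw [mul_assoc, mul_assoc, eq_neg_of_add_eq_zero_left (c_mul_c_add β α),
    ← lie_skew (dualRoot α) (projPar ⁅x, dualRoot β⁆), map_neg, neg_mul_neg]

theorem Jhat_sum_Jhat_c (x : G μ) :
    Jhat x * ∑ α, Jhat (dualRoot α) * c α - (∑ α, Jhat (dualRoot α) * c α) * Jhat x =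
      ∑ α, Jhat (projPar ⁅x, dualRoot α⁆) * c α + ∑ α, gh (projPar ⁅x, dualRoot α⁆) * c α := by
  have h : Jhat x * ∑ α, Jhat (dualRoot α) * c α -
      (∑ α, Jhat (dualRoot α) * c α) * Jhat x =
      ∑ α, Jhat ⁅x, dualRoot α⁆ * c α +
      ∑ α : Pos μ, ∑ β, bHat ⁅dualRoot α, projPar ⁅x, dualRoot β⁆⁆ * c β * c α -
        ∑ α, Jhat (dualRoot α) * ∑ β, coef α ⁅x, dualRoot β⁆ • c β := by
    rw [Finset.mul_sum, Finset.sum_mul, ← Finset.sum_sub_distrib, ← Finset.sum_add_distrib,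
      ← Finset.sum_sub_distrib]
    refine Finset.sum_congr rfl fun α _ => ?_
    rw [commutator_mul, Jhat_c, mul_neg, ← sub_eq_add_neg, Jhat_Jhat, add_mul, Finset.sum_mul]
    simp_rw [projPar_lie_dualRoot, lie_zero, sub_zero]
  rw [h, sum_bHat_lie_projPar, add_sub_right_comm]
  congr 1
  simp_rw [Finset.mul_sum]
  rw [Finset.sum_comm, ← Finset.sum_sub_distrib]
  refine Finset.sum_congr rfl fun α _ => ?_
  rw [projPar_eq, ← JhatLin_apply (_ - _), map_sub, sub_mul, projNeg_eq, map_sum,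
    Finset.sum_mul, JhatLin_apply]
  congr 1
  refine Finset.sum_congr rfl fun β _ => ?_
  rw [map_smul, smul_mul_assoc, mul_smul_comm, JhatLin_apply]

theorem Jhat_sum_chi_c (x : G μ) :
    Jhat x * ∑ α : Pos μ, chi α • c α - (∑ α : Pos μ, chi α • c α) * Jhat x =
      - ∑ α, (∑ β, chi β * coef β ⁅x, dualRoot α⁆) • c α := by
  rw [Finset.mul_sum, Finset.sum_mul, ← Finset.sum_sub_distrib]
  simp_rw [mul_smul_comm, smul_mul_assoc, ← smul_sub, Jhat_c, smul_neg, Finset.smul_sum,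
    Finset.sum_neg_distrib, Finset.sum_smul, smul_smul]
  rw [Finset.sum_comm]

/-- In the form `Q_eq`, the first sum contributes `J` and the second `Ĵ + gh`, all at the
projections onto `g_{≥0}`; half of the total is `Ĵ`. Only generators of `Ω_red` occur on the right,
so `Ω_red` is stable under `d`. -/
theorem d_Jhat (x : G μ) : d μ (Jhat x) = - ∑ α, (Jhat (projPar ⁅x, dualRoot α⁆) +
    (∑ β, chi β * coef β ⁅x, dualRoot α⁆) • 1) * c α := by
  rw [d_apply, parity_Jhat, ← neg_sub, neg_inj]
  have h4 : Jhat x * Q μ - Q μ * Jhat x = (1 / 2 : ℂ) •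
      ((Jhat x * ∑ α, J (dualRoot α) * c α - (∑ α, J (dualRoot α) * c α) * Jhat x) +
        (Jhat x * ∑ α, Jhat (dualRoot α) * c α - (∑ α, Jhat (dualRoot α) * c α) * Jhat x)) -
      (Jhat x * ∑ α : Pos μ, chi α • c α - (∑ α : Pos μ, chi α • c α) * Jhat x) := by
    rw [Q_eq, mul_sub, sub_mul, mul_smul_comm, smul_mul_assoc, mul_add, add_mul]
    module
  have h6 : ∑ α : Pos μ, Jhat (projPar ⁅x, dualRoot α⁆) * c α =
      ∑ α, J (projPar ⁅x, dualRoot α⁆) * c α + ∑ α, gh (projPar ⁅x, dualRoot α⁆) * c α := by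
    rw [← Finset.sum_add_distrib]
    refine Finset.sum_congr rfl fun α _ => ?_
    rw [Jhat_eq, add_mul]
  rw [h4, Jhat_sum_J_c, Jhat_sum_Jhat_c, Jhat_sum_chi_c]
  simp_rw [add_mul, smul_mul_assoc, one_mul]
  rw [Finset.sum_add_distrib, h6]
  module

/-- The constraint `Ĵ^α - χ(J^α)`. -/
def constraint (α : Pos μ) : Omega μ := Jhat (dualRoot α) - chi α • 1

theorem parity_constraint (α : Pos μ) : parity μ (constraint α) = constraint α := by
  simp [constraint, parity_Jhat]

theorem chi_eq_zero_of_ht {β : Pos μ} (h : ht β ≠ 1) : chi β = 0 := by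
  simp only [chi, tPlus, Matrix.of_apply]
  rw [if_neg]
  intro h2
  apply h
  simp [ht, h2]

/-- `[g_-, g_-]` lies in grades at most `-2`. As `t₊` has grade `1`, this makes `χ` a character of
`g_-`, which is why the constraints are closed. -/
theorem coef_lie_dualRoot_of_ht (α β : Pos μ) {γ : Pos μ} (h : ht γ = 1) :
    coef γ ⁅dualRoot α, dualRoot β⁆ = 0 := by
  have h1 := α.2
  have h2 := β.2
  have mem : ∀ α : Pos μ, dualRoot α ∈ grade μ (- ht α) := by
    intro α i j hij
    change Matrix.single _ _ (1 : ℂ) i j ≠ 0 at hij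
    rw [Matrix.single_apply] at hij
    simp only [ne_eq, ite_eq_right_iff, one_ne_zero, imp_false, not_not] at hij
    rw [← hij.1, ← hij.2]
    simp [ht]
  by_contra h0
  have h4 := grade_bracket μ (mem α) (mem β) _ _ h0
  have h3 := h
  simp only [ht] at h3 h4
  omega

theorem d_constraint (α : Pos μ) : d μ (constraint α) = 0 := by
  have h : ∀ β, (Jhat (projPar ⁅dualRoot α, dualRoot β⁆) +
      (∑ γ, chi γ * coef γ ⁅dualRoot α, dualRoot β⁆) • (1 : Omega μ)) * c β = 0 := by
    intro β
    have h1 : ∑ γ, chi γ * coef γ ⁅dualRoot α, dualRoot β⁆ = 0 := by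
      refine Finset.sum_eq_zero fun γ _ => ?_
      by_cases h : ht γ = 1
      · rw [coef_lie_dualRoot_of_ht α β h, mul_zero]
      · rw [chi_eq_zero_of_ht h, zero_mul]
    rw [h1, projPar_lie_dualRoot, ← JhatLin_apply, map_zero, zero_add, zero_smul, zero_mul]
  rw [constraint, map_sub, map_smul, d_one, smul_zero, sub_zero, d_Jhat]
  simp_rw [h]
  rw [Finset.sum_const_zero, neg_zero]

theorem d_b (α : Pos μ) : d μ (b α) = constraint α := by
  have h1 : (∑ β, J (dualRoot β) * c β) * b α + b α * ∑ β, J (dualRoot β) * c β =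
      J (dualRoot α) := by
    rw [Finset.sum_mul, Finset.mul_sum, ← Finset.sum_add_distrib]
    simp_rw [anticommutator_mul, J_mul_b, sub_self, zero_mul, sub_zero,
      add_comm (c _ * b _), c_mul_b_add]
    simp
  have h2 : (∑ β, Jhat (dualRoot β) * c β) * b α + b α * ∑ β, Jhat (dualRoot β) * c β =
      Jhat (dualRoot α) + gh (dualRoot α) := by
    rw [Finset.sum_mul, Finset.mul_sum, ← Finset.sum_add_distrib]
    simp_rw [anticommutator_mul, Jhat_b, add_comm (c _ * b _), c_mul_b_add]
    rw [Finset.sum_sub_distrib, sub_eq_add_neg, ← Finset.sum_neg_distrib, gh_eq]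
    congr 1
    · simp
    · refine Finset.sum_congr rfl fun β _ => ?_
      rw [← lie_skew, map_neg, neg_mul, neg_neg]
  have h3 : (∑ β : Pos μ, chi β • c β) * b α + b α * ∑ β : Pos μ, chi β • c β = chi α • 1 := by
    rw [Finset.sum_mul, Finset.mul_sum, ← Finset.sum_add_distrib]
    simp_rw [smul_mul_assoc, mul_smul_comm, ← smul_add, add_comm (c _ * b _), c_mul_b_add]
    simp
  have h4 : d μ (b α) = (1 / 2 : ℂ) •
      (((∑ β, J (dualRoot β) * c β) * b α + b α * ∑ β, J (dualRoot β) * c β) +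
        ((∑ β, Jhat (dualRoot β) * c β) * b α + b α * ∑ β, Jhat (dualRoot β) * c β)) -
      ((∑ β : Pos μ, chi β • c β) * b α + b α * ∑ β : Pos μ, chi β • c β) := by
    rw [d_apply, parity_b, Q_eq, neg_mul, sub_neg_eq_add, mul_sub, sub_mul, mul_smul_comm,
      smul_mul_assoc, mul_add, add_mul]
    module
  -- `J + (Ĵ + gh) = 2 Ĵ`, so the factor one half in `Q_eq` leaves exactly `Ĵ - χ`.
  rw [h4, h1, h2, h3, constraint, Jhat_eq]
  module

/-- This is the Chevalley–Eilenberg differential of `g_-`. Only the cubic part of `Q` contributes,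
and no antighosts are left over. -/
theorem d_c (α : Pos μ) : d μ (c α) = (1 / 2 : ℂ) •
    ∑ β, ∑ γ, coef α ⁅dualRoot β, dualRoot γ⁆ • (c γ * c β) := by
  have h1 : (∑ β, J (dualRoot β) * c β) * c α + c α * ∑ β, J (dualRoot β) * c β = 0 := by
    rw [Finset.sum_mul, Finset.mul_sum, ← Finset.sum_add_distrib]
    simp_rw [anticommutator_mul, J_mul_c, sub_self, zero_mul, sub_zero, c_mul_c_add]
    simp
  have h2 : (∑ β, Jhat (dualRoot β) * c β) * c α + c α * ∑ β, Jhat (dualRoot β) * c β =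
      ∑ β, ∑ γ, coef α ⁅dualRoot β, dualRoot γ⁆ • (c γ * c β) := by
    rw [Finset.sum_mul, Finset.mul_sum, ← Finset.sum_add_distrib]
    simp_rw [anticommutator_mul, Jhat_c, c_mul_c_add, mul_zero, zero_sub, neg_mul, neg_neg,
      Finset.sum_mul, smul_mul_assoc]
  have h3 : (∑ β : Pos μ, chi β • c β) * c α + c α * ∑ β : Pos μ, chi β • c β = 0 := by
    rw [Finset.sum_mul, Finset.mul_sum, ← Finset.sum_add_distrib]
    simp_rw [smul_mul_assoc, mul_smul_comm, ← smul_add, c_mul_c_add]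
    simp
  have h4 : d μ (c α) = (1 / 2 : ℂ) •
      (((∑ β, J (dualRoot β) * c β) * c α + c α * ∑ β, J (dualRoot β) * c β) +
        ((∑ β, Jhat (dualRoot β) * c β) * c α + c α * ∑ β, Jhat (dualRoot β) * c β)) -
      ((∑ β : Pos μ, chi β • c β) * c α + c α * ∑ β : Pos μ, chi β • c β) := by
    rw [d_apply, parity_c, Q_eq, neg_mul, sub_neg_eq_add, mul_sub, sub_mul, mul_smul_comm,
      smul_mul_assoc, mul_add, add_mul]
    module
  rw [h4, h1, h2, h3]
  module

/-! ### Algebra homomorphisms out of enveloping algebras -/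

section Enveloping

variable {L A : Type*} [LieRing L] [LieAlgebra ℂ L] [Ring A] [Algebra ℂ A]

/-- The extension to `U L` of a linear map which takes brackets to commutators. -/
def uLift (f : L →ₗ[ℂ] A) (hf : ∀ x y, f ⁅x, y⁆ = f x * f y - f y * f x) :
    UniversalEnvelopingAlgebra ℂ L →ₐ[ℂ] A :=
  let _ : LieRing A := LieRing.ofAssociativeRing
  UniversalEnvelopingAlgebra.lift ℂ
    { f with
      map_lie' := fun {x y} => by
        change f ⁅x, y⁆ = ⁅f x, f y⁆
        rw [hf, LieRing.of_associative_ring_bracket] }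

theorem uLift_ι (f : L →ₗ[ℂ] A) (hf : ∀ x y, f ⁅x, y⁆ = f x * f y - f y * f x) (x : L) :
    uLift f hf (UniversalEnvelopingAlgebra.ι ℂ x) = f x := by
  let _ : LieRing A := LieRing.ofAssociativeRing
  rw [uLift, UniversalEnvelopingAlgebra.lift_ι_apply]
  rfl

theorem ι_lie (x y : L) : UniversalEnvelopingAlgebra.ι ℂ ⁅x, y⁆ =
    UniversalEnvelopingAlgebra.ι ℂ x * UniversalEnvelopingAlgebra.ι ℂ y -
      UniversalEnvelopingAlgebra.ι ℂ y * UniversalEnvelopingAlgebra.ι ℂ x := by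
  let _ : LieRing (UniversalEnvelopingAlgebra ℂ L) := LieRing.ofAssociativeRing
  rw [LieHom.map_lie, LieRing.of_associative_ring_bracket]

theorem adjoin_range_ι :
    Algebra.adjoin ℂ (Set.range (UniversalEnvelopingAlgebra.ι ℂ : L → _)) = ⊤ := by
  let S := Algebra.adjoin ℂ (Set.range (UniversalEnvelopingAlgebra.ι ℂ : L → _))
  let f : L →ₗ[ℂ] S :=
    { toFun := fun x => ⟨UniversalEnvelopingAlgebra.ι ℂ x, Algebra.subset_adjoin ⟨x, rfl⟩⟩
      map_add' := fun x y => Subtype.ext (by simp)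
      map_smul' := fun r x => Subtype.ext (by simp) }
  have hf : ∀ x y, f ⁅x, y⁆ = f x * f y - f y * f x := fun x y => Subtype.ext (ι_lie x y)
  have h : S.val.comp (uLift f hf) = AlgHom.id ℂ _ := by
    let _ : LieRing (UniversalEnvelopingAlgebra ℂ L) := LieRing.ofAssociativeRing
    refine UniversalEnvelopingAlgebra.hom_ext ℂ (LieHom.ext fun x => ?_)
    change ((uLift f hf (UniversalEnvelopingAlgebra.ι ℂ x) : S) :
      UniversalEnvelopingAlgebra ℂ L) = UniversalEnvelopingAlgebra.ι ℂ x
    rw [uLift_ι]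
    rfl
  rw [eq_top_iff]
  intro u _
  have h2 := (uLift f hf u).2
  have h3 : ((uLift f hf u : S) : UniversalEnvelopingAlgebra ℂ L) = u := DFunLike.congr_fun h u
  rwa [h3] at h2

theorem uea_induction {P : UniversalEnvelopingAlgebra ℂ L → Prop} (h1 : P 1)
    (hadd : ∀ u v, P u → P v → P (u + v)) (hsmul : ∀ (r : ℂ) u, P u → P (r • u))
    (hmul : ∀ u x, P u → P (u * UniversalEnvelopingAlgebra.ι ℂ x))
    (u : UniversalEnvelopingAlgebra ℂ L) : P u := by
  -- The elements whose right multiplication preserves `P` form a subalgebra containing the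
  -- generators.
  let S : Subalgebra ℂ (UniversalEnvelopingAlgebra ℂ L) :=
    { carrier := {v | ∀ u, P u → P (u * v)}
      mul_mem' := fun {v w} hv hw u hu => by rw [← mul_assoc]; exact hw _ (hv _ hu)
      add_mem' := fun {v w} hv hw u hu => by rw [mul_add]; exact hadd _ _ (hv _ hu) (hw _ hu)
      algebraMap_mem' := fun r u hu => by
        rw [← Algebra.commutes, ← Algebra.smul_def]; exact hsmul _ _ hu }
  have h : S = ⊤ := by
    rw [eq_top_iff, ← adjoin_range_ι, Algebra.adjoin_le_iff]
    rintro _ ⟨x, rfl⟩ u hu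
    exact hmul u x hu
  have hu : u ∈ S := by rw [h]; trivial
  simpa using hu 1 h1

end Enveloping

/-! ### Polynomial functions on the unipotent group of `g_-` -/

section LowerTriangular

variable {R : Type*} [CommRing R]

/-- Matrices vanishing outside of `g_-`. -/
def IsLow (M : Matrix μ.cells μ.cells R) : Prop := ∀ i j, col i ≤ col j → M i j = 0

/-- Matrices vanishing outside of `g_{≤ 0}`. -/
def IsWeakLow (M : Matrix μ.cells μ.cells R) : Prop := ∀ i j, col i < col j → M i j = 0

theorem IsLow.isWeakLow {M : Matrix μ.cells μ.cells R} (h : IsLow M) : IsWeakLow M :=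
  fun i j hij => h i j hij.le

theorem isWeakLow_one : IsWeakLow (1 : Matrix μ.cells μ.cells R) := by
  intro i j hij
  rw [Matrix.one_apply_ne]
  rintro rfl
  exact lt_irrefl _ hij

theorem IsLow.mul_weak {M N : Matrix μ.cells μ.cells R} (hM : IsLow M) (hN : IsWeakLow N) :
    IsLow (M * N) := by
  intro i j hij
  rw [Matrix.mul_apply]
  refine Finset.sum_eq_zero fun k _ => ?_
  by_cases h : col i ≤ col k
  · rw [hM i k h, zero_mul]
  · rw [hN k j (by omega), mul_zero]

theorem IsWeakLow.mul_low {M N : Matrix μ.cells μ.cells R} (hM : IsWeakLow M) (hN : IsLow N) :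
    IsLow (M * N) := by
  intro i j hij
  rw [Matrix.mul_apply]
  refine Finset.sum_eq_zero fun k _ => ?_
  by_cases h : col i < col k
  · rw [hM i k h, zero_mul]
  · rw [hN k j (by omega), mul_zero]

theorem IsLow.add {M N : Matrix μ.cells μ.cells R} (hM : IsLow M) (hN : IsLow N) :
    IsLow (M + N) := fun i j h => by rw [Matrix.add_apply, hM i j h, hN i j h, add_zero]

theorem IsLow.sub {M N : Matrix μ.cells μ.cells R} (hM : IsLow M) (hN : IsLow N) :
    IsLow (M - N) := fun i j h => by rw [Matrix.sub_apply, hM i j h, hN i j h, sub_zero]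

theorem IsWeakLow.add {M N : Matrix μ.cells μ.cells R} (hM : IsWeakLow M) (hN : IsWeakLow N) :
    IsWeakLow (M + N) := fun i j h => by rw [Matrix.add_apply, hM i j h, hN i j h, add_zero]

/-- The projection of a matrix onto `g_-`. -/
def lowPart : Matrix μ.cells μ.cells R →ₗ[R] Matrix μ.cells μ.cells R where
  toFun M := Matrix.of fun i j => if col j < col i then M i j else 0
  map_add' M N := by ext i j; simp only [Matrix.of_apply, Matrix.add_apply]; split_ifs <;> simp
  map_smul' r M := by ext i j; simp only [Matrix.of_apply, Matrix.smul_apply]; split_ifs <;> simp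

theorem lowPart_apply (M : Matrix μ.cells μ.cells R) (i j : μ.cells) :
    lowPart M i j = if col j < col i then M i j else 0 := rfl

theorem isLow_lowPart (M : Matrix μ.cells μ.cells R) : IsLow (lowPart M) := fun i j h => by
  rw [lowPart_apply, if_neg (by omega)]

theorem IsLow.lowPart_eq {M : Matrix μ.cells μ.cells R} (h : IsLow M) : lowPart M = M := by
  ext i j
  rw [lowPart_apply]
  split_ifs with hij
  · rfl
  · rw [h i j (by omega)]

/-- Matrices vanishing outside of `g_{≥ 0}`. -/
def IsUpp (M : Matrix μ.cells μ.cells R) : Prop := ∀ i j, col j < col i → M i j = 0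

theorem IsUpp.lowPart_eq {M : Matrix μ.cells μ.cells R} (h : IsUpp M) : lowPart M = 0 := by
  ext i j
  rw [lowPart_apply]
  split_ifs with hij
  · rw [h i j hij]; rfl
  · rfl

theorem IsUpp.mul {M N : Matrix μ.cells μ.cells R} (hM : IsUpp M) (hN : IsUpp N) :
    IsUpp (M * N) := by
  intro i j hij
  rw [Matrix.mul_apply]
  refine Finset.sum_eq_zero fun k _ => ?_
  by_cases h : col k < col i
  · rw [hM i k h, zero_mul]
  · rw [hN k j (by omega), mul_zero]

theorem isUpp_sub_lowPart (M : Matrix μ.cells μ.cells R) : IsUpp (M - lowPart M) := by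
  intro i j h
  rw [Matrix.sub_apply, lowPart_apply, if_pos h, sub_self]

/-- The cocycle identity for the projection onto a subalgebra along a complementary one. -/
theorem lowPart_commutator (X Y : Matrix μ.cells μ.cells R) :
    lowPart (lowPart X * Y - Y * lowPart X) - lowPart (lowPart Y * X - X * lowPart Y) +
      (lowPart Y * lowPart X - lowPart X * lowPart Y) = lowPart (X * Y - Y * X) := by
  have h1 : lowPart (lowPart X * lowPart Y - lowPart Y * lowPart X) =
      lowPart X * lowPart Y - lowPart Y * lowPart X :=
    (((isLow_lowPart X).mul_weak (isLow_lowPart Y).isWeakLow).sub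
      ((isLow_lowPart Y).mul_weak (isLow_lowPart X).isWeakLow)).lowPart_eq
  have h2 : lowPart ((X - lowPart X) * (Y - lowPart Y)) = 0 :=
    ((isUpp_sub_lowPart X).mul (isUpp_sub_lowPart Y)).lowPart_eq
  have h3 : lowPart ((Y - lowPart Y) * (X - lowPart X)) = 0 :=
    ((isUpp_sub_lowPart Y).mul (isUpp_sub_lowPart X)).lowPart_eq
  -- Split `X` and `Y` into lower and upper parts: products of two upper parts die under `lowPart`,
  -- and the commutator of the lower parts is fixed by it.
  have h4 : X * Y - Y * X = (lowPart X * Y - Y * lowPart X) - (lowPart Y * X - X * lowPart Y) -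
      (lowPart X * lowPart Y - lowPart Y * lowPart X) + (X - lowPart X) * (Y - lowPart Y) -
      (Y - lowPart Y) * (X - lowPart X) := by noncomm_ring
  rw [h4, map_sub lowPart (_ + _), map_add, map_sub lowPart (_ - _ - _),
    map_sub lowPart (_ - _) (_ - _), h1, h2, h3]
  abel

theorem isLow_diagonal_commutator (f : μ.cells → R) {M : Matrix μ.cells μ.cells R}
    (h : IsLow M) : IsLow (Matrix.diagonal f * M - M * Matrix.diagonal f) := by
  intro i j hij
  rw [Matrix.sub_apply, Matrix.diagonal_mul, Matrix.mul_diagonal, h i j hij]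
  ring

end LowerTriangular

/-! ### Entrywise derivatives of matrices -/

section DerivationMatrix

variable {A : Type*} [CommRing A] [Algebra ℂ A] (D : Derivation ℂ A A)

theorem map_derivation_mul (M N : Matrix μ.cells μ.cells A) :
    (M * N).map D = M.map D * N + M * N.map D := by
  ext i j
  simp only [Matrix.map_apply, Matrix.mul_apply, Matrix.add_apply, map_sum, Derivation.leibniz,
    smul_eq_mul, Finset.sum_add_distrib]
  rw [add_comm]
  congr 1
  exact Finset.sum_congr rfl fun k _ => mul_comm _ _

theorem map_derivation_lowPart (M : Matrix μ.cells μ.cells A) :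
    (lowPart M).map D = lowPart (M.map D) := by
  ext i j
  rw [Matrix.map_apply, lowPart_apply, lowPart_apply]
  split_ifs <;> simp

theorem map_derivation_const (x : Matrix μ.cells μ.cells ℂ) :
    (x.map (algebraMap ℂ A)).map D = 0 := by
  ext i j
  simp

theorem map_derivation_one : (1 : Matrix μ.cells μ.cells A).map D = 0 := by
  ext i j
  rw [Matrix.map_apply, Matrix.one_apply]
  split_ifs <;> simp

end DerivationMatrix

/-! ### The universal unipotent matrix and the vector fields on the big cell -/

variable (μ) in
/-- Polynomial functions on the unipotent group with Lie algebra `g_-`. -/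
abbrev Fn := MvPolynomial (Pos μ) ℂ

variable (μ) in
/-- The strictly lower triangular part of the universal point of the unipotent group. -/
def uniLow : Matrix μ.cells μ.cells (Fn μ) :=
  Matrix.of fun i j => if h : col j < col i then MvPolynomial.X ⟨(j, i), h⟩ else 0

variable (μ) in
/-- The universal point of the unipotent group. -/
def uni : Matrix μ.cells μ.cells (Fn μ) := 1 + uniLow μ

theorem isLow_uniLow : IsLow (uniLow μ) := fun i j h => by
  rw [uniLow, Matrix.of_apply, dif_neg (by omega)]

theorem isWeakLow_uni : IsWeakLow (uni μ) := isWeakLow_one.add isLow_uniLow.isWeakLow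

variable (μ) in
/-- The inverse of the universal point. -/
def uniInv : Matrix μ.cells μ.cells (Fn μ) :=
  ∑ k ∈ Finset.range (Finset.univ.sup (col : μ.cells → ℕ) + 1), (-uniLow μ) ^ k

/-- Each strictly lower factor moves by at least one column. Hence the geometric series for the
inverse stops after the largest column number. -/
theorem neg_uniLow_pow (k : ℕ) (i j : μ.cells) (h : col i < col j + k) :
    ((-uniLow μ) ^ k) i j = 0 := by
  induction k generalizing i with
  | zero =>
    rw [pow_zero]
    exact isWeakLow_one i j h
  | succ k ih =>
    rw [pow_succ', Matrix.mul_apply]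
    refine Finset.sum_eq_zero fun l _ => ?_
    by_cases hl : col i ≤ col l
    · rw [Matrix.neg_apply, isLow_uniLow i l hl, neg_zero, zero_mul]
    · rw [ih l (by omega), mul_zero]

theorem uni_mul_uniInv : uni μ * uniInv μ = 1 := by
  have h1 : uni μ = 1 - -uniLow μ := by rw [sub_neg_eq_add]; rfl
  have h2 : (-uniLow μ) ^ (Finset.univ.sup (col : μ.cells → ℕ) + 1) = 0 := by
    ext i j
    rw [neg_uniLow_pow]
    · rfl
    · have := Finset.le_sup (f := (col : μ.cells → ℕ)) (Finset.mem_univ i)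
      omega
  rw [h1, uniInv, mul_neg_geom_sum, h2, sub_zero]

theorem uniInv_mul_uni : uniInv μ * uni μ = 1 := mul_eq_one_comm.1 uni_mul_uniInv

theorem isWeakLow_uniInv : IsWeakLow (uniInv μ) := by
  intro i j h
  rw [uniInv, Matrix.sum_apply]
  exact Finset.sum_eq_zero fun k _ => neg_uniLow_pow k i j (by omega)

/-- A constant matrix. -/
abbrev cst (x : G μ) : Matrix μ.cells μ.cells (Fn μ) := x.1.map (algebraMap ℂ (Fn μ))

theorem cst_lie (x y : G μ) : cst ⁅x, y⁆ = cst x * cst y - cst y * cst x := by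
  refine Matrix.ext fun i j => ?_
  change algebraMap ℂ (Fn μ) ((x.1 * y.1 - y.1 * x.1) i j) = _
  rw [Matrix.sub_apply, Matrix.sub_apply, Matrix.mul_apply, Matrix.mul_apply, Matrix.mul_apply,
    Matrix.mul_apply, map_sub, map_sum, map_sum]
  simp_rw [map_mul]
  rfl

/-- The universal conjugate of an element of `g`. -/
def conj (x : G μ) : Matrix μ.cells μ.cells (Fn μ) := uni μ * cst x * uniInv μ

theorem conj_add (x y : G μ) : conj (x + y) = conj x + conj y := by
  have : cst (x + y) = cst x + cst y := by ext i j; simp [cst]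
  rw [conj, this, mul_add, add_mul]; rfl

theorem conj_smul (r : ℂ) (x : G μ) : conj (r • x) = r • conj x := by
  have : cst (r • x) = r • cst x := by
    refine Matrix.ext fun i j => ?_
    rw [Matrix.smul_apply, Algebra.smul_def]
    exact map_mul (algebraMap ℂ (Fn μ)) r (x.1 i j)
  rw [conj, this, Matrix.mul_smul, Matrix.smul_mul]; rfl

theorem conj_lie (x y : G μ) : conj ⁅x, y⁆ = conj x * conj y - conj y * conj x := by
  have h : ∀ X Y : Matrix μ.cells μ.cells (Fn μ), uni μ * X * uniInv μ * (uni μ * Y * uniInv μ) =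
      uni μ * (X * Y) * uniInv μ := by
    intro X Y
    calc _ = uni μ * X * (uniInv μ * uni μ) * Y * uniInv μ := by noncomm_ring
      _ = _ := by rw [uniInv_mul_uni]; noncomm_ring
  rw [conj, conj, conj, h, h, cst_lie]
  noncomm_ring

/-- The action of `g` by vector fields on the big cell of the flag manifold. -/
def vf (x : G μ) : Derivation ℂ (Fn μ) (Fn μ) :=
  MvPolynomial.mkDerivation ℂ fun α => (lowPart (conj x) * uni μ) α.1.2 α.1.1

/-- Translating the universal point `u` on the right by `x` gives `u x = (u x u⁻¹) u`. Modulo the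
subgroup of `g_{≥0}` acting on the left, only the `g_-` part of `u x u⁻¹` counts. This matrix
equation is used in place of coordinates from here on. -/
theorem uni_map_vf (x : G μ) : (uni μ).map (vf x) = lowPart (conj x) * uni μ := by
  refine Matrix.ext fun i j => ?_
  rw [Matrix.map_apply, uni, Matrix.add_apply, map_add]
  have h1 : vf x ((1 : Matrix μ.cells μ.cells (Fn μ)) i j) = 0 := by
    rw [Matrix.one_apply]
    split_ifs <;> simp
  rw [h1, zero_add, uniLow, Matrix.of_apply]
  split_ifs with h
  · rw [vf, MvPolynomial.mkDerivation_X]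
    rfl
  · rw [map_zero]
    change 0 = (lowPart (conj x) * uni μ) i j
    exact ((isLow_lowPart (conj x)).mul_weak isWeakLow_uni i j (by omega)).symm

theorem uniInv_map_derivation (D : Derivation ℂ (Fn μ) (Fn μ)) :
    (uniInv μ).map D = - (uniInv μ * (uni μ).map D * uniInv μ) := by
  have h := map_derivation_mul D (uni μ) (uniInv μ)
  rw [uni_mul_uniInv, map_derivation_one] at h
  calc (uniInv μ).map D = (uniInv μ * uni μ) * (uniInv μ).map D := by
        rw [uniInv_mul_uni, one_mul]
    _ = uniInv μ * ((uni μ).map D * uniInv μ + uni μ * (uniInv μ).map D) -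
        uniInv μ * (uni μ).map D * uniInv μ := by noncomm_ring
    _ = _ := by rw [← h, mul_zero, zero_sub]

theorem uniInv_map_vf (x : G μ) : (uniInv μ).map (vf x) = - (uniInv μ * lowPart (conj x)) := by
  rw [uniInv_map_derivation, uni_map_vf, mul_assoc, mul_assoc, uni_mul_uniInv, mul_one]

theorem conj_map_vf (x y : G μ) :
    (conj y).map (vf x) = lowPart (conj x) * conj y - conj y * lowPart (conj x) := by
  have h : conj y = uni μ * cst y * uniInv μ := rfl
  rw [h, map_derivation_mul, map_derivation_mul, map_derivation_const, mul_zero, add_zero,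
    uni_map_vf, uniInv_map_vf, mul_neg, ← sub_eq_add_neg]
  simp only [mul_assoc]

/-- Differentiating the matrix equation of `uni` twice reduces the claim to `lowPart_commutator` for
`conj x` and `conj y`. -/
theorem vf_lie (x y : G μ) : vf ⁅x, y⁆ = ⁅vf x, vf y⁆ := by
  apply MvPolynomial.derivation_ext
  intro α
  have key : ∀ x y : G μ, ((uni μ).map (vf y)).map (vf x) =
      lowPart (lowPart (conj x) * conj y - conj y * lowPart (conj x)) * uni μ +
        lowPart (conj y) * lowPart (conj x) * uni μ := by
    intro x y
    rw [uni_map_vf, map_derivation_mul, map_derivation_lowPart, conj_map_vf, uni_map_vf, mul_assoc]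
  have hX : (MvPolynomial.X α : Fn μ) = uni μ α.1.2 α.1.1 := by
    rw [uni, Matrix.add_apply, Matrix.one_apply_ne α.ne, zero_add, uniLow, Matrix.of_apply,
      dif_pos α.2]
  rw [Derivation.commutator_apply, hX]
  change ((uni μ).map (vf ⁅x, y⁆)) _ _ = (((uni μ).map (vf y)).map (vf x)) _ _ -
    (((uni μ).map (vf x)).map (vf y)) _ _
  rw [← Matrix.sub_apply, key, key, uni_map_vf, conj_lie, ← lowPart_commutator, add_mul, sub_mul,
    sub_mul, sub_add_sub_comm]

/-- `vf` as a linear map into operators. -/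
def vfLin : G μ →ₗ[ℂ] Module.End ℂ (Fn μ) where
  toFun x := (vf x : Fn μ →ₗ[ℂ] Fn μ)
  map_add' x y := by
    have : vf (x + y) = vf x + vf y := by
      apply MvPolynomial.derivation_ext
      intro α
      simp [vf, conj_add, add_mul, MvPolynomial.mkDerivation_X]
    rw [this]; rfl
  map_smul' r x := by
    have : vf (r • x) = r • vf x := by
      apply MvPolynomial.derivation_ext
      intro α
      rw [Derivation.smul_apply, vf, vf, MvPolynomial.mkDerivation_X, MvPolynomial.mkDerivation_X,
        conj_smul, ← algebraMap_smul (Fn μ) r (conj x), map_smul, Matrix.smul_mul,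
        Matrix.smul_apply, algebraMap_smul]
    rw [this]; rfl

theorem vfLin_apply (x : G μ) (f : Fn μ) : vfLin x f = vf x f := rfl

theorem vfLin_lie (x y : G μ) : vfLin ⁅x, y⁆ = vfLin x * vfLin y - vfLin y * vfLin x := by
  refine LinearMap.ext fun f => ?_
  change vf ⁅x, y⁆ f = _
  rw [vf_lie, Derivation.commutator_apply]
  rfl

/-- Evaluation at the identity. -/
def ev0 : Fn μ →ₐ[ℂ] ℂ := MvPolynomial.aeval fun _ => 0

theorem uni_map_ev0 : (uni μ).map ev0 = 1 := by
  ext i j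
  rw [Matrix.map_apply, uni, Matrix.add_apply, map_add, uniLow, Matrix.of_apply]
  have : ev0 (if h : col j < col i then (MvPolynomial.X ⟨(j, i), h⟩ : Fn μ) else 0) = 0 := by
    split_ifs <;> simp [ev0]
  rw [this, add_zero, Matrix.one_apply, Matrix.one_apply]
  split_ifs <;> simp

theorem uniInv_map_ev0 : (uniInv μ).map ev0 = 1 := by
  have h : (uni μ * uniInv μ).map ev0 = (uni μ).map ev0 * (uniInv μ).map ev0 :=
    Matrix.map_mul (f := (ev0 : Fn μ →ₐ[ℂ] ℂ).toRingHom)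
  rw [uni_map_ev0, one_mul, uni_mul_uniInv] at h
  rw [← h]
  ext i j
  rw [Matrix.map_apply, Matrix.one_apply, Matrix.one_apply]
  split_ifs <;> simp

theorem conj_map_ev0 (x : G μ) : (conj x).map ev0 = x.1 := by
  have h : ∀ M N : Matrix μ.cells μ.cells (Fn μ), (M * N).map ev0 = M.map ev0 * N.map ev0 :=
    fun M N => Matrix.map_mul (f := (ev0 : Fn μ →ₐ[ℂ] ℂ).toRingHom)
  rw [conj, h, h, uni_map_ev0, uniInv_map_ev0, one_mul, mul_one]
  ext i j
  simp [cst]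

/-- The isotropy algebra of the base point of the flag manifold is `g_{≥0}`, so these vector fields
vanish at the identity. -/
theorem ev0_vf_projPar (x : G μ) (f : Fn μ) : ev0 (vf (projPar x) f) = 0 := by
  induction f using MvPolynomial.induction_on with
  | C a => simp
  | add p q hp hq => rw [map_add, map_add, hp, hq, add_zero]
  | mul_X p α hp =>
    have h : ev0 (vf (projPar x) (MvPolynomial.X α)) = 0 := by
      rw [vf, MvPolynomial.mkDerivation_X]
      have h : ∀ M N : Matrix μ.cells μ.cells (Fn μ), (M * N).map ev0 = M.map ev0 * N.map ev0 :=
        fun M N => Matrix.map_mul (f := (ev0 : Fn μ →ₐ[ℂ] ℂ).toRingHom)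
      change (((lowPart (conj (projPar x)) * uni μ).map ev0) _ _) = 0
      rw [h, uni_map_ev0, mul_one, Matrix.map_apply, lowPart_apply, if_pos α.2]
      change (conj (projPar x)).map ev0 α.1.2 α.1.1 = 0
      rw [conj_map_ev0, projPar_apply, if_pos α.2]
    rw [Derivation.leibniz, map_add, smul_eq_mul, smul_eq_mul, map_mul, map_mul, h, hp, mul_zero,
      mul_zero, add_zero]

/-! ### The logarithmic derivative along dilations -/

variable (μ) in
/-- The logarithmic derivative of the universal point along the dilations. -/
def logDer : Matrix μ.cells μ.cells (Fn μ) :=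
  uniInv μ * Matrix.diagonal (fun i => (col i : Fn μ)) * uni μ -
    Matrix.diagonal (fun i => (col i : Fn μ))

/-- The coordinates of `logDer`. -/
def eps (α : Pos μ) : Fn μ := logDer μ α.1.2 α.1.1

theorem isLow_logDer : IsLow (logDer μ) := by
  -- With `C` the diagonal matrix of columns, `u⁻¹ C u - C = u⁻¹ [C, u]`, and the summand `1` of `u`
  -- commutes with `C`.
  have h : logDer μ = uniInv μ * (Matrix.diagonal (fun i => (col i : Fn μ)) * uniLow μ -
      uniLow μ * Matrix.diagonal (fun i => (col i : Fn μ))) := by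
    have h1 : Matrix.diagonal (fun i => (col i : Fn μ)) =
        uniInv μ * uni μ * Matrix.diagonal (fun i => (col i : Fn μ)) := by
      rw [uniInv_mul_uni, one_mul]
    rw [logDer]
    conv_lhs => enter [2]; rw [h1]
    rw [uni]
    noncomm_ring
  rw [h]
  exact isWeakLow_uniInv.mul_low (isLow_diagonal_commutator _ isLow_uniLow)

theorem logDer_eq : logDer μ = ∑ γ, eps γ • cst (dualRoot γ) := by
  ext1 i j
  rw [Matrix.sum_apply]
  have h : ∀ γ : Pos μ, (eps γ • cst (dualRoot γ)) i j =
      if γ.1 = (j, i) then logDer μ i j else 0 := by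
    intro γ
    change logDer μ γ.1.2 γ.1.1 * algebraMap ℂ (Fn μ) (Matrix.single γ.1.2 γ.1.1 (1 : ℂ) i j) = _
    rw [Matrix.single_apply]
    by_cases h : γ.1 = (j, i)
    · simp [h]
    · rw [if_neg h, if_neg (fun h2 => h (Prod.ext h2.2 h2.1)), map_zero, mul_zero]
  simp_rw [h]
  by_cases hc : col j < col i
  · rw [Finset.sum_eq_single ⟨(j, i), hc⟩]
    · simp
    · intro γ _ hγ
      rw [if_neg]
      intro h2
      exact hγ (Subtype.ext h2)
    · simp
  · rw [isLow_logDer i j (by omega), Finset.sum_eq_zero]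
    intro γ _
    simp

theorem isLow_cst_dualRoot (β : Pos μ) : IsLow (cst (dualRoot β)) := by
  intro i j hij
  change algebraMap ℂ (Fn μ) (Matrix.single β.1.2 β.1.1 (1 : ℂ) i j) = 0
  rw [Matrix.single_apply, if_neg, map_zero]
  rintro ⟨rfl, rfl⟩
  have := β.2
  omega

/-- For `t^β ∈ g_-` the projection `lowPart` is superfluous, so the vector field is left invariant:
`u` has derivative `u t^β`. Hence `u⁻¹ C u` has derivative `[u⁻¹ C u, t^β]`, and `u⁻¹ C u` is
`logDer + C`. -/
theorem logDer_map_vf (β : Pos μ) : (logDer μ).map (vf (dualRoot β)) =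
    (logDer μ * cst (dualRoot β) - cst (dualRoot β) * logDer μ) +
      (Matrix.diagonal (fun i => (col i : Fn μ)) * cst (dualRoot β) -
        cst (dualRoot β) * Matrix.diagonal (fun i => (col i : Fn μ))) := by
  have h1 : lowPart (conj (dualRoot β)) = conj (dualRoot β) := by
    apply IsLow.lowPart_eq
    rw [conj]
    exact (isWeakLow_uni.mul_low (isLow_cst_dualRoot β)).mul_weak isWeakLow_uniInv
  have h2 : (Matrix.diagonal (fun i : μ.cells => (col i : Fn μ))).map (vf (dualRoot β)) = 0 := by
    ext i j
    rw [Matrix.map_apply, Matrix.diagonal_apply]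
    split_ifs <;> simp
  have h3 : ∀ M N : Matrix μ.cells μ.cells (Fn μ), (M - N).map (vf (dualRoot β)) =
      M.map (vf (dualRoot β)) - N.map (vf (dualRoot β)) := by
    intro M N
    ext i j
    simp
  have h4 : uniInv μ * conj (dualRoot β) = cst (dualRoot β) * uniInv μ := by
    rw [conj, ← mul_assoc, ← mul_assoc, uniInv_mul_uni, one_mul]
  have h5 : conj (dualRoot β) * uni μ = uni μ * cst (dualRoot β) := by
    rw [conj, mul_assoc, uniInv_mul_uni, mul_one]
  rw [logDer, h3, map_derivation_mul, map_derivation_mul, h2, mul_zero, add_zero, sub_zero,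
    uni_map_vf, uniInv_map_vf, h1, h4, h5]
  noncomm_ring

/-- The commutator of `C` with `t^β` is `ht β • t^β` and gives the constant term, which becomes the
weight in the homotopy formula. The sum is the coordinate form of `[logDer, t^β]`. -/
theorem vf_eps (α β : Pos μ) : vf (dualRoot β) (eps α) =
    ∑ γ : Pos μ, coef α ⁅dualRoot γ, dualRoot β⁆ • eps γ +
      if α = β then MvPolynomial.C (ht β : ℂ) else 0 := by
  change ((logDer μ).map (vf (dualRoot β))) α.1.2 α.1.1 = _
  rw [logDer_map_vf, Matrix.add_apply]
  congr 1
  · have h : logDer μ * cst (dualRoot β) - cst (dualRoot β) * logDer μ =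
        ∑ γ : Pos μ, eps γ • cst ⁅dualRoot γ, dualRoot β⁆ := by
      rw [logDer_eq, Finset.sum_mul, Finset.mul_sum, ← Finset.sum_sub_distrib]
      refine Finset.sum_congr rfl fun γ _ => ?_
      rw [cst_lie, smul_sub, Matrix.smul_mul, Matrix.mul_smul]
    rw [h, Matrix.sum_apply]
    refine Finset.sum_congr rfl fun γ _ => ?_
    rw [Algebra.smul_def (coef α _), mul_comm]
    rfl
  · rw [Matrix.sub_apply, Matrix.diagonal_mul, Matrix.mul_diagonal]
    change _ * algebraMap ℂ (Fn μ) (coef α (dualRoot β)) -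
      algebraMap ℂ (Fn μ) (coef α (dualRoot β)) * _ = _
    rw [coef_dualRoot]
    split_ifs with h
    · subst h
      simp [ht]
    · simp

theorem ev0_eps (α : Pos μ) : ev0 (eps α) = 0 := by
  have h : ∀ M N : Matrix μ.cells μ.cells (Fn μ), (M * N).map ev0 = M.map ev0 * N.map ev0 :=
    fun M N => Matrix.map_mul (f := (ev0 : Fn μ →ₐ[ℂ] ℂ).toRingHom)
  rw [eps, logDer, Matrix.sub_apply, map_sub]
  change ((uniInv μ * Matrix.diagonal (fun i => (col i : Fn μ)) * uni μ).map ev0) _ _ - _ = 0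
  rw [h, h, uni_map_ev0, uniInv_map_ev0, one_mul, mul_one, Matrix.map_apply, sub_self]

/-! ### The contracting homotopy -/

variable (μ) in
/-- The algebra `U g ⊗ End A`, with `A` the polynomial functions on the unipotent group. -/
abbrev UDiff := UniversalEnvelopingAlgebra ℂ (G μ) ⊗[ℂ] Module.End ℂ (Fn μ)

open UniversalEnvelopingAlgebra in
/-- The map `x ↦ x ⊗ 1 + 1 ⊗ D_x`, with `D_x` the vector field of `x`, on `g`. -/
def vfDiag : G μ →ₗ[ℂ] UDiff μ where
  toFun x := ι ℂ x ⊗ₜ 1 + 1 ⊗ₜ vfLin x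
  map_add' x y := by
    rw [map_add, map_add, TensorProduct.add_tmul, TensorProduct.tmul_add, add_add_add_comm]
  map_smul' r x := by
    rw [map_smul, map_smul, ← TensorProduct.smul_tmul', TensorProduct.tmul_smul, ← smul_add]
    rfl

open UniversalEnvelopingAlgebra in
theorem vfDiag_apply (x : G μ) : vfDiag x = ι ℂ x ⊗ₜ 1 + 1 ⊗ₜ vfLin x := rfl

theorem vfDiag_lie (x y : G μ) : vfDiag ⁅x, y⁆ = vfDiag x * vfDiag y - vfDiag y * vfDiag x := by
  simp only [vfDiag_apply, mul_add, add_mul, Algebra.TensorProduct.tmul_mul_tmul, mul_one,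
    one_mul, ι_lie, vfLin_lie, TensorProduct.sub_tmul, TensorProduct.tmul_sub]
  abel

/-- The extension of `vfDiag` to `U g`. -/
def vfT : UniversalEnvelopingAlgebra ℂ (G μ) →ₐ[ℂ] UDiff μ :=
  uLift (A := UDiff μ) vfDiag vfDiag_lie

theorem vfT_one : vfT (1 : UniversalEnvelopingAlgebra ℂ (G μ)) = 1 := vfT.map_one'

open UniversalEnvelopingAlgebra in
theorem vfT_ι (x : G μ) : vfT (ι ℂ x) = ι ℂ x ⊗ₜ 1 + 1 ⊗ₜ vfLin x := by
  rw [vfT, uLift_ι, vfDiag_apply]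

/-- Application of operators to `f`, followed by evaluation at the identity. -/
def evalAt : Fn μ →ₗ[ℂ] Module.End ℂ (Fn μ) →ₗ[ℂ] ℂ :=
  (LinearMap.compRight ℂ (ev0 : Fn μ →ₐ[ℂ] ℂ).toLinearMap) ∘ₗ LinearMap.applyₗ

theorem evalAt_apply (f : Fn μ) (D : Module.End ℂ (Fn μ)) : evalAt f D = ev0 (D f) := rfl

variable (μ) in
/-- The contraction of the second factor with `evalAt f`. -/
def slice (f : Fn μ) : UniversalEnvelopingAlgebra ℂ (G μ) ⊗[ℂ] Module.End ℂ (Fn μ) →ₗ[ℂ]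
    UniversalEnvelopingAlgebra ℂ (G μ) :=
  (TensorProduct.rid ℂ (UniversalEnvelopingAlgebra ℂ (G μ))).toLinearMap ∘ₗ
    LinearMap.lTensor _ (evalAt f)

theorem slice_tmul (f : Fn μ) (u : UniversalEnvelopingAlgebra ℂ (G μ))
    (D : Module.End ℂ (Fn μ)) : slice μ f (u ⊗ₜ D) = ev0 (D f) • u := by
  simp [slice, evalAt_apply]

theorem slice_add (f g : Fn μ) (t) : slice μ (f + g) t = slice μ f t + slice μ g t := by
  simp [slice, LinearMap.lTensor_add]

theorem slice_smul (r : ℂ) (f : Fn μ) (t) : slice μ (r • f) t = r • slice μ f t := by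
  simp [slice, LinearMap.lTensor_smul]

theorem slice_sum {κ : Type*} (s : Finset κ) (f : κ → Fn μ) (t) :
    slice μ (∑ k ∈ s, f k) t = ∑ k ∈ s, slice μ (f k) t := by
  classical
  induction s using Finset.induction_on with
  | empty => simp [slice]
  | insert a s ha ih => rw [Finset.sum_insert ha, Finset.sum_insert ha, slice_add, ih]

theorem slice_mul_left (f : Fn μ) (t) (u : UniversalEnvelopingAlgebra ℂ (G μ)) :
    slice μ f (t * (u ⊗ₜ 1)) = slice μ f t * u := by
  induction t using TensorProduct.induction_on with
  | zero => simp
  | tmul v D => simp [slice_tmul]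
  | add s t hs ht => rw [add_mul, map_add, map_add, add_mul, hs, ht]

theorem slice_mul_right (f : Fn μ) (t) (D : Module.End ℂ (Fn μ)) :
    slice μ f (t * ((1 : UniversalEnvelopingAlgebra ℂ (G μ)) ⊗ₜ D)) = slice μ (D f) t := by
  induction t using TensorProduct.induction_on with
  | zero => simp
  | tmul v D' => simp [slice_tmul]
  | add s t hs ht => rw [add_mul, map_add, map_add, hs, ht]

theorem slice_left_mul (f : Fn μ) (t) (u : UniversalEnvelopingAlgebra ℂ (G μ)) :
    slice μ f ((u ⊗ₜ 1) * t) = u * slice μ f t := by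
  induction t using TensorProduct.induction_on with
  | zero => simp
  | tmul v D => simp [slice_tmul]
  | add s t hs ht => rw [mul_add, map_add, map_add, mul_add, hs, ht]

/-- The leftmost operator is applied last, immediately before evaluation at the identity, where its
vector field vanishes. -/
theorem slice_vf_mul (f : Fn μ) (t) (x : G μ) :
    slice μ f (((1 : UniversalEnvelopingAlgebra ℂ (G μ)) ⊗ₜ vfLin (projPar x)) * t) = 0 := by
  induction t using TensorProduct.induction_on with
  | zero => simp
  | tmul v D =>
    rw [Algebra.TensorProduct.tmul_mul_tmul, slice_tmul, Module.End.mul_apply, vfLin_apply,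
      ev0_vf_projPar, zero_smul]
  | add s t hs ht => rw [mul_add, map_add, hs, ht, add_zero]

/-- A counit identity: vector fields kill constants, so only the part of the coproduct with `1` in
the second factor is seen. -/
theorem slice_C_vfT (r : ℂ) (u : UniversalEnvelopingAlgebra ℂ (G μ)) :
    slice μ (MvPolynomial.C r) (vfT u) = r • u := by
  induction u using uea_induction with
  | h1 => rw [vfT_one, Algebra.TensorProduct.one_def, slice_tmul]; simp
  | hadd u v hu hv => rw [map_add, map_add, hu, hv, smul_add]
  | hsmul s u hu => rw [map_smul, map_smul, hu, smul_comm]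
  | hmul u x hu =>
    rw [map_mul, vfT_ι, mul_add, map_add, slice_mul_left, slice_mul_right, hu, vfLin_apply]
    have : vf x (MvPolynomial.C r) = 0 := by simp
    rw [this, smul_mul_assoc]
    simp [slice]

/-- The derivative of the coordinate `eps α` as an operator on `U g`. -/
def Eop (α : Pos μ) : UniversalEnvelopingAlgebra ℂ (G μ) →ₗ[ℂ]
    UniversalEnvelopingAlgebra ℂ (G μ) :=
  slice μ (eps α) ∘ₗ (vfT : _ →ₐ[ℂ] _).toLinearMap

theorem Eop_apply (α : Pos μ) (u) : Eop α u = slice μ (eps α) (vfT u) := rfl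

theorem Eop_one (α : Pos μ) : Eop α 1 = 0 := by
  rw [Eop_apply, vfT_one, Algebra.TensorProduct.one_def, slice_tmul, Module.End.one_apply,
    ev0_eps, zero_smul]

-- The rightmost factor is the first to differentiate `eps α`, and `vf_eps` expands the result in
-- the same family of functions. This is a Leibniz rule twisted by the adjoint action of `g_-`.
open UniversalEnvelopingAlgebra in
theorem Eop_mul_dualRoot (α β : Pos μ) (u) : Eop α (u * ι ℂ (dualRoot β)) =
    Eop α u * ι ℂ (dualRoot β) + ∑ γ : Pos μ, coef α ⁅dualRoot γ, dualRoot β⁆ • Eop γ u +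
      if α = β then (ht β : ℂ) • u else 0 := by
  rw [Eop_apply, map_mul, vfT_ι, mul_add, map_add, slice_mul_left, slice_mul_right, vfLin_apply,
    vf_eps, slice_add, slice_sum, add_assoc]
  simp_rw [slice_smul]
  congr 2
  split_ifs
  · rw [slice_C_vfT]
  · simp [slice]

-- The leftmost factor differentiates last, at the base point, where `g_{≥0}` acts by zero. This is
-- the source of the linearity of the homotopy over `Ω_red`.
open UniversalEnvelopingAlgebra in
theorem Eop_projPar_mul (α : Pos μ) (x : G μ) (u) :
    Eop α (ι ℂ (projPar x) * u) = ι ℂ (projPar x) * Eop α u := by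
  rw [Eop_apply, map_mul, vfT_ι, add_mul, map_add, slice_left_mul, slice_vf_mul, add_zero]
  rfl

/-- `Eop α` acting on the first factor of `Ω`. -/
def EOm (α : Pos μ) : Omega μ →ₗ[ℂ] Omega μ := (Eop α).rTensor (Ghost μ)

theorem EOm_tmul (α : Pos μ) (u : UniversalEnvelopingAlgebra ℂ (G μ)) (v : Ghost μ) :
    EOm α (u ⊗ₜ v) = Eop α u ⊗ₜ v := rfl

theorem EOm_one (α : Pos μ) : EOm α 1 = 0 := by
  rw [Algebra.TensorProduct.one_def, EOm_tmul, Eop_one, TensorProduct.zero_tmul]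

variable (μ) in
/-- The Clifford algebra inside `Ω`. -/
def ghostSub : Subalgebra ℂ (Omega μ) :=
  (Algebra.TensorProduct.includeRight : Ghost μ →ₐ[ℂ] Omega μ).range

theorem c_mem_ghostSub (α : Pos μ) : c α ∈ ghostSub μ := ⟨_, rfl⟩

theorem b_mem_ghostSub (α : Pos μ) : b α ∈ ghostSub μ := ⟨_, rfl⟩

theorem bHat_mem_ghostSub (x : G μ) : bHat x ∈ ghostSub μ := by
  rw [bHat_eq]
  exact Subalgebra.sum_mem _ fun γ _ => Subalgebra.smul_mem _ (b_mem_ghostSub γ) _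

theorem gh_mem_ghostSub (x : G μ) : gh x ∈ ghostSub μ := by
  rw [gh_eq]
  exact Subalgebra.sum_mem _ fun β _ =>
    Subalgebra.mul_mem _ (bHat_mem_ghostSub _) (c_mem_ghostSub β)

theorem EOm_mul_ghost (α : Pos μ) (X : Omega μ) {Y : Omega μ} (hY : Y ∈ ghostSub μ) :
    EOm α (X * Y) = EOm α X * Y := by
  obtain ⟨y, rfl⟩ := hY
  change EOm α (X * (1 ⊗ₜ y)) = EOm α X * (1 ⊗ₜ y)
  induction X using TensorProduct.induction_on with
  | zero => simp
  | tmul u v => simp [EOm_tmul]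
  | add s t hs ht => rw [add_mul, map_add, map_add, add_mul, hs, ht]

theorem EOm_ghost_mul (α : Pos μ) (X : Omega μ) {Y : Omega μ} (hY : Y ∈ ghostSub μ) :
    EOm α (Y * X) = Y * EOm α X := by
  obtain ⟨y, rfl⟩ := hY
  change EOm α ((1 ⊗ₜ y) * X) = (1 ⊗ₜ y) * EOm α X
  induction X using TensorProduct.induction_on with
  | zero => simp
  | tmul u v => simp [EOm_tmul]
  | add s t hs ht => rw [mul_add, map_add, map_add, mul_add, hs, ht]

theorem EOm_J_mul (α : Pos μ) (x : G μ) (X : Omega μ) :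
    EOm α (J (projPar x) * X) = J (projPar x) * EOm α X := by
  rw [J]
  induction X using TensorProduct.induction_on with
  | zero => simp
  | tmul u v => simp only [EOm_tmul, Algebra.TensorProduct.tmul_mul_tmul, Eop_projPar_mul]
  | add s t hs ht => rw [mul_add, map_add, map_add, mul_add, hs, ht]

theorem EOm_mul_J (α β : Pos μ) (X : Omega μ) : EOm α (X * J (dualRoot β)) =
    EOm α X * J (dualRoot β) + ∑ γ : Pos μ, coef α ⁅dualRoot γ, dualRoot β⁆ • EOm γ X +
      if α = β then (ht β : ℂ) • X else 0 := by
  rw [J]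
  induction X using TensorProduct.induction_on with
  | zero => simp
  | tmul u v =>
    simp only [EOm_tmul, Algebra.TensorProduct.tmul_mul_tmul, Eop_mul_dualRoot, mul_one,
      TensorProduct.add_tmul, TensorProduct.sum_tmul, TensorProduct.smul_tmul']
    congr 1
    split_ifs <;> simp
  | add s t hs ht =>
    rw [add_mul, map_add, map_add, add_mul, hs, ht]
    simp only [map_add, smul_add, Finset.sum_add_distrib]
    split_ifs <;> abel

theorem EOm_parity (α : Pos μ) (X : Omega μ) : EOm α (parity μ X) = parity μ (EOm α X) := by
  induction X using TensorProduct.induction_on with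
  | zero => simp
  | tmul u v => simp [EOm_tmul, parity]
  | add s t hs ht => rw [map_add, map_add, map_add, map_add, hs, ht]

/-! ### The homotopy operator on `Ω` -/

variable (μ) in
/-- The homotopy operator which contracts the constraints against the antighosts. -/
def hop : Omega μ →ₗ[ℂ] Omega μ := ∑ α, LinearMap.mulRight ℂ (b α) ∘ₗ EOm α

theorem hop_apply (X : Omega μ) : hop μ X = ∑ α, EOm α X * b α := by
  simp [hop, LinearMap.sum_apply]

theorem hop_one : hop μ 1 = 0 := by simp [hop_apply, EOm_one]

theorem hop_mul_b (X : Omega μ) (β : Pos μ) : hop μ (X * b β) = - (hop μ X * b β) := by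
  rw [hop_apply, hop_apply, Finset.sum_mul, ← Finset.sum_neg_distrib]
  refine Finset.sum_congr rfl fun α _ => ?_
  rw [EOm_mul_ghost α X (b_mem_ghostSub β), mul_assoc, mul_assoc,
    eq_neg_of_add_eq_zero_left (b_mul_b_add β α), mul_neg]

theorem hop_ghost_mul (X : Omega μ) {Y : Omega μ} (hY : Y ∈ ghostSub μ) :
    hop μ (Y * X) = Y * hop μ X := by
  rw [hop_apply, hop_apply, Finset.mul_sum]
  refine Finset.sum_congr rfl fun α _ => ?_
  rw [EOm_ghost_mul α X hY, mul_assoc]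

theorem hop_Jhat_mul (X : Omega μ) (x : G μ) :
    hop μ (Jhat (projPar x) * X) = Jhat (projPar x) * hop μ X := by
  rw [Jhat_eq, add_mul, map_add, hop_ghost_mul X (gh_mem_ghostSub _), add_mul]
  congr 1
  rw [hop_apply, hop_apply, Finset.mul_sum]
  refine Finset.sum_congr rfl fun α _ => ?_
  rw [EOm_J_mul, mul_assoc]

theorem hop_parity (X : Omega μ) : hop μ (parity μ X) = - parity μ (hop μ X) := by
  rw [hop_apply, hop_apply, map_sum, ← Finset.sum_neg_distrib]
  refine Finset.sum_congr rfl fun α _ => ?_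
  rw [map_mul, parity_b, EOm_parity, mul_neg, neg_neg]

theorem EOm_mul_constraint (X : Omega μ) (α β : Pos μ) :
    EOm α (X * constraint β) = EOm α X * constraint β +
      ∑ γ : Pos μ, coef α ⁅dualRoot γ, dualRoot β⁆ • EOm γ X +
      if α = β then (ht β : ℂ) • X else 0 := by
  rw [constraint, Jhat_eq, mul_sub, mul_add, map_sub, map_add, EOm_mul_J,
    EOm_mul_ghost α X (gh_mem_ghostSub _), mul_smul_comm, mul_one, map_smul, mul_sub, mul_add,
    mul_smul_comm, mul_one]
  abel

theorem constraint_b (α β : Pos μ) :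
    constraint β * b α = b α * constraint β + bHat ⁅dualRoot β, dualRoot α⁆ := by
  rw [← Jhat_b, constraint, sub_mul, mul_sub, smul_mul_assoc, mul_smul_comm, one_mul, mul_one]
  abel

theorem EOm_mul_constraint_mul_b (X : Omega μ) (α β : Pos μ) :
    EOm α (X * constraint β) * b α = EOm α X * b α * constraint β +
      EOm α X * bHat ⁅dualRoot β, dualRoot α⁆ +
      ∑ γ : Pos μ, coef α ⁅dualRoot γ, dualRoot β⁆ • (EOm γ X * b α) +
      if α = β then (ht β : ℂ) • (X * b β) else 0 := by
  rw [EOm_mul_constraint, add_mul, add_mul, mul_assoc, constraint_b, mul_add, ← mul_assoc,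
    Finset.sum_mul]
  simp_rw [smul_mul_assoc]
  congr 1
  split_ifs with hab
  · rw [hab, smul_mul_assoc]
  · rw [zero_mul]

/-- The twist in the Leibniz rule of `EOm` cancels the terms arising when the constraint is moved
past the antighosts. Only the constant of `vf_eps` remains, which replaces the constraint by its
antighost. -/
theorem hop_mul_constraint (X : Omega μ) (β : Pos μ) :
    hop μ (X * constraint β) = hop μ X * constraint β + (ht β : ℂ) • (X * b β) := by
  have h3 : ∑ α : Pos μ, ∑ γ : Pos μ, coef α ⁅dualRoot γ, dualRoot β⁆ • (EOm γ X * b α) =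
      - ∑ α : Pos μ, EOm α X * bHat ⁅dualRoot β, dualRoot α⁆ := by
    rw [Finset.sum_comm, ← Finset.sum_neg_distrib]
    refine Finset.sum_congr rfl fun γ _ => ?_
    rw [← lie_skew (dualRoot β) (dualRoot γ), map_neg, mul_neg, neg_neg, bHat_eq, Finset.mul_sum]
    refine Finset.sum_congr rfl fun α _ => ?_
    rw [mul_smul_comm]
  rw [hop_apply, hop_apply, Finset.sum_mul]
  simp_rw [EOm_mul_constraint_mul_b, Finset.sum_add_distrib]
  rw [h3, add_neg_cancel_right, Finset.sum_ite_eq', if_pos (Finset.mem_univ β)]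

/-- An element of `g_{≥0}` is the sum of its graded parts, so the homogeneous generators can be
traded for the image of one linear projection. -/
theorem adjoin_projPar : OmegaRed μ =
    Algebra.adjoin ℂ ((Set.range fun x : G μ => Jhat (projPar x)) ∪ Set.range c) := by
  apply le_antisymm
  · rw [OmegaRed, Algebra.adjoin_le_iff]
    rintro _ (⟨m, hm, x, hx, rfl⟩ | h)
    · exact Algebra.subset_adjoin (Or.inl ⟨x, by simp only [projPar_of_mem_grade hm hx]⟩)
    · exact Algebra.subset_adjoin (Or.inr h)
  · rw [Algebra.adjoin_le_iff]
    rintro _ (⟨x, rfl⟩ | h)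
    · change Jhat (projPar x) ∈ OmegaRed μ
      have h1 : Jhat (projPar x) = ∑ m ∈ (Finset.univ : Finset (μ.cells × μ.cells)).image
          (fun ij => (col ij.2 : ℤ) - col ij.1), Jhat (gradePart m (projPar x)) := by
        conv_lhs => rw [← sum_gradePart (projPar x)]
        rw [← JhatLin_apply, map_sum]
        simp_rw [JhatLin_apply]
      rw [h1]
      refine Subalgebra.sum_mem _ fun m _ => ?_
      by_cases hm : 0 ≤ m
      · exact Algebra.subset_adjoin (Or.inl ⟨m, hm, _, gradePart_mem m _, rfl⟩)
      · have h0 : gradePart m (projPar x) = 0 := by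
          apply Subtype.ext
          ext i j
          simp only [gradePart, Matrix.of_apply]
          split_ifs with h
          · rw [projPar_apply, if_pos (by omega)]
            rfl
          · rfl
        rw [h0, ← JhatLin_apply, map_zero]
        exact Subalgebra.zero_mem _
    · exact Algebra.subset_adjoin (Or.inr h)

theorem Jhat_projPar_mem (x : G μ) : Jhat (projPar x) ∈ OmegaRed μ := by
  rw [adjoin_projPar]
  exact Algebra.subset_adjoin (Or.inl ⟨x, rfl⟩)

theorem c_mem_OmegaRed (α : Pos μ) : c α ∈ OmegaRed μ :=
  Algebra.subset_adjoin (Or.inr ⟨α, rfl⟩)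

theorem hop_red_mul {X : Omega μ} (hX : X ∈ OmegaRed μ) (Y : Omega μ) :
    hop μ (X * Y) = X * hop μ Y := by
  rw [adjoin_projPar] at hX
  induction hX using Algebra.adjoin_induction generalizing Y with
  | mem X hX =>
    obtain ⟨x, rfl⟩ | ⟨α, rfl⟩ := hX
    · exact hop_Jhat_mul Y x
    · exact hop_ghost_mul Y (c_mem_ghostSub α)
  | algebraMap r => rw [← Algebra.smul_def, map_smul, Algebra.smul_def]
  | add X Z _ _ hX hZ => rw [add_mul, map_add, hX, hZ, add_mul]
  | mul X Z _ _ hX hZ => rw [mul_assoc, hX, hZ, mul_assoc]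

theorem hop_red {X : Omega μ} (hX : X ∈ OmegaRed μ) : hop μ X = 0 := by
  have := hop_red_mul hX 1
  rwa [mul_one, hop_one, mul_zero] at this

/-! ### The total degree -/

theorem bideg_le_degPiece (p : ℤ × ℤ) : bideg μ p ≤ degPiece μ (p.1 + p.2) := by
  have h : p = (p.1, p.1 + p.2 - p.1) := Prod.ext rfl (by simp)
  conv_lhs => rw [h]
  exact le_iSup (fun q : ℤ => bideg μ (q, p.1 + p.2 - q)) p.1

theorem isGen_mem_degPiece {p : ℤ × ℤ} {X : Omega μ} (h : IsGen p X) :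
    X ∈ degPiece μ (p.1 + p.2) :=
  bideg_le_degPiece p (Submodule.subset_span h.isMonomial)

theorem J_mem_degPiece (x : G μ) : J x ∈ degPiece μ 0 := by
  rw [← sum_gradePart x, ← JLin_apply, map_sum]
  refine Submodule.sum_mem _ fun m _ => ?_
  have h := isGen_mem_degPiece (IsGen.J m _ (gradePart_mem m x))
  rwa [add_neg_cancel] at h

theorem c_mem_degPiece (α : Pos μ) : c α ∈ degPiece μ 1 := by
  have := isGen_mem_degPiece (IsGen.c α)
  rwa [add_sub_cancel] at this

theorem b_mem_degPiece (α : Pos μ) : b α ∈ degPiece μ (-1) := by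
  have := isGen_mem_degPiece (IsGen.b α)
  rwa [show -ht α + (ht α - 1) = -1 by ring] at this

theorem one_mem_degPiece : (1 : Omega μ) ∈ degPiece μ 0 :=
  bideg_le_degPiece 0 (Submodule.subset_span IsMonomial.one)

theorem degPiece_mul_of_eq {k l m : ℤ} {X Y : Omega μ} (hX : X ∈ degPiece μ k)
    (hY : Y ∈ degPiece μ l) (h : k + l = m) : X * Y ∈ degPiece μ m :=
  h ▸ degPiece_mul hX hY

theorem bHat_mem_degPiece (x : G μ) : bHat x ∈ degPiece μ (-1) := by
  rw [bHat_eq]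
  exact Submodule.sum_mem _ fun γ _ => Submodule.smul_mem _ _ (b_mem_degPiece γ)

theorem gh_mem_degPiece (x : G μ) : gh x ∈ degPiece μ 0 := by
  rw [gh_eq]
  exact Submodule.sum_mem _ fun β _ =>
    degPiece_mul_of_eq (bHat_mem_degPiece _) (c_mem_degPiece β) (by norm_num)

theorem Jhat_mem_degPiece (x : G μ) : Jhat x ∈ degPiece μ 0 := by
  rw [Jhat_eq]
  exact add_mem (J_mem_degPiece x) (gh_mem_degPiece x)

theorem constraint_mem_degPiece (α : Pos μ) : constraint α ∈ degPiece μ 0 :=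
  sub_mem (Jhat_mem_degPiece _) (Submodule.smul_mem _ _ one_mem_degPiece)

theorem Q_mem_degPiece : Q μ ∈ degPiece μ 1 := by
  rw [Q_eq]
  refine sub_mem (Submodule.smul_mem _ _ (add_mem ?_ ?_)) ?_
  · exact Submodule.sum_mem _ fun α _ =>
      degPiece_mul_of_eq (J_mem_degPiece _) (c_mem_degPiece α) (zero_add 1)
  · exact Submodule.sum_mem _ fun α _ =>
      degPiece_mul_of_eq (Jhat_mem_degPiece _) (c_mem_degPiece α) (zero_add 1)
  · exact Submodule.sum_mem _ fun α _ => Submodule.smul_mem _ _ (c_mem_degPiece α)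

theorem parity_eq_or {k : ℤ} {X : Omega μ} (hX : X ∈ degPiece μ k) :
    ∃ r : ℂ, parity μ X = r • X := by
  refine ⟨((k.negOnePow : ℤ) : ℂ), ?_⟩
  rw [parity_degPiece hX, Int.cast_smul_eq_zsmul]

theorem d_mem_degPiece {k : ℤ} {X : Omega μ} (hX : X ∈ degPiece μ k) :
    d μ X ∈ degPiece μ (k + 1) := by
  obtain ⟨r, hr⟩ := parity_eq_or hX
  rw [d_apply, hr, smul_mul_assoc]
  refine sub_mem ?_ (Submodule.smul_mem _ _ (degPiece_mul hX Q_mem_degPiece))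
  rw [add_comm]
  exact degPiece_mul Q_mem_degPiece hX

/-- The ghost number operator. -/
def ghostNumber (μ : YoungDiagram) : Omega μ := ∑ α : Pos μ, c α * b α

theorem ghostNumber_gen {p : ℤ × ℤ} {x : Omega μ} (hx : IsGen p x) :
    ghostNumber μ * x - x * ghostNumber μ = ((p.1 + p.2 : ℤ) : ℂ) • x := by
  rw [ghostNumber, Finset.sum_mul, Finset.mul_sum, ← Finset.sum_sub_distrib]
  cases hx with
  | J m x hx =>
    rw [Finset.sum_eq_zero]
    · simp
    · intro α _
      rw [mul_assoc, ← J_mul_b, ← mul_assoc, ← J_mul_c, mul_assoc, sub_self]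
  | c α =>
    simp_rw [comm_c]
    simp
  | b α =>
    simp_rw [comm_b]
    rw [show (-ht α + (ht α - 1) : ℤ) = -1 by ring]
    simp

theorem ghostNumber_monomial {p : ℤ × ℤ} {x : Omega μ} (hx : IsMonomial p x) :
    ghostNumber μ * x - x * ghostNumber μ = ((p.1 + p.2 : ℤ) : ℂ) • x := by
  induction hx with
  | one => simp
  | @cons p q x y hx _ ih =>
    have h1 := ghostNumber_gen hx
    have h : ghostNumber μ * (x * y) - x * y * ghostNumber μ =
        (ghostNumber μ * x - x * ghostNumber μ) * y +
          x * (ghostNumber μ * y - y * ghostNumber μ) := by noncomm_ring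
    rw [h, h1, ih, smul_mul_assoc, mul_smul_comm, ← add_smul]
    congr 1
    simp only [Prod.fst_add, Prod.snd_add]
    push_cast
    ring

/-- The degree is the eigenvalue of the commutator with the ghost number operator, and eigenspaces
are independent. -/
theorem degPiece_iSupIndep : iSupIndep (degPiece μ) := by
  let f : Module.End ℂ (Omega μ) :=
    LinearMap.mulLeft ℂ (ghostNumber μ) - LinearMap.mulRight ℂ (ghostNumber μ)
  have hinj : Function.Injective fun k : ℤ => (k : ℂ) := Int.cast_injective
  refine ((Module.End.eigenspaces_iSupIndep f).comp hinj).mono fun k => ?_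
  refine iSup_le fun p => ?_
  rw [bideg, Submodule.span_le]
  intro x hx
  have := ghostNumber_monomial hx
  rw [add_sub_cancel] at this
  exact Module.End.mem_eigenspace_iff.2 this

/-- By the modular law, `(S k ⊔ ⨆ D j) ⊓ D k = S k ⊔ (⨆ D j ⊓ D k)` with `j ≠ k`, and the last term
vanishes by independence. It lets a spanning family of homogeneous elements be restricted to a
single degree. -/
theorem mem_of_mem_iSup_of_iSupIndep {ι V : Type*} [AddCommGroup V] [Module ℂ V]
    {D S : ι → Submodule ℂ V} (hD : iSupIndep D) (hS : ∀ i, S i ≤ D i) {k : ι} {X : V}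
    (hX : X ∈ D k) (hX2 : X ∈ ⨆ i, S i) : X ∈ S k := by
  have h1 : ⨆ i, S i ≤ S k ⊔ ⨆ (j) (_ : j ≠ k), D j := by
    refine iSup_le fun i => ?_
    by_cases h : i = k
    · rw [h]; exact le_sup_left
    · exact le_trans (hS i) (le_trans (le_iSup₂_of_le i h le_rfl) le_sup_right)
  have h2 : X ∈ (S k ⊔ ⨆ (j) (_ : j ≠ k), D j) ⊓ D k := ⟨h1 hX2, hX⟩
  rwa [sup_inf_assoc_of_le _ (hS k), inf_comm, (hD k).eq_bot, sup_bot_eq] at h2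

/-! ### The reduced algebra -/

/-- Products of generators of `Ω_red`, with their degrees. -/
inductive IsRed : ℤ → Omega μ → Prop
  | one : IsRed 0 1
  | J {k : ℤ} {X : Omega μ} (m : ℤ) (hm : 0 ≤ m) (x : G μ) (hx : x ∈ grade μ m)
      (hX : IsRed k X) : IsRed k (Jhat x * X)
  | c {k : ℤ} {X : Omega μ} (α : Pos μ) (hX : IsRed k X) : IsRed (k + 1) (c α * X)

theorem IsRed.nonneg {k : ℤ} {X : Omega μ} (h : IsRed k X) : 0 ≤ k := by
  induction h with
  | one => exact le_rfl
  | J _ _ _ _ _ ih => exact ih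
  | c _ _ ih => omega

theorem IsRed.mem {k : ℤ} {X : Omega μ} (h : IsRed k X) : X ∈ OmegaRed μ := by
  induction h with
  | one => exact one_mem _
  | J m hm x hx _ ih => exact mul_mem (Algebra.subset_adjoin (Or.inl ⟨m, hm, x, hx, rfl⟩)) ih
  | c α _ ih => exact mul_mem (c_mem_OmegaRed α) ih

theorem IsRed.mem_degPiece {k : ℤ} {X : Omega μ} (h : IsRed k X) : X ∈ degPiece μ k := by
  induction h with
  | one => exact one_mem_degPiece
  | J m hm x hx _ ih => simpa using degPiece_mul (Jhat_mem_degPiece x) ih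
  | c α _ ih =>
    rw [add_comm]
    exact degPiece_mul (c_mem_degPiece α) ih

theorem IsRed.mul {k l : ℤ} {X Y : Omega μ} (h : IsRed k X) (hY : IsRed l Y) :
    IsRed (k + l) (X * Y) := by
  induction h with
  | one => simpa using hY
  | J m hm x hx _ ih => rw [mul_assoc]; exact IsRed.J m hm x hx ih
  | c α _ ih => rw [mul_assoc, add_right_comm]; exact IsRed.c α ih

variable (μ) in
/-- The piece of degree `k` of `Ω_red`. -/
def redPiece (k : ℤ) : Submodule ℂ (Omega μ) := Submodule.span ℂ {X | IsRed k X}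

theorem redPiece_le_degPiece (k : ℤ) : redPiece μ k ≤ degPiece μ k :=
  Submodule.span_le.2 fun _ h => h.mem_degPiece

theorem le_iSup_redPiece : Subalgebra.toSubmodule (OmegaRed μ) ≤ ⨆ k, redPiece μ k := by
  let S : Subalgebra ℂ (Omega μ) := (⨆ k, redPiece μ k).toSubalgebra
    (Submodule.mem_iSup_of_mem 0 (Submodule.subset_span IsRed.one)) (by
      intro x y hx hy
      have h := Submodule.mul_mem_mul hx hy
      rw [Submodule.iSup_mul] at h
      simp_rw [Submodule.mul_iSup] at h
      refine (iSup_le fun p => iSup_le fun q => ?_ : _ ≤ ⨆ k, redPiece μ k) h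
      refine le_trans ?_ (le_iSup _ (p + q))
      rw [redPiece, redPiece, Submodule.span_mul_span]
      refine Submodule.span_mono ?_
      rintro _ ⟨u, hu, v, hv, rfl⟩
      exact hu.mul hv)
  have h : OmegaRed μ ≤ S := by
    rw [OmegaRed, Algebra.adjoin_le_iff]
    rintro _ (⟨m, hm, x, hx, rfl⟩ | ⟨α, rfl⟩)
    · refine Submodule.mem_iSup_of_mem 0 (Submodule.subset_span ?_)
      simpa using IsRed.J m hm x hx IsRed.one
    · refine Submodule.mem_iSup_of_mem 1 (Submodule.subset_span ?_)
      simpa using IsRed.c α IsRed.one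
  exact h

theorem mem_redPiece {k : ℤ} {X : Omega μ} (hX : X ∈ OmegaRed μ) (hk : X ∈ degPiece μ k) :
    X ∈ redPiece μ k :=
  mem_of_mem_iSup_of_iSupIndep degPiece_iSupIndep redPiece_le_degPiece hk (le_iSup_redPiece hX)

/-- The degree of a word in the `Ĵ` and the `c` is its number of ghosts, which is never negative.
This yields uniqueness of reduced representatives. -/
theorem red_neg_one_eq_zero {X : Omega μ} (hX : X ∈ OmegaRed μ) (hk : X ∈ degPiece μ (-1)) :
    X = 0 := by
  have h := mem_redPiece hX hk
  have h2 : redPiece μ (-1) = ⊥ := by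
    rw [redPiece, Submodule.span_eq_bot]
    intro Y hY
    have := IsRed.nonneg hY
    omega
  rwa [h2, Submodule.mem_bot] at h

theorem parity_mem_OmegaRed {X : Omega μ} (hX : X ∈ OmegaRed μ) : parity μ X ∈ OmegaRed μ := by
  rw [adjoin_projPar] at hX
  induction hX using Algebra.adjoin_induction with
  | mem X hX =>
    obtain ⟨x, rfl⟩ | ⟨α, rfl⟩ := hX
    · change parity μ (Jhat (projPar x)) ∈ _
      rw [parity_Jhat]
      exact Jhat_projPar_mem x
    · rw [parity_c]
      exact neg_mem (c_mem_OmegaRed α)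
  | algebraMap r =>
    rw [AlgHom.commutes]
    exact Subalgebra.algebraMap_mem _ r
  | add X Z _ _ hX hZ => rw [map_add]; exact add_mem hX hZ
  | mul X Z _ _ hX hZ => rw [map_mul]; exact mul_mem hX hZ

theorem d_mem_OmegaRed {X : Omega μ} (hX : X ∈ OmegaRed μ) : d μ X ∈ OmegaRed μ := by
  have hp := @adjoin_projPar μ
  have hX' := hX
  rw [hp] at hX
  induction hX using Algebra.adjoin_induction with
  | mem X hX =>
    obtain ⟨x, rfl⟩ | ⟨α, rfl⟩ := hX
    · change d μ (Jhat (projPar x)) ∈ _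
      rw [d_Jhat]
      refine neg_mem (Subalgebra.sum_mem _ fun α _ => mul_mem (add_mem (Jhat_projPar_mem _) ?_)
        (c_mem_OmegaRed α))
      exact Subalgebra.smul_mem _ (one_mem _) _
    · rw [d_c]
      exact Subalgebra.smul_mem _ (Subalgebra.sum_mem _ fun β _ => Subalgebra.sum_mem _ fun γ _ =>
        Subalgebra.smul_mem _ (mul_mem (c_mem_OmegaRed γ) (c_mem_OmegaRed β)) _) _
  | algebraMap r =>
    rw [Algebra.algebraMap_eq_smul_one, map_smul, d_one, smul_zero]
    exact zero_mem _
  | add X Z hX1 hZ1 hX hZ => rw [map_add]; exact add_mem (hX (hp ▸ hX1)) (hZ (hp ▸ hZ1))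
  | mul X Z hX1 hZ1 hX hZ =>
    rw [d_mul]
    exact add_mem (mul_mem (hX (hp ▸ hX1)) (hp ▸ hZ1))
      (mul_mem (parity_mem_OmegaRed (hp ▸ hX1)) (hZ (hp ▸ hZ1)))

/-! ### The Koszul decomposition of `Ω` -/

/-- The weight of a constraint or antighost. -/
def wt (α : Pos μ) : ℕ := col α.1.2 - col α.1.1

theorem wt_pos (α : Pos μ) : 0 < wt α := Nat.sub_pos_of_lt α.2

theorem cast_wt (α : Pos μ) : (wt α : ℂ) = (ht α : ℂ) := by
  rw [wt, Nat.cast_sub α.2.le]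
  simp [ht]

/-- Products of an element of `Ω_red` and a word in the constraints and the antighosts, with the
weight of the word and the degree of the product. -/
inductive IsKos : ℕ → ℤ → Omega μ → Prop
  | red {k : ℤ} {X : Omega μ} (hX : X ∈ OmegaRed μ) (hk : X ∈ degPiece μ k) : IsKos 0 k X
  | b {ν : ℕ} {k : ℤ} {X : Omega μ} (h : IsKos ν k X) (β : Pos μ) :
      IsKos (ν + wt β) (k + (-1)) (X * b β)
  | K {ν : ℕ} {k : ℤ} {X : Omega μ} (h : IsKos ν k X) (β : Pos μ) :
      IsKos (ν + wt β) k (X * constraint β)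

variable (μ) in
/-- The span of the products of weight `ν` and degree `k`. -/
def kosPiece (ν : ℕ) (k : ℤ) : Submodule ℂ (Omega μ) := Submodule.span ℂ {X | IsKos ν k X}

theorem IsKos.mem_degPiece {ν : ℕ} {k : ℤ} {X : Omega μ} (h : IsKos ν k X) :
    X ∈ degPiece μ k := by
  induction h with
  | red _ hk => exact hk
  | b _ β ih => exact degPiece_mul ih (b_mem_degPiece β)
  | K _ β ih => simpa using degPiece_mul ih (constraint_mem_degPiece β)

theorem kosPiece_le_degPiece (ν : ℕ) (k : ℤ) : kosPiece μ ν k ≤ degPiece μ k :=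
  Submodule.span_le.2 fun _ h => h.mem_degPiece

theorem kosPiece_mul_b {ν : ℕ} {k : ℤ} {X : Omega μ} (hX : X ∈ kosPiece μ ν k) (β : Pos μ) :
    X * b β ∈ kosPiece μ (ν + wt β) (k + (-1)) := by
  have h : kosPiece μ ν k ≤
      (kosPiece μ (ν + wt β) (k + (-1))).comap (LinearMap.mulRight ℂ (b β)) :=
    Submodule.span_le.2 fun Y hY => Submodule.subset_span (IsKos.b hY β)
  exact h hX

theorem kosPiece_mul_constraint {ν : ℕ} {k : ℤ} {X : Omega μ} (hX : X ∈ kosPiece μ ν k)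
    (β : Pos μ) : X * constraint β ∈ kosPiece μ (ν + wt β) k := by
  have h : kosPiece μ ν k ≤
      (kosPiece μ (ν + wt β) k).comap (LinearMap.mulRight ℂ (constraint β)) :=
    Submodule.span_le.2 fun Y hY => Submodule.subset_span (IsKos.K hY β)
  exact h hX

/-- Every letter has positive weight, so weight `0` forces the empty word. -/
theorem kosPiece_zero_le (k : ℤ) {X : Omega μ} (hX : X ∈ kosPiece μ 0 k) : X ∈ OmegaRed μ := by
  have h : kosPiece μ 0 k ≤ Subalgebra.toSubmodule (OmegaRed μ) := by
    refine Submodule.span_le.2 fun Y hY => ?_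
    have key : ∀ {ν : ℕ} {k : ℤ} {Y : Omega μ}, IsKos ν k Y → ν = 0 → Y ∈ OmegaRed μ := by
      intro ν k Y h h0
      cases h with
      | red hX _ => exact hX
      | b _ β => have := wt_pos β; omega
      | K _ β => have := wt_pos β; omega
    exact key hY rfl
  exact h hX

theorem IsKos.d_mem {ν : ℕ} {k : ℤ} {X : Omega μ} (h : IsKos ν k X) :
    d μ X ∈ kosPiece μ ν (k + 1) := by
  induction h with
  | red hX hk => exact Submodule.subset_span (IsKos.red (d_mem_OmegaRed hX) (d_mem_degPiece hk))
  | @b ν k X h β ih =>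
    rw [d_mul, d_b]
    refine add_mem ?_ ?_
    · rw [add_right_comm]
      exact kosPiece_mul_b ih β
    · obtain ⟨r, hr⟩ := parity_eq_or h.mem_degPiece
      rw [hr, smul_mul_assoc, neg_add_cancel_right]
      exact Submodule.smul_mem _ _ (Submodule.subset_span (h.K β))
  | @K ν k X h β ih =>
    rw [d_mul, d_constraint, mul_zero, add_zero]
    exact kosPiece_mul_constraint ih β

theorem d_mem_kosPiece {ν : ℕ} {k : ℤ} {X : Omega μ} (hX : X ∈ kosPiece μ ν k) :
    d μ X ∈ kosPiece μ ν (k + 1) := by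
  have h : kosPiece μ ν k ≤ (kosPiece μ ν (k + 1)).comap (d μ) :=
    Submodule.span_le.2 fun Y hY => hY.d_mem
  exact h hX

/-! ### The anticommutator of `d` with the homotopy -/

variable (μ) in
/-- The homotopy operator with the sign which makes it anticommute with `d` up to the weight. -/
def homot : Omega μ →ₗ[ℂ] Omega μ := hop μ ∘ₗ (parity μ).toLinearMap

theorem homot_apply (X : Omega μ) : homot μ X = hop μ (parity μ X) := rfl

theorem homot_red {X : Omega μ} (hX : X ∈ OmegaRed μ) : homot μ X = 0 :=
  hop_red (parity_mem_OmegaRed hX)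

theorem homot_mul_b (X : Omega μ) (β : Pos μ) : homot μ (X * b β) = homot μ X * b β := by
  rw [homot_apply, map_mul, parity_b, mul_neg, map_neg, hop_mul_b, neg_neg]
  rfl

theorem homot_mul_constraint (X : Omega μ) (β : Pos μ) : homot μ (X * constraint β) =
    homot μ X * constraint β + (wt β : ℂ) • (parity μ X * b β) := by
  rw [homot_apply, map_mul, parity_constraint, hop_mul_constraint, cast_wt]
  rfl

theorem parity_homot (X : Omega μ) : parity μ (homot μ X) = - homot μ (parity μ X) := by
  rw [homot_apply, homot_apply, hop_parity, hop_parity, hop_parity, neg_neg, map_neg]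

theorem IsKos.homot_mem {ν : ℕ} {k : ℤ} {X : Omega μ} (h : IsKos ν k X) :
    homot μ X ∈ kosPiece μ ν (k + (-1)) := by
  induction h with
  | red hX hk =>
    rw [homot_red hX]
    exact zero_mem _
  | @b ν k X h β ih =>
    rw [homot_mul_b]
    exact kosPiece_mul_b ih β
  | @K ν k X h β ih =>
    rw [homot_mul_constraint]
    refine add_mem (kosPiece_mul_constraint ih β) (Submodule.smul_mem _ _ ?_)
    obtain ⟨r, hr⟩ := parity_eq_or h.mem_degPiece
    rw [hr, smul_mul_assoc]
    exact Submodule.smul_mem _ _ (Submodule.subset_span (h.b β))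

theorem homot_mem_kosPiece {ν : ℕ} {k : ℤ} {X : Omega μ} (hX : X ∈ kosPiece μ ν k) :
    homot μ X ∈ kosPiece μ ν (k + (-1)) := by
  have h : kosPiece μ ν k ≤ (kosPiece μ ν (k + (-1))).comap (homot μ) :=
    Submodule.span_le.2 fun Y hY => hY.homot_mem
  exact h hX

variable (μ) in
/-- The anticommutator of `d` with the homotopy. -/
def laplace : Module.End ℂ (Omega μ) := d μ ∘ₗ homot μ + homot μ ∘ₗ d μ

theorem laplace_apply (X : Omega μ) : laplace μ X = d μ (homot μ X) + homot μ (d μ X) := rfl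

/-- Differentiating `b β` creates a constraint which the homotopy turns back into `wt β • b β`. The
cross terms containing the constraint cancel because of the sign built into `homot`. -/
theorem laplace_mul_b (X : Omega μ) (β : Pos μ) :
    laplace μ (X * b β) = laplace μ X * b β + (wt β : ℂ) • (X * b β) := by
  rw [laplace_apply, laplace_apply, homot_mul_b, d_mul, d_mul, d_b, map_add, homot_mul_b,
    homot_mul_constraint, parity_parity, parity_homot, add_mul]
  noncomm_ring

theorem d_mul_constraint (X : Omega μ) (β : Pos μ) :
    d μ (X * constraint β) = d μ X * constraint β := by
  rw [d_mul, d_constraint, mul_zero, add_zero]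

theorem laplace_mul_constraint (X : Omega μ) (β : Pos μ) :
    laplace μ (X * constraint β) =
      laplace μ X * constraint β + (wt β : ℂ) • (X * constraint β) := by
  have h : d μ (parity μ X * b β) = - (parity μ (d μ X) * b β) + X * constraint β := by
    rw [d_mul, d_b, parity_parity, parity_d, neg_mul, neg_neg]
  rw [laplace_apply, laplace_apply, homot_mul_constraint, d_mul_constraint, homot_mul_constraint,
    LinearMap.map_add, LinearMap.map_smul, d_mul_constraint, h, add_mul, smul_add, smul_neg]
  abel

theorem IsKos.laplace_eq {ν : ℕ} {k : ℤ} {X : Omega μ} (h : IsKos ν k X) :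
    laplace μ X = (ν : ℂ) • X := by
  induction h with
  | red hX hk =>
    rw [laplace_apply, homot_red hX, homot_red (d_mem_OmegaRed hX), map_zero, add_zero,
      Nat.cast_zero, zero_smul]
  | @b ν k X h β ih => rw [laplace_mul_b, ih, smul_mul_assoc, ← add_smul, Nat.cast_add]
  | @K ν k X h β ih => rw [laplace_mul_constraint, ih, smul_mul_assoc, ← add_smul, Nat.cast_add]

/-- Independence of the weight pieces is read off from eigenvalues, so that uniqueness of the
expression as element of `Ω_red` times word is not required. -/
theorem kosPiece_le_eigenspace (ν : ℕ) (k : ℤ) :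
    kosPiece μ ν k ≤ (laplace μ).eigenspace (ν : ℂ) :=
  Submodule.span_le.2 fun _ h => Module.End.mem_eigenspace_iff.2 h.laplace_eq

theorem kosPiece_iSupIndep (k : ℤ) : iSupIndep fun ν => kosPiece μ ν k :=
  ((Module.End.eigenspaces_iSupIndep (laplace μ)).comp
    (Nat.cast_injective : Function.Injective (Nat.cast : ℕ → ℂ))).mono
      fun ν => kosPiece_le_eigenspace ν k

/-! ### The products of `Ω_red` with words in constraints and antighosts span `Ω` -/

variable (μ) in
/-- The span of `1`, the antighosts and the constraints. -/
def letters : Submodule ℂ (Omega μ) := Submodule.span ℂ ({1} ∪ (Set.range b ∪ Set.range constraint))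

theorem one_mem_letters : (1 : Omega μ) ∈ letters μ := Submodule.subset_span (Or.inl rfl)

theorem b_mem_letters (α : Pos μ) : b α ∈ letters μ :=
  Submodule.subset_span (Or.inr (Or.inl ⟨α, rfl⟩))

theorem constraint_mem_letters (α : Pos μ) : constraint α ∈ letters μ :=
  Submodule.subset_span (Or.inr (Or.inr ⟨α, rfl⟩))

theorem bHat_mem_letters (x : G μ) : bHat x ∈ letters μ := by
  rw [bHat_eq]
  exact Submodule.sum_mem _ fun γ _ => Submodule.smul_mem _ _ (b_mem_letters γ)

theorem Jhat_projNeg_mem_letters (x : G μ) : Jhat (projNeg x) ∈ letters μ := by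
  rw [projNeg_eq, ← JhatLin_apply, map_sum]
  refine Submodule.sum_mem _ fun γ _ => ?_
  rw [map_smul, JhatLin_apply]
  refine Submodule.smul_mem _ _ ?_
  have h : Jhat (dualRoot γ) = constraint γ + chi γ • 1 := by rw [constraint, sub_add_cancel]
  rw [h]
  exact add_mem (constraint_mem_letters γ) (Submodule.smul_mem _ _ one_mem_letters)

variable (μ) in
/-- The span of the products of an element of `Ω_red` and a letter. -/
def redLetters : Submodule ℂ (Omega μ) := Subalgebra.toSubmodule (OmegaRed μ) * letters μ

theorem letters_le_redLetters : letters μ ≤ redLetters μ := fun X hX => by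
  have := Submodule.mul_mem_mul (show (1 : Omega μ) ∈ Subalgebra.toSubmodule (OmegaRed μ) from
    one_mem (OmegaRed μ)) hX
  rwa [one_mul] at this

theorem mul_mem_redLetters {X Y : Omega μ} (hX : X ∈ OmegaRed μ) (hY : Y ∈ letters μ) :
    X * Y ∈ redLetters μ :=
  Submodule.mul_mem_mul (M := Subalgebra.toSubmodule (OmegaRed μ)) hX hY

theorem red_mem_redLetters {X : Omega μ} (hX : X ∈ OmegaRed μ) : X ∈ redLetters μ := by
  have := mul_mem_redLetters hX one_mem_letters
  rwa [mul_one] at this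

theorem red_mul_redLetters {X Y : Omega μ} (hX : X ∈ OmegaRed μ) (hY : Y ∈ redLetters μ) :
    X * Y ∈ redLetters μ := by
  refine Submodule.mul_induction_on hY (fun m hm n hn => ?_) (fun x y hx hy => ?_)
  · rw [← mul_assoc]
    exact mul_mem_redLetters ((OmegaRed μ).mul_mem hX hm) hn
  · rw [mul_add]
    exact add_mem hx hy

theorem letters_mul_of_gen {X : Omega μ} (h1 : X ∈ redLetters μ)
    (hb : ∀ α, b α * X ∈ redLetters μ) (hK : ∀ α, constraint α * X ∈ redLetters μ)
    {Y : Omega μ} (hY : Y ∈ letters μ) : Y * X ∈ redLetters μ := by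
  have h : letters μ ≤ (redLetters μ).comap (LinearMap.mulRight ℂ X) := by
    refine Submodule.span_le.2 ?_
    rintro _ (rfl | ⟨α, rfl⟩ | ⟨α, rfl⟩)
    · simpa using h1
    · exact hb α
    · exact hK α
  exact h hY

theorem bHat_mul_c_mem (x : G μ) (α : Pos μ) : bHat x * c α ∈ redLetters μ := by
  have h : bHat x * c α = coef α x • 1 - c α * bHat x := by rw [← bHat_c, add_sub_cancel_right]
  rw [h]
  exact sub_mem (Submodule.smul_mem _ _ (red_mem_redLetters (one_mem _)))
    (mul_mem_redLetters (c_mem_OmegaRed α) (bHat_mem_letters x))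

theorem Jhat_mem_redLetters (x : G μ) : Jhat x ∈ redLetters μ := by
  rw [← projPar_add_projNeg x, ← JhatLin_apply, map_add, JhatLin_apply, JhatLin_apply]
  exact add_mem (red_mem_redLetters (Jhat_projPar_mem x))
    (letters_le_redLetters (Jhat_projNeg_mem_letters x))

/-- Moving a generator of `Ω_red` to the left through one letter leaves at most one letter: the
corrections in the commutators are linear in the antighosts, and `b c` is reordered by the Clifford
relation. The letter `1` records the cases where none is left. -/
theorem letters_mul_Jhat (x : G μ) {Y : Omega μ} (hY : Y ∈ letters μ) :
    Y * Jhat (projPar x) ∈ redLetters μ := by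
  refine letters_mul_of_gen (red_mem_redLetters (Jhat_projPar_mem x)) (fun α => ?_)
    (fun α => ?_) hY
  · have h : b α * Jhat (projPar x) =
        Jhat (projPar x) * b α - bHat ⁅projPar x, dualRoot α⁆ := by
      rw [← Jhat_b, sub_sub_cancel]
    rw [h]
    exact sub_mem (mul_mem_redLetters (Jhat_projPar_mem x) (b_mem_letters α))
      (letters_le_redLetters (bHat_mem_letters _))
  · have h : constraint α * Jhat (projPar x) = Jhat (projPar x) * constraint α +
        (Jhat (dualRoot α) * Jhat (projPar x) - Jhat (projPar x) * Jhat (dualRoot α)) := by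
      rw [constraint, sub_mul, mul_sub, smul_mul_assoc, mul_smul_comm, one_mul, mul_one]
      abel
    rw [h, Jhat_Jhat]
    exact add_mem (mul_mem_redLetters (Jhat_projPar_mem x) (constraint_mem_letters α))
      (add_mem (Jhat_mem_redLetters _) (Submodule.sum_mem _ fun β _ => bHat_mul_c_mem _ β))

theorem letters_mul_c (β : Pos μ) {Y : Omega μ} (hY : Y ∈ letters μ) :
    Y * c β ∈ redLetters μ := by
  refine letters_mul_of_gen (red_mem_redLetters (c_mem_OmegaRed β)) (fun α => ?_)
    (fun α => ?_) hY
  · rw [← bHat_dualRoot]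
    exact bHat_mul_c_mem _ β
  · have h : constraint α * c β = c β * constraint α +
        (Jhat (dualRoot α) * c β - c β * Jhat (dualRoot α)) := by
      rw [constraint, sub_mul, mul_sub, smul_mul_assoc, mul_smul_comm, one_mul, mul_one]
      abel
    rw [h, Jhat_c]
    exact add_mem (mul_mem_redLetters (c_mem_OmegaRed β) (constraint_mem_letters α))
      (red_mem_redLetters (neg_mem (Subalgebra.sum_mem _ fun γ _ =>
        Subalgebra.smul_mem _ (c_mem_OmegaRed γ) _)))

theorem letters_mul_red {X Y : Omega μ} (hY : Y ∈ letters μ) (hX : X ∈ OmegaRed μ) :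
    Y * X ∈ redLetters μ := by
  have hp := @adjoin_projPar μ
  rw [hp] at hX
  induction hX using Algebra.adjoin_induction generalizing Y with
  | mem X hX =>
    obtain ⟨x, rfl⟩ | ⟨α, rfl⟩ := hX
    · exact letters_mul_Jhat x hY
    · exact letters_mul_c α hY
  | algebraMap r =>
    rw [← Algebra.commutes, ← Algebra.smul_def]
    exact Submodule.smul_mem _ _ (letters_le_redLetters hY)
  | add X Z _ _ hX hZ => rw [mul_add]; exact add_mem (hX hY) (hZ hY)
  | mul X Z _ _ hX hZ =>
    rw [← mul_assoc]
    have h : ∀ W ∈ redLetters μ, W * Z ∈ redLetters μ := by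
      intro W hW
      refine Submodule.mul_induction_on hW (fun m hm n hn => ?_) (fun x y hx hy => ?_)
      · rw [mul_assoc]
        exact red_mul_redLetters hm (hZ hn)
      · rw [add_mul]
        exact add_mem hx hy
    exact h _ (hX hY)

variable (μ) in
/-- The span of all products of an element of `Ω_red` and a word. -/
def kosSpan : Submodule ℂ (Omega μ) := ⨆ k, ⨆ ν, kosPiece μ ν k

theorem IsKos.mem_kosSpan {ν : ℕ} {k : ℤ} {X : Omega μ} (h : IsKos ν k X) : X ∈ kosSpan μ :=
  Submodule.mem_iSup_of_mem k (Submodule.mem_iSup_of_mem ν (Submodule.subset_span h))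

theorem kosSpan_le {T : Submodule ℂ (Omega μ)}
    (h : ∀ {ν : ℕ} {k : ℤ} {X : Omega μ}, IsKos ν k X → X ∈ T) : kosSpan μ ≤ T :=
  iSup_le fun _ => iSup_le fun _ => Submodule.span_le.2 fun _ hX => h hX

theorem kosSpan_mul_b {X : Omega μ} (hX : X ∈ kosSpan μ) (β : Pos μ) : X * b β ∈ kosSpan μ := by
  have h : kosSpan μ ≤ (kosSpan μ).comap (LinearMap.mulRight ℂ (b β)) :=
    kosSpan_le fun hX => (hX.b β).mem_kosSpan
  exact h hX

theorem kosSpan_mul_constraint {X : Omega μ} (hX : X ∈ kosSpan μ) (β : Pos μ) :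
    X * constraint β ∈ kosSpan μ := by
  have h : kosSpan μ ≤ (kosSpan μ).comap (LinearMap.mulRight ℂ (constraint β)) :=
    kosSpan_le fun hX => (hX.K β).mem_kosSpan
  exact h hX

theorem red_le_kosSpan : Subalgebra.toSubmodule (OmegaRed μ) ≤ kosSpan μ := by
  refine le_trans le_iSup_redPiece (iSup_le fun k => ?_)
  refine Submodule.span_le.2 fun X hX => ?_
  exact (IsKos.red (IsRed.mem hX) (IsRed.mem_degPiece hX)).mem_kosSpan

theorem redLetters_le_kosSpan : redLetters μ ≤ kosSpan μ := by
  rw [redLetters, Submodule.mul_le]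
  intro X hX Y hY
  have h : letters μ ≤ (kosSpan μ).comap (LinearMap.mulLeft ℂ X) := by
    refine Submodule.span_le.2 ?_
    rintro _ (rfl | ⟨α, rfl⟩ | ⟨α, rfl⟩)
    · simpa using red_le_kosSpan hX
    · exact kosSpan_mul_b (red_le_kosSpan hX) α
    · exact kosSpan_mul_constraint (red_le_kosSpan hX) α
  exact h hY

theorem mul_kosSpan {Y : Omega μ} (hY : ∀ X ∈ OmegaRed μ, Y * X ∈ kosSpan μ) {X : Omega μ}
    (hX : X ∈ kosSpan μ) : Y * X ∈ kosSpan μ := by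
  have h : kosSpan μ ≤ (kosSpan μ).comap (LinearMap.mulLeft ℂ Y) := by
    refine kosSpan_le fun hX => ?_
    change Y * _ ∈ kosSpan μ
    induction hX with
    | red hX _ => exact hY _ hX
    | b _ β ih => rw [← mul_assoc]; exact kosSpan_mul_b ih β
    | K _ β ih => rw [← mul_assoc]; exact kosSpan_mul_constraint ih β
  exact h hX

theorem kosSpan_eq_top : kosSpan μ = ⊤ := by
  -- The left multipliers of `kosSpan` form a subalgebra. It contains all generators of `Ω`, and
  -- `kosSpan` contains `1`.
  let S : Subalgebra ℂ (Omega μ) :=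
    { carrier := {Y | ∀ X ∈ kosSpan μ, Y * X ∈ kosSpan μ}
      mul_mem' := fun {Y Z} hY hZ X hX => by rw [mul_assoc]; exact hY _ (hZ _ hX)
      add_mem' := fun {Y Z} hY hZ X hX => by rw [add_mul]; exact add_mem (hY _ hX) (hZ _ hX)
      algebraMap_mem' := fun r X hX => by
        rw [← Algebra.smul_def]; exact Submodule.smul_mem _ _ hX }
  have hred : ∀ Y ∈ OmegaRed μ, Y ∈ S := fun Y hY X hX =>
    mul_kosSpan (fun Z hZ => red_le_kosSpan ((OmegaRed μ).mul_mem hY hZ)) hX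
  have hlet : ∀ Y ∈ letters μ, Y ∈ S := fun Y hY X hX =>
    mul_kosSpan (fun Z hZ => redLetters_le_kosSpan (letters_mul_red hY hZ)) hX
  have hc : ∀ α, c α ∈ S := fun α => hred _ (c_mem_OmegaRed α)
  have hb : ∀ α, b α ∈ S := fun α => hlet _ (b_mem_letters α)
  have hS : S = ⊤ := gens_span S (fun x => by
    have h : J x = Jhat (projPar x) + Jhat (projNeg x) - gh x := by
      rw [← JhatLin_apply, ← JhatLin_apply, ← map_add, projPar_add_projNeg, JhatLin_apply,
        Jhat_eq, add_sub_cancel_right]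
    rw [h, gh_eq]
    refine sub_mem (add_mem (hred _ (Jhat_projPar_mem x)) (hlet _ (Jhat_projNeg_mem_letters x)))
      (sum_mem fun β _ => mul_mem (hlet _ (bHat_mem_letters _)) (hc β))) hc hb
  rw [eq_top_iff]
  intro X _
  have hX : X ∈ S := by rw [hS]; trivial
  have := hX 1 (red_le_kosSpan (one_mem (OmegaRed μ)))
  rwa [mul_one] at this

theorem mem_iSup_kosPiece {k : ℤ} {X : Omega μ} (hX : X ∈ degPiece μ k) :
    X ∈ ⨆ ν, kosPiece μ ν k := by
  refine mem_of_mem_iSup_of_iSupIndep (S := fun k => ⨆ ν, kosPiece μ ν k) degPiece_iSupIndep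
    (fun k => iSup_le fun ν => kosPiece_le_degPiece ν k) hX ?_
  have h := @kosSpan_eq_top μ
  rw [kosSpan] at h
  rw [h]
  trivial

theorem exists_kos_decomposition {k : ℤ} {X : Omega μ} (hX : X ∈ degPiece μ k) :
    ∃ (s : Finset ℕ) (f : ℕ → Omega μ), 0 ∈ s ∧ (∀ ν, f ν ∈ kosPiece μ ν k) ∧
      ∑ ν ∈ s, f ν = X := by
  obtain ⟨f, hf, h⟩ := (Submodule.mem_iSup_iff_exists_finsupp _ _).1 (mem_iSup_kosPiece hX)
  -- The index `0` is included even if `f 0 = 0`, so that the reduced part can always be split off.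
  refine ⟨insert 0 f.support, f, Finset.mem_insert_self _ _, hf, ?_⟩
  rw [← h, Finsupp.sum]
  refine (Finset.sum_subset (Finset.subset_insert _ _) fun ν _ hν => ?_).symm
  exact Finsupp.notMem_support_iff.1 hν

/-- Every cocycle of degree `0` is cohomologous to one in `Ω_red`. -/
theorem exists_red_representative {Z : Omega μ} (hZ : Z ∈ degPiece μ 0) (hd : d μ Z = 0) :
    ∃ X ∈ OmegaRed μ, X ∈ degPiece μ 0 ∧ d μ X = 0 ∧ ∃ Y ∈ degPiece μ (-1), d μ Y = Z - X := by
  obtain ⟨s, f, h0, hf, rfl⟩ := exists_kos_decomposition hZ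
  rw [map_sum] at hd
  -- `d` preserves weights and the weight pieces are independent, so every component is closed.
  have hdf : ∀ ν ∈ s, d μ (f ν) = 0 :=
    (iSupIndep_iff_finsetSum_eq_zero_imp_eq_zero _).1 (kosPiece_iSupIndep (0 + 1)) s _
      (fun ν _ => d_mem_kosPiece (hf ν)) hd
  -- On a closed component of weight `ν ≠ 0` the relation `d h + h d = ν` becomes `d h = ν`, so
  -- division by `ν` gives a primitive.
  refine ⟨f 0, kosPiece_zero_le 0 (hf 0), kosPiece_le_degPiece _ _ (hf 0), hdf 0 h0,
    ∑ ν ∈ s.erase 0, (ν : ℂ)⁻¹ • homot μ (f ν), ?_, ?_⟩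
  · refine Submodule.sum_mem _ fun ν _ => Submodule.smul_mem _ _ ?_
    have := kosPiece_le_degPiece _ _ (homot_mem_kosPiece (hf ν))
    rwa [zero_add] at this
  · rw [map_sum, ← Finset.add_sum_erase s f h0, add_sub_cancel_left]
    refine Finset.sum_congr rfl fun ν hν => ?_
    have hν0 : (ν : ℂ) ≠ 0 := Nat.cast_ne_zero.2 (Finset.ne_of_mem_erase hν)
    have h1 := Module.End.mem_eigenspace_iff.1 (kosPiece_le_eigenspace ν 0 (hf ν))
    rw [laplace_apply, hdf ν (Finset.mem_of_mem_erase hν), map_zero, add_zero] at h1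
    rw [map_smul, h1, smul_smul, inv_mul_cancel₀ hν0, one_smul]

/-- A coboundary of degree `0` in `Ω_red` vanishes. -/
theorem red_coboundary_eq_zero {X Y : Omega μ} (hX : X ∈ OmegaRed μ) (hX0 : X ∈ degPiece μ 0)
    (hY : Y ∈ degPiece μ (-1)) (h : d μ Y = X) : X = 0 := by
  obtain ⟨s, f, h0, hf, rfl⟩ := exists_kos_decomposition hY
  have hf0 : f 0 = 0 :=
    red_neg_one_eq_zero (kosPiece_zero_le _ (hf 0)) (kosPiece_le_degPiece _ _ (hf 0))
  rw [map_sum, ← Finset.add_sum_erase s _ h0, hf0, map_zero, zero_add] at h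
  -- `X` has weight `0`, whereas `d Y` has no component of weight `0` because `f 0 = 0`.
  -- Independence is applied to `-X` together with the other components of `d Y`.
  have key := (iSupIndep_iff_finsetSum_eq_zero_imp_eq_zero _).1 (kosPiece_iSupIndep (μ := μ) 0) s
    (fun ν => if ν = 0 then - X else d μ (f ν)) (fun ν _ => ?_) ?_ 0 h0
  · simpa using key
  · split_ifs with hν
    · rw [hν]
      exact neg_mem (Submodule.subset_span (IsKos.red hX hX0))
    · have := d_mem_kosPiece (hf ν)
      rwa [neg_add_cancel] at this
  · rw [← Finset.add_sum_erase s _ h0, if_pos rfl, neg_add_eq_zero, ← h]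
    refine Finset.sum_congr rfl fun ν hν => ?_
    rw [if_neg (Finset.ne_of_mem_erase hν)]

/-! ### Symbols -/

variable (μ) in
/-- Polynomial functions on the space of matrices. -/
abbrev MatFn := MvPolynomial (μ.cells × μ.cells) ℂ

/-- The left invariant vector field attached to an element of `g`. -/
def lvf (x : G μ) : Derivation ℂ (MatFn μ) (MatFn μ) :=
  MvPolynomial.mkDerivation ℂ fun ij => ∑ k, x.1 k ij.2 • MvPolynomial.X (ij.1, k)

theorem lvf_X (x : G μ) (i j : μ.cells) :
    lvf x (MvPolynomial.X (i, j)) = ∑ k, x.1 k j • MvPolynomial.X (i, k) := by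
  rw [lvf, MvPolynomial.mkDerivation_X]

theorem lvf_lvf_X (x y : G μ) (i j : μ.cells) :
    lvf x (lvf y (MvPolynomial.X (i, j))) = ∑ k, (x.1 * y.1) k j • MvPolynomial.X (i, k) := by
  rw [lvf_X, map_sum]
  simp_rw [Derivation.map_smul, lvf_X, Finset.smul_sum, smul_smul]
  rw [Finset.sum_comm]
  refine Finset.sum_congr rfl fun k _ => ?_
  rw [← Finset.sum_smul, Matrix.mul_apply]
  congr 1
  exact Finset.sum_congr rfl fun l _ => mul_comm _ _

theorem lvf_lie (x y : G μ) : lvf ⁅x, y⁆ = ⁅lvf x, lvf y⁆ := by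
  apply MvPolynomial.derivation_ext
  rintro ⟨i, j⟩
  rw [Derivation.commutator_apply, lvf_lvf_X, lvf_lvf_X, lvf_X, ← Finset.sum_sub_distrib]
  refine Finset.sum_congr rfl fun k _ => ?_
  rw [LieAlgebra.SpecialLinear.sl_bracket, Matrix.sub_apply, sub_smul]

/-- `lvf` as a linear map into operators. -/
def lvfLin : G μ →ₗ[ℂ] Module.End ℂ (MatFn μ) where
  toFun x := (lvf x : MatFn μ →ₗ[ℂ] MatFn μ)
  map_add' x y := by
    have : lvf (x + y) = lvf x + lvf y := by
      apply MvPolynomial.derivation_ext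
      rintro ⟨i, j⟩
      rw [Derivation.add_apply, lvf_X, lvf_X, lvf_X, ← Finset.sum_add_distrib]
      refine Finset.sum_congr rfl fun k _ => ?_
      rw [← add_smul]
      rfl
    rw [this]; rfl
  map_smul' r x := by
    have : lvf (r • x) = r • lvf x := by
      apply MvPolynomial.derivation_ext
      rintro ⟨i, j⟩
      rw [Derivation.smul_apply, lvf_X, lvf_X, Finset.smul_sum]
      refine Finset.sum_congr rfl fun k _ => ?_
      rw [smul_smul]
      rfl
    rw [this]; rfl

theorem lvfLin_apply (x : G μ) (f : MatFn μ) : lvfLin x f = lvf x f := rfl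

theorem lvfLin_lie (x y : G μ) :
    lvfLin ⁅x, y⁆ = lvfLin x * lvfLin y - lvfLin y * lvfLin x := by
  refine LinearMap.ext fun f => ?_
  change lvf ⁅x, y⁆ f = _
  rw [lvf_lie, Derivation.commutator_apply]
  rfl

variable (μ) in
/-- The action of `U g` by left invariant differential operators. -/
def diffOp : UniversalEnvelopingAlgebra ℂ (G μ) →ₐ[ℂ] Module.End ℂ (MatFn μ) :=
  uLift lvfLin lvfLin_lie

theorem diffOp_ι (x : G μ) : diffOp μ (UniversalEnvelopingAlgebra.ι ℂ x) = lvfLin x :=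
  uLift_ι _ _ x

/-- Evaluation at the identity matrix. -/
def ev1 : MatFn μ →ₐ[ℂ] ℂ :=
  MvPolynomial.aeval fun ij => (1 : Matrix μ.cells μ.cells ℂ) ij.1 ij.2

/-- The affine function with differential `l` which vanishes at the identity. -/
def affine (l : Matrix μ.cells μ.cells ℂ →ₗ[ℂ] ℂ) : MatFn μ :=
  ∑ i, ∑ j, l (Matrix.single i j 1) •
    (MvPolynomial.X (i, j) - MvPolynomial.C ((1 : Matrix μ.cells μ.cells ℂ) i j))

section Symbols

variable (l : Matrix μ.cells μ.cells ℂ →ₗ[ℂ] ℂ)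

theorem ev1_affine : ev1 (affine l) = 0 := by
  simp [affine, ev1]

theorem ev1_lvf_affine (x : G μ) : ev1 (lvf x (affine l)) = l x.1 := by
  have h : ∀ i j, ev1 (lvf x (l (Matrix.single i j 1) •
      (MvPolynomial.X (i, j) - MvPolynomial.C ((1 : Matrix μ.cells μ.cells ℂ) i j)))) =
      l (Matrix.single i j (x.1 i j)) := by
    intro i j
    rw [Derivation.map_smul, map_sub, MvPolynomial.derivation_C, sub_zero, lvf_X, map_smul,
      map_sum]
    simp_rw [map_smul]
    rw [Finset.sum_eq_single i]
    · have h2 : Matrix.single i j (x.1 i j) = x.1 i j • Matrix.single i j (1 : ℂ) := by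
        rw [Matrix.smul_single, smul_eq_mul, mul_one]
      rw [h2, map_smul]
      simp [ev1, mul_comm]
    · intro k _ hk
      simp [ev1, Matrix.one_apply_ne hk.symm]
    · simp
  rw [affine, map_sum, map_sum]
  simp_rw [map_sum, h]
  conv_rhs => rw [Matrix.matrix_eq_sum_single x.1]
  simp_rw [map_sum]

/-- A product of elements of `g` in `U g`. -/
def uWord (w : List (G μ)) : UniversalEnvelopingAlgebra ℂ (G μ) :=
  (w.map (UniversalEnvelopingAlgebra.ι ℂ)).prod

/-- A derivation either hits a power of the affine function and lowers its exponent by one, or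
leaves the exponent unchanged. In the second case the term stays divisible by one more power and
goes into the remainder. -/
theorem diffOp_uWord_affine_pow (w : List (G μ)) (r : ℕ) : ∃ g : MatFn μ,
    diffOp μ (uWord w) (affine l ^ (w.length + r)) =
      ((w.length + r).descFactorial w.length : MatFn μ) * affine l ^ r *
        (w.map fun x => lvf x (affine l)).prod + affine l ^ (r + 1) * g := by
  induction w generalizing r with
  | nil => exact ⟨0, by simp [uWord]⟩
  | cons x w ih =>
    obtain ⟨g, hg⟩ := ih (r + 1)
    have h : uWord (x :: w) = UniversalEnvelopingAlgebra.ι ℂ x * uWord w := by simp [uWord]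
    have hlen : (x :: w).length + r = w.length + (r + 1) := by
      rw [List.length_cons]; omega
    have hdesc : ((w.length + (r + 1)).descFactorial (w.length + 1) : MatFn μ) =
        (r + 1) * (w.length + (r + 1)).descFactorial w.length := by
      rw [Nat.descFactorial_succ, Nat.add_sub_cancel_left]
      push_cast
      ring
    have h0 : lvf x (((w.length + (r + 1)).descFactorial w.length : ℕ) : MatFn μ) = 0 :=
      Derivation.map_natCast _ _
    refine ⟨((w.length + (r + 1)).descFactorial w.length : MatFn μ) *
      lvf x ((w.map fun x => lvf x (affine l)).prod) + (r + 2) * lvf x (affine l) * g +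
      affine l * lvf x g, ?_⟩
    rw [h, map_mul, Module.End.mul_apply, diffOp_ι, lvfLin_apply, hlen, hg, List.length_cons,
      hdesc, List.map_cons, List.prod_cons, map_add, Derivation.leibniz, Derivation.leibniz,
      Derivation.leibniz, Derivation.leibniz_pow, Derivation.leibniz_pow, h0]
    simp only [smul_eq_mul, nsmul_eq_mul, add_tsub_cancel_right]
    push_cast
    ring

/-- The `k`-th symbol of an element of `U g`, evaluated at `l`. -/
def symU (k : ℕ) : UniversalEnvelopingAlgebra ℂ (G μ) →ₗ[ℂ] ℂ :=
  ((k.factorial : ℂ)⁻¹ • ev1.toLinearMap) ∘ₗ LinearMap.applyₗ (affine l ^ k) ∘ₗ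
    (diffOp μ).toLinearMap

theorem symU_apply (k : ℕ) (u : UniversalEnvelopingAlgebra ℂ (G μ)) :
    symU l k u = (k.factorial : ℂ)⁻¹ * ev1 (diffOp μ u (affine l ^ k)) := rfl

/-- At the identity the affine function vanishes, so the remainder disappears and the main term
survives only if the word uses up all `k` factors. Top symbols are thus well defined without a
normal form in `U g`. -/
theorem symU_uWord (w : List (G μ)) (k : ℕ) (hk : w.length ≤ k) :
    symU l k (uWord w) = if w.length = k then (w.map fun x => l x.1).prod else 0 := by
  obtain ⟨r, rfl⟩ := Nat.exists_eq_add_of_le hk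
  obtain ⟨g, hg⟩ := diffOp_uWord_affine_pow l w r
  have hprod : ev1 ((w.map fun x => lvf x (affine l)).prod) = (w.map fun x => l x.1).prod := by
    rw [map_list_prod, List.map_map]
    congr 1
    refine List.map_congr_left fun x _ => ?_
    exact ev1_lvf_affine l x
  rw [symU_apply, hg, map_add, map_mul, map_mul, map_mul, map_pow, map_pow, ev1_affine, hprod,
    map_natCast, zero_pow (Nat.succ_ne_zero r), zero_mul, add_zero]
  rcases r with _ | r
  · rw [add_zero, if_pos rfl, pow_zero, mul_one, Nat.descFactorial_self, ← mul_assoc,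
      inv_mul_cancel₀ (Nat.cast_ne_zero.2 (Nat.factorial_ne_zero _)), one_mul]
  · rw [zero_pow (Nat.succ_ne_zero r), if_neg (by omega), mul_zero, zero_mul, mul_zero]

/-- The `k`-th symbol of an element of `Ω`, evaluated at `l`. -/
def symb (k : ℕ) : Omega μ →ₗ[ℂ] Ghost μ :=
  (TensorProduct.lid ℂ (Ghost μ)).toLinearMap ∘ₗ LinearMap.rTensor _ (symU l k)

theorem symb_tmul (k : ℕ) (u : UniversalEnvelopingAlgebra ℂ (G μ)) (v : Ghost μ) :
    symb l k (u ⊗ₜ v) = symU l k u • v := by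
  simp [symb]

variable (μ) in
/-- The filtration of `Ω` by the number of factors `J`. -/
def fil (k : ℕ) : Submodule ℂ (Omega μ) :=
  Submodule.span ℂ {X | ∃ (w : List (G μ)) (v : Ghost μ), w.length ≤ k ∧ X = uWord w ⊗ₜ v}

theorem uWord_append (w w' : List (G μ)) : uWord (w ++ w') = uWord w * uWord w' := by
  simp [uWord]

theorem fil_mul {i j : ℕ} {X Y : Omega μ} (hX : X ∈ fil μ i) (hY : Y ∈ fil μ j) :
    X * Y ∈ fil μ (i + j) := by
  have h := Submodule.mul_mem_mul hX hY
  rw [fil, fil, Submodule.span_mul_span] at h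
  refine Submodule.span_mono ?_ h
  rintro _ ⟨_, ⟨w, v, hw, rfl⟩, _, ⟨w', v', hw', rfl⟩, rfl⟩
  refine ⟨w ++ w', v * v', by rw [List.length_append]; omega, ?_⟩
  rw [uWord_append]
  exact Algebra.TensorProduct.tmul_mul_tmul _ _ _ _

theorem symb_eq_zero_of_lt {i k : ℕ} (h : i < k) {X : Omega μ} (hX : X ∈ fil μ i) :
    symb l k X = 0 := by
  have : fil μ i ≤ LinearMap.ker (symb l k) := by
    refine Submodule.span_le.2 ?_
    rintro _ ⟨w, v, hw, rfl⟩
    change symb l k _ = 0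
    rw [symb_tmul, symU_uWord l w k (by omega), if_neg (by omega), zero_smul]
  exact this hX

theorem symb_mul {i j : ℕ} {X Y : Omega μ} (hX : X ∈ fil μ i) (hY : Y ∈ fil μ j) :
    symb l (i + j) (X * Y) = symb l i X * symb l j Y := by
  induction hX using Submodule.span_induction with
  | mem X hX =>
    obtain ⟨w, v, hw, rfl⟩ := hX
    induction hY using Submodule.span_induction with
    | mem Y hY =>
      obtain ⟨w', v', hw', rfl⟩ := hY
      rw [Algebra.TensorProduct.tmul_mul_tmul, ← uWord_append, symb_tmul, symb_tmul, symb_tmul,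
        symU_uWord l _ i hw, symU_uWord l _ j hw',
        symU_uWord l _ (i + j) (by rw [List.length_append]; omega), smul_mul_smul_comm,
        List.length_append, List.map_append, List.prod_append]
      congr 1
      by_cases h1 : w.length = i
      · by_cases h2 : w'.length = j
        · rw [if_pos h1, if_pos h2, if_pos (by omega)]
        · rw [if_neg h2, if_neg (by omega), mul_zero]
      · rw [if_neg h1, if_neg (by omega), zero_mul]
    | zero => rw [mul_zero, map_zero, map_zero, mul_zero]
    | add Y Z _ _ h1 h2 => rw [mul_add, map_add, map_add, mul_add, h1, h2]
    | smul r Y _ h => rw [mul_smul_comm, map_smul, map_smul, mul_smul_comm, h]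
  | zero => rw [zero_mul, map_zero, map_zero, zero_mul]
  | add Y Z _ _ h1 h2 => rw [add_mul, map_add, map_add, add_mul, h1, h2]
  | smul r Y _ h => rw [smul_mul_assoc, map_smul, map_smul, smul_mul_assoc, h]

theorem ghost_mem_fil {X : Omega μ} (hX : X ∈ ghostSub μ) (k : ℕ) : X ∈ fil μ k := by
  obtain ⟨v, rfl⟩ := hX
  exact Submodule.subset_span ⟨[], v, Nat.zero_le _, rfl⟩

theorem J_mem_fil (x : G μ) : J x ∈ fil μ 1 :=
  Submodule.subset_span ⟨[x], 1, le_rfl, by simp [uWord, J]⟩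

theorem Jhat_mem_fil (x : G μ) : Jhat x ∈ fil μ 1 := by
  rw [Jhat_eq]
  exact add_mem (J_mem_fil x) (ghost_mem_fil (gh_mem_ghostSub x) 1)

theorem symb_J (x : G μ) : symb l 1 (J x) = l x.1 • 1 := by
  have h : J x = uWord [x] ⊗ₜ 1 := by simp [uWord, J]
  rw [h, symb_tmul, symU_uWord l [x] 1 le_rfl]
  simp

theorem symb_Jhat (x : G μ) : symb l 1 (Jhat x) = l x.1 • 1 := by
  rw [Jhat_eq, map_add, symb_J, symb_eq_zero_of_lt l zero_lt_one
    (ghost_mem_fil (gh_mem_ghostSub x) 0), add_zero]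

theorem symb_ghost (v : Ghost μ) : symb l 0 (1 ⊗ₜ v) = v := by
  have h : (1 : UniversalEnvelopingAlgebra ℂ (G μ)) = uWord [] := by simp [uWord]
  rw [h, symb_tmul, symU_uWord l [] 0 le_rfl]
  simp

/-- The ghosts as elements of the Clifford algebra. -/
def cG (α : Pos μ) : Ghost μ :=
  CliffordAlgebra.ι (QuadraticForm.dualProd ℂ (Pos μ → ℂ)) (0, Pi.single α 1)

theorem symb_c (α : Pos μ) : symb l 0 (c α) = cG α := symb_ghost l (cG α)

/-- A product of hatted generators. -/
def hatWord (w : List (G μ)) : Omega μ := (w.map Jhat).prod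

theorem hatWord_cons (x : G μ) (w : List (G μ)) : hatWord (x :: w) = Jhat x * hatWord w := by
  simp [hatWord]

theorem hatWord_mem_fil (w : List (G μ)) : hatWord w ∈ fil μ w.length := by
  induction w with
  | nil =>
    refine Submodule.subset_span ⟨[], 1, le_rfl, ?_⟩
    simp [hatWord, uWord, Algebra.TensorProduct.one_def]
  | cons x w ih =>
    rw [hatWord_cons, List.length_cons, add_comm]
    exact fil_mul (Jhat_mem_fil x) ih

theorem symb_hatWord (w : List (G μ)) :
    symb l w.length (hatWord w) = (w.map fun x => l x.1).prod • 1 := by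
  induction w with
  | nil => exact (symb_ghost l 1).trans (by simp)
  | cons x w ih =>
    rw [hatWord_cons, List.length_cons, add_comm, symb_mul l (Jhat_mem_fil x) (hatWord_mem_fil w),
      symb_Jhat, ih, smul_mul_smul_comm, one_mul, List.map_cons, List.prod_cons]

theorem fil_mul_ghost {k : ℕ} {X Y : Omega μ} (hX : X ∈ fil μ k) (hY : Y ∈ ghostSub μ) :
    X * Y ∈ fil μ k := by
  have h := fil_mul hX (ghost_mem_fil hY 0)
  rwa [add_zero] at h

theorem smul_one_mem_fil (r : ℂ) (k : ℕ) : r • (1 : Omega μ) ∈ fil μ k :=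
  Submodule.smul_mem _ _ (ghost_mem_fil (one_mem (ghostSub μ)) k)

theorem d_Jhat_mem_fil (x : G μ) : d μ (Jhat x) ∈ fil μ 1 := by
  rw [d_Jhat]
  refine neg_mem (Submodule.sum_mem _ fun α _ => ?_)
  refine fil_mul_ghost ?_ (c_mem_ghostSub α)
  refine add_mem (Jhat_mem_fil _) ?_
  exact smul_one_mem_fil _ 1

/-- The terms with `χ` have lower filtration and drop out. What remains is the action of `g_-` on `g
/ g_-`, realised on `g_{≥0}`. -/
theorem symb_d_Jhat (x : G μ) :
    symb l 1 (d μ (Jhat x)) = ∑ α : Pos μ, l (projPar ⁅dualRoot α, x⁆).1 • cG α := by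
  rw [d_Jhat, map_neg, map_sum, ← Finset.sum_neg_distrib]
  refine Finset.sum_congr rfl fun α _ => ?_
  rw [add_mul, map_add, smul_mul_assoc, one_mul, map_smul,
    symb_eq_zero_of_lt l zero_lt_one (ghost_mem_fil (c_mem_ghostSub α) 0), smul_zero, add_zero]
  have h := symb_mul l (Jhat_mem_fil (projPar ⁅x, dualRoot α⁆))
    (ghost_mem_fil (c_mem_ghostSub α) 0)
  rw [add_zero] at h
  rw [h, symb_Jhat, symb_c, smul_mul_assoc, one_mul, ← neg_smul, ← lie_skew x (dualRoot α),
    map_neg]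
  congr 1
  rw [← map_neg]
  congr 1
  exact neg_neg _

theorem d_hatWord_cons (x : G μ) (w : List (G μ)) :
    d μ (hatWord (x :: w)) = d μ (Jhat x) * hatWord w + Jhat x * d μ (hatWord w) := by
  rw [hatWord_cons, d_mul, parity_Jhat]

theorem d_hatWord_mem_fil (w : List (G μ)) : d μ (hatWord w) ∈ fil μ w.length := by
  induction w with
  | nil =>
    have h : hatWord ([] : List (G μ)) = 1 := by simp [hatWord]
    rw [h, d_one]
    exact zero_mem _
  | cons x w ih =>
    rw [d_hatWord_cons, List.length_cons, add_comm]
    exact add_mem (fil_mul (d_Jhat_mem_fil x) (hatWord_mem_fil w)) (fil_mul (Jhat_mem_fil x) ih)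

theorem symb_d_hatWord_cons (x : G μ) (w : List (G μ)) :
    symb l (w.length + 1) (d μ (hatWord (x :: w))) =
      (w.map fun x => l x.1).prod • ∑ α : Pos μ, l (projPar ⁅dualRoot α, x⁆).1 • cG α +
        l x.1 • symb l w.length (d μ (hatWord w)) := by
  rw [d_hatWord_cons, map_add, add_comm w.length 1,
    symb_mul l (d_Jhat_mem_fil x) (hatWord_mem_fil w),
    symb_mul l (Jhat_mem_fil x) (d_hatWord_mem_fil w), symb_hatWord, symb_Jhat, symb_d_Jhat,
    mul_smul_comm, mul_one, smul_mul_assoc, one_mul]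

end Symbols

/-- The ghosts are linearly independent. -/
theorem cG_linearIndependent : LinearIndependent ℂ (cG : Pos μ → Ghost μ) := by
  rw [Fintype.linearIndependent_iff]
  intro a ha α
  have h : ∀ β : Pos μ, CliffordAlgebra.ι (QuadraticForm.dualProd ℂ (Pos μ → ℂ))
      (LinearMap.proj α, 0) * cG β + cG β * CliffordAlgebra.ι
        (QuadraticForm.dualProd ℂ (Pos μ → ℂ)) (LinearMap.proj α, 0) =
      if β = α then 1 else 0 := by
    intro β
    rw [cG, CliffordAlgebra.ι_mul_ι_add_swap]
    have h : QuadraticMap.polar (QuadraticForm.dualProd ℂ (Pos μ → ℂ))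
        ((LinearMap.proj α, 0) : Module.Dual ℂ (Pos μ → ℂ) × (Pos μ → ℂ)) (0, Pi.single β 1) =
          if β = α then 1 else 0 := by
      simp [QuadraticMap.polar, Pi.single_apply, eq_comm]
    rw [h]
    split_ifs <;> simp
  let _ : Invertible (2 : ℂ) := invertibleOfNonzero two_ne_zero
  -- The anticommutator with the antighost `b^α` extracts the coefficient of `c_α`.
  have h2 : a α • (1 : Ghost μ) = 0 := by
    calc a α • (1 : Ghost μ) = ∑ β : Pos μ, a β • (CliffordAlgebra.ι
          (QuadraticForm.dualProd ℂ (Pos μ → ℂ)) (LinearMap.proj α, 0) * cG β + cG β *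
            CliffordAlgebra.ι (QuadraticForm.dualProd ℂ (Pos μ → ℂ)) (LinearMap.proj α, 0)) := by
          simp_rw [h]
          simp
      _ = CliffordAlgebra.ι (QuadraticForm.dualProd ℂ (Pos μ → ℂ)) (LinearMap.proj α, 0) *
            (∑ β, a β • cG β) + (∑ β, a β • cG β) *
            CliffordAlgebra.ι (QuadraticForm.dualProd ℂ (Pos μ → ℂ)) (LinearMap.proj α, 0) := by
          rw [Finset.mul_sum, Finset.sum_mul, ← Finset.sum_add_distrib]
          simp_rw [mul_smul_comm, smul_mul_assoc, smul_add]
      _ = 0 := by rw [ha, mul_zero, zero_mul, add_zero]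
  exact (smul_eq_zero.1 h2).resolve_right one_ne_zero

/-! ### Ordered monomials -/

section OrderedMonomials

variable {ι R : Type*} [Ring R] [Algebra ℂ R]

/-- The list of variables of a monomial. -/
def monList (m : ι →₀ ℕ) : List ι := (Finsupp.toMultiset m).toList

theorem monList_length (m : ι →₀ ℕ) : (monList m).length = m.degree := by
  rw [monList, Multiset.length_toList, Finsupp.card_toMultiset]
  rfl

theorem mem_monList {m : ι →₀ ℕ} {i : ι} : i ∈ monList m ↔ m i ≠ 0 := by
  rw [monList, Multiset.mem_toList, Finsupp.mem_toMultiset, Finsupp.mem_support_iff]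

theorem monList_prod_map {M : Type*} [CommMonoid M] (m : ι →₀ ℕ) (f : ι → M) :
    ((monList m).map f).prod = m.prod fun i k => f i ^ k := by
  rw [monList, ← Multiset.prod_coe, ← Multiset.map_coe, Multiset.coe_toList,
    Finsupp.toMultiset_map, Finsupp.prod_toMultiset, Finsupp.prod_mapDomain_index]
  · simp
  · intro b m n
    rw [pow_add]

variable (j : ι → R)

/-- The ordered monomial attached to a monomial. -/
def ordMon (m : ι →₀ ℕ) : R := ((monList m).map j).prod

/-- The linear map from polynomials which takes monomials to ordered monomials. -/
def ordPoly : MvPolynomial ι ℂ →ₗ[ℂ] R := (MvPolynomial.basisMonomials ι ℂ).constr ℂ (ordMon j)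

theorem ordPoly_monomial (m : ι →₀ ℕ) (r : ℂ) :
    ordPoly j (MvPolynomial.monomial m r) = r • ordMon j m := by
  have h : MvPolynomial.monomial m r = r • MvPolynomial.basisMonomials ι ℂ m := by
    rw [MvPolynomial.coe_basisMonomials, MvPolynomial.smul_monomial, smul_eq_mul, mul_one]
  rw [h, map_smul, ordPoly, Module.Basis.constr_basis]

theorem ordPoly_eq_sum (P : MvPolynomial ι ℂ) :
    ordPoly j P = ∑ m ∈ P.support, P.coeff m • ordMon j m := by
  conv_lhs => rw [P.as_sum]
  rw [map_sum]
  simp_rw [ordPoly_monomial]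

theorem map_ordPoly {R' : Type*} [Ring R'] [Algebra ℂ R'] (f : R →ₐ[ℂ] R')
    (P : MvPolynomial ι ℂ) : f (ordPoly j P) = ordPoly (fun i => f (j i)) P := by
  rw [ordPoly_eq_sum, ordPoly_eq_sum, map_sum]
  refine Finset.sum_congr rfl fun m _ => ?_
  rw [map_smul, ordMon, ordMon, map_list_prod, List.map_map]
  rfl

/-- The span of the words with less than `n` letters. -/
def wordSpan (n : ℕ) : Submodule ℂ R :=
  Submodule.span ℂ {X | ∃ w : List ι, w.length < n ∧ X = (w.map j).prod}

theorem wordSpan_mono {n n' : ℕ} (h : n ≤ n') : wordSpan j n ≤ wordSpan j n' := by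
  refine Submodule.span_mono ?_
  rintro _ ⟨w, hw, rfl⟩
  exact ⟨w, hw.trans_le h, rfl⟩

theorem mul_wordSpan (i : ι) {n : ℕ} {X : R} (hX : X ∈ wordSpan j n) :
    j i * X ∈ wordSpan j (n + 1) := by
  have h : wordSpan j n ≤ (wordSpan j (n + 1)).comap (LinearMap.mulLeft ℂ (j i)) := by
    refine Submodule.span_le.2 ?_
    rintro _ ⟨w, hw, rfl⟩
    exact Submodule.subset_span ⟨i :: w, by rw [List.length_cons]; omega, by simp⟩
  exact h hX

variable {j}

/-- Exchanging two adjacent letters costs a linear combination of letters in their place, hence only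
words that are one letter shorter. -/
theorem perm_sub_mem_wordSpan
    (hj : ∀ i k, j i * j k - j k * j i ∈ Submodule.span ℂ (Set.range j))
    {w w' : List ι} (h : w.Perm w') :
    (w.map j).prod - (w'.map j).prod ∈ wordSpan j w.length := by
  induction h with
  | nil => simp
  | cons i _ ih =>
    rw [List.map_cons, List.map_cons, List.prod_cons, List.prod_cons, ← mul_sub]
    exact mul_wordSpan j i ih
  | swap i k w =>
    simp only [List.map_cons, List.prod_cons, List.length_cons]
    rw [← mul_assoc, ← mul_assoc, ← sub_mul]
    have h : Submodule.span ℂ (Set.range j) ≤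
        (wordSpan j (w.length + 1 + 1)).comap (LinearMap.mulRight ℂ (w.map j).prod) := by
      refine Submodule.span_le.2 ?_
      rintro _ ⟨i, rfl⟩
      exact Submodule.subset_span ⟨i :: w, by simp, by simp⟩
    exact h (hj k i)
  | trans h1 h2 ih1 ih2 =>
    rw [← h1.length_eq] at ih2
    have := add_mem ih1 ih2
    rwa [sub_add_sub_cancel] at this

/-- A word differs from the chosen word of its multiset by shorter words, so induction on the length
applies. One word per multiset suffices; the letters need not carry a total order. -/
theorem wordSpan_le_range (hj : ∀ i k, j i * j k - j k * j i ∈ Submodule.span ℂ (Set.range j))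
    (n : ℕ) : wordSpan j n ≤ LinearMap.range (ordPoly j) := by
  classical
  induction n with
  | zero =>
    refine Submodule.span_le.2 ?_
    rintro _ ⟨w, hw, rfl⟩
    omega
  | succ n ih =>
    refine Submodule.span_le.2 ?_
    rintro _ ⟨w, hw, rfl⟩
    have hp : w.Perm (monList (Multiset.toFinsupp (w : Multiset ι))) := by
      rw [monList, Multiset.toFinsupp_toMultiset, ← Multiset.coe_eq_coe, Multiset.coe_toList]
    have h1 := ih (wordSpan_mono j (by omega) (perm_sub_mem_wordSpan hj hp))
    have h2 : ((monList (Multiset.toFinsupp (w : Multiset ι))).map j).prod ∈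
        LinearMap.range (ordPoly j) :=
      ⟨MvPolynomial.monomial (Multiset.toFinsupp (w : Multiset ι)) 1, by
        rw [ordPoly_monomial, one_smul]
        rfl⟩
    have := add_mem h1 h2
    rwa [sub_add_cancel] at this

/-- The ordered monomials span the algebra generated by the letters. -/
theorem exists_ordPoly_eq (hj : ∀ i k, j i * j k - j k * j i ∈ Submodule.span ℂ (Set.range j))
    {X : R} (hX : X ∈ Algebra.adjoin ℂ (Set.range j)) : ∃ P, ordPoly j P = X := by
  have h : Subalgebra.toSubmodule (Algebra.adjoin ℂ (Set.range j)) ≤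
      LinearMap.range (ordPoly j) := by
    rw [Algebra.adjoin_eq_span]
    refine Submodule.span_le.2 fun Y hY => ?_
    obtain ⟨w, hw, rfl⟩ := Submonoid.exists_list_of_mem_closure hY
    have h2 : ∃ w' : List ι, w = w'.map j := by
      clear hY
      induction w with
      | nil => exact ⟨[], rfl⟩
      | cons a w ih =>
        obtain ⟨w', rfl⟩ := ih fun y hy => hw y (List.mem_cons_of_mem _ hy)
        obtain ⟨i, rfl⟩ := hw a List.mem_cons_self
        exact ⟨i :: w', rfl⟩
    obtain ⟨w', rfl⟩ := h2
    exact wordSpan_le_range hj (w'.length + 1) (Submodule.subset_span ⟨w', by omega, rfl⟩)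
  exact h hX

end OrderedMonomials

/-! ### Independence of ordered monomials in the `Ĵ` -/

section Independence

variable {ι : Type*} (e : ι → G μ) (l : Matrix μ.cells μ.cells ℂ →ₗ[ℂ] ℂ)

theorem ordMon_Jhat (m : ι →₀ ℕ) :
    ordMon (fun i => Jhat (e i)) m = hatWord ((monList m).map e) := by
  rw [ordMon, hatWord, List.map_map]
  rfl

/-- The top symbol of an ordered polynomial. -/
theorem symb_ordPoly (P : MvPolynomial ι ℂ) {k : ℕ} (hk : P.totalDegree ≤ k) :
    symb l k (ordPoly (fun i => Jhat (e i)) P) =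
      MvPolynomial.eval (fun i => l (e i).1) (MvPolynomial.homogeneousComponent k P) • 1 := by
  rw [ordPoly_eq_sum, map_sum, MvPolynomial.homogeneousComponent_apply, map_sum, Finset.sum_smul,
    Finset.sum_filter]
  refine Finset.sum_congr rfl fun m hm => ?_
  have hlen : ((monList m).map e).length = m.degree := by rw [List.length_map, monList_length]
  have hle : m.degree ≤ k := (MvPolynomial.le_totalDegree hm).trans hk
  rw [map_smul, ordMon_Jhat]
  split_ifs with h
  · rw [← h, ← hlen, symb_hatWord, List.map_map, MvPolynomial.eval_monomial, mul_smul]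
    congr 2
    exact monList_prod_map m fun i => l (e i).1
  · rw [symb_eq_zero_of_lt l (lt_of_le_of_ne hle h), smul_zero]
    rw [← hlen]
    exact hatWord_mem_fil _

variable {e}

theorem exists_functional (he : LinearIndependent ℂ e) (y : ι → ℂ) :
    ∃ l : Matrix μ.cells μ.cells ℂ →ₗ[ℂ] ℂ, ∀ i, l (e i).1 = y i := by
  have he' : LinearIndependent ℂ fun i => (e i).1 :=
    he.map' ({ toFun := fun x => x.1, map_add' := fun _ _ => rfl, map_smul' := fun _ _ => rfl } :
      G μ →ₗ[ℂ] Matrix μ.cells μ.cells ℂ) (LinearMap.ker_eq_bot.2 Subtype.val_injective)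
  obtain ⟨l, hl⟩ := LinearMap.exists_extend ((Module.Basis.span he').constr ℂ y)
  refine ⟨l, fun i => ?_⟩
  have h := DFunLike.congr_fun hl (Module.Basis.span he' i)
  rw [Module.Basis.constr_basis] at h
  rw [← h, LinearMap.comp_apply]
  congr 1
  rw [Module.Basis.span_apply]
  rfl

theorem homogeneousComponent_totalDegree_eq_zero {P : MvPolynomial ι ℂ}
    (h : MvPolynomial.homogeneousComponent P.totalDegree P = 0) : P = 0 := by
  by_contra hP
  obtain ⟨m, hm, hmd⟩ := Finset.exists_mem_eq_sup P.support
    (MvPolynomial.support_nonempty.2 hP) fun s => s.sum fun _ e => e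
  have h2 := MvPolynomial.coeff_homogeneousComponent P.totalDegree P m
  have hmd' : m.degree = P.totalDegree := hmd.symm
  rw [if_pos hmd', h, MvPolynomial.coeff_zero] at h2
  exact MvPolynomial.mem_support_iff.1 hm h2.symm

theorem ghost_smul_one_eq_zero {r : ℂ} (h : r • (1 : Ghost μ) = 0) : r = 0 := by
  let _ : Invertible (2 : ℂ) := invertibleOfNonzero two_ne_zero
  exact (smul_eq_zero.1 h).resolve_right one_ne_zero

/-- The ordered monomials in the `Ĵ` of linearly independent elements are linearly independent. -/
theorem ordPoly_Jhat_injective (he : LinearIndependent ℂ e) {P : MvPolynomial ι ℂ}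
    (h : ordPoly (fun i => Jhat (e i)) P = 0) : P = 0 := by
  -- Linear independence provides a functional with any prescribed values `y` on the `e i`. The
  -- symbol at it is the value of the top component at `y`, so that component vanishes as a
  -- function.
  refine homogeneousComponent_totalDegree_eq_zero (MvPolynomial.funext fun y => ?_)
  obtain ⟨l, hl⟩ := exists_functional he y
  have h2 := symb_ordPoly e l P le_rfl
  rw [h, map_zero] at h2
  rw [map_zero]
  have h3 := ghost_smul_one_eq_zero h2.symm
  simp_rw [hl] at h3
  exact h3

end Independence

/-! ### A basis of the parabolic subalgebra -/

/-- The basis vector `t_α` of `g_+`. -/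
def tUp (α : Pos μ) : G μ := LieAlgebra.SpecialLinear.single α.1.1 α.1.2 α.ne.symm 1

theorem tUp_apply (α : Pos μ) (i j : μ.cells) :
    (tUp α).1 i j = if α.1 = (i, j) then 1 else 0 := by
  change Matrix.single α.1.1 α.1.2 (1 : ℂ) i j = _
  rw [Matrix.single_apply]
  exact if_congr (Prod.ext_iff (x := α.1) (y := (i, j))).symm rfl rfl

theorem ht_pos (α : Pos μ) : 0 < ht α := sub_pos.2 (Int.ofNat_lt.2 α.2)

theorem tUp_mem_grade (α : Pos μ) : tUp α ∈ grade μ (ht α) := by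
  intro i j h
  rw [tUp_apply] at h
  have h2 : α.1 = (i, j) := by
    by_contra h2
    exact h (if_neg h2)
  rw [ht, h2]

theorem dualRoot_mem_grade (α : Pos μ) : dualRoot α ∈ grade μ (-ht α) := by
  intro i j h
  have h2 : Matrix.single α.1.2 α.1.1 (1 : ℂ) i j ≠ 0 := h
  rw [Matrix.single_apply] at h2
  have h3 : α.1.2 = i ∧ α.1.1 = j := by
    by_contra h3
    exact h2 (if_neg h3)
  rw [ht, h3.1, h3.2, neg_sub]

variable (μ) in
/-- The index set of a basis of `g_{≥ 0}`. -/
abbrev ParIdx := Fin (Module.finrank ℂ (G0 μ)) ⊕ Pos μ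

variable (μ) in
/-- A basis of `g_0`. -/
abbrev basisZero : Module.Basis (Fin (Module.finrank ℂ (G0 μ))) ℂ (G0 μ) :=
  Module.finBasis ℂ (G0 μ)

/-- A basis of `g_{≥ 0}`: a basis of `g_0`, followed by the `t_α`. -/
def parBasis : ParIdx μ → G μ := Sum.elim (fun k => (basisZero μ k : G μ)) tUp

theorem mem_grade_zero_of_mem_G0 (x : G0 μ) : (x : G μ) ∈ grade μ 0 := x.2

theorem projPar_parBasis (i : ParIdx μ) : projPar (parBasis i) = parBasis i := by
  rcases i with k | α
  · exact projPar_of_mem_grade le_rfl (basisZero μ k).2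
  · exact projPar_of_mem_grade (sub_nonneg.2 (Int.ofNat_le.2 α.2.le)) (tUp_mem_grade α)

theorem grade_zero_apply {x : G μ} (hx : x ∈ grade μ 0) {i j : μ.cells} (h : col i ≠ col j) :
    x.1 i j = 0 := by
  by_contra h2
  have := hx i j h2
  omega

theorem sum_smul_tUp_apply (a : Pos μ → ℂ) (i j : μ.cells) :
    (∑ α, a α • tUp α : G μ).1 i j = if h : col i < col j then a ⟨(i, j), h⟩ else 0 := by
  rw [AddSubmonoidClass.coe_finsetSum, Matrix.sum_apply]
  have h : ∀ α : Pos μ, ((a α • tUp α : G μ) : Matrix μ.cells μ.cells ℂ) i j =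
      if α.1 = (i, j) then a α else 0 := by
    intro α
    change a α * (tUp α).1 i j = _
    rw [tUp_apply, mul_ite, mul_one, mul_zero]
  simp_rw [h]
  split_ifs with hc
  · rw [Finset.sum_eq_single ⟨(i, j), hc⟩]
    · simp
    · intro γ _ hγ
      exact if_neg fun h2 => hγ (Subtype.ext h2)
    · simp
  · refine Finset.sum_eq_zero fun γ _ => if_neg fun h2 => hc ?_
    have := γ.2
    rwa [h2] at this

theorem parBasis_linearIndependent : LinearIndependent ℂ (parBasis : ParIdx μ → G μ) := by
  rw [Fintype.linearIndependent_iff]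
  intro g hg
  rw [Fintype.sum_sum_type] at hg
  have hz : (∑ k, g (Sum.inl k) • (basisZero μ k : G μ)) =
      ((∑ k, g (Sum.inl k) • basisZero μ k : G0 μ) : G μ) := by
    rw [AddSubmonoidClass.coe_finsetSum]
    rfl
  have h1 : ∀ α, g (Sum.inr α) = 0 := by
    intro α
    have hz2 : (∑ k, g (Sum.inl k) • (basisZero μ k : G μ)).1 α.1.1 α.1.2 = 0 := by
      rw [hz]
      exact grade_zero_apply (mem_grade_zero_of_mem_G0 _) α.2.ne
    have h2 : (∑ k, g (Sum.inl k) • parBasis (Sum.inl k) +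
        ∑ α, g (Sum.inr α) • parBasis (Sum.inr α) : G μ).1 α.1.1 α.1.2 = 0 := by
      rw [hg]; rfl
    change (∑ k, g (Sum.inl k) • (basisZero μ k : G μ)).1 α.1.1 α.1.2 +
      (∑ α, g (Sum.inr α) • tUp α : G μ).1 α.1.1 α.1.2 = 0 at h2
    rw [sum_smul_tUp_apply, dif_pos α.2, hz2, zero_add] at h2
    exact h2
  rintro (k | α)
  · simp_rw [h1, zero_smul, Finset.sum_const_zero, add_zero] at hg
    have h3 : (∑ k, g (Sum.inl k) • basisZero μ k : G0 μ) = 0 := Subtype.ext (hz.symm.trans hg)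
    exact Fintype.linearIndependent_iff.1 (basisZero μ).linearIndependent _ h3 k
  · exact h1 α

theorem mem_span_parBasis {x : G μ} (hx : projPar x = x) :
    x ∈ Submodule.span ℂ (Set.range (parBasis : ParIdx μ → G μ)) := by
  rw [projPar_eq_self_iff] at hx
  let y : G μ := ∑ α : Pos μ, x.1 α.1.1 α.1.2 • tUp α
  have hy : y ∈ Submodule.span ℂ (Set.range (parBasis : ParIdx μ → G μ)) :=
    Submodule.sum_mem _ fun α _ => Submodule.smul_mem _ _ (Submodule.subset_span ⟨Sum.inr α, rfl⟩)
  have hz : x - y ∈ grade μ 0 := by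
    intro i j h
    by_contra hc
    apply h
    change x.1 i j - y.1 i j = 0
    rw [sum_smul_tUp_apply]
    split_ifs with h2
    · exact sub_self _
    · rw [hx i j (by omega), sub_zero]
  let z : G0 μ := ⟨x - y, hz⟩
  have hz2 : (z : G μ) ∈ Submodule.span ℂ (Set.range (parBasis : ParIdx μ → G μ)) := by
    rw [← (basisZero μ).sum_repr z, AddSubmonoidClass.coe_finsetSum]
    exact Submodule.sum_mem _ fun k _ =>
      Submodule.smul_mem _ _ (Submodule.subset_span ⟨Sum.inl k, rfl⟩)
  have := add_mem hz2 hy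
  rwa [sub_add_cancel] at this

theorem Jhat_mem_span {ι : Type*} (e : ι → G μ) {x : G μ}
    (hx : x ∈ Submodule.span ℂ (Set.range e)) :
    Jhat x ∈ Submodule.span ℂ (Set.range fun i => Jhat (e i)) := by
  have h : Submodule.span ℂ (Set.range e) ≤
      (Submodule.span ℂ (Set.range fun i => Jhat (e i))).comap JhatLin := by
    refine Submodule.span_le.2 ?_
    rintro _ ⟨i, rfl⟩
    exact Submodule.subset_span ⟨i, (JhatLin_apply (e i)).symm⟩
  have := h hx
  rwa [Submodule.mem_comap, JhatLin_apply] at this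

/-- The corrections in `Jhat_Jhat` are antighosts of brackets of two elements of `g_{≥0}`, and such
brackets have no `g_-` part. -/
theorem Jhat_Jhat_of_projPar {x y : G μ} (hx : projPar x = x) (hy : projPar y = y) :
    Jhat x * Jhat y - Jhat y * Jhat x = Jhat ⁅x, y⁆ := by
  have h : ∀ z w : G μ, projPar z = z → bHat ⁅z, projPar w⁆ = 0 := by
    intro z w hz
    rw [bHat_eq]
    refine Finset.sum_eq_zero fun γ _ => ?_
    rw [← hz, coef_lie_projPar, zero_smul]
  rw [Jhat_Jhat, add_eq_left]
  refine Finset.sum_eq_zero fun β _ => ?_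
  rw [map_sub, h _ _ hx, h _ _ hy, sub_zero, zero_mul]

theorem Jhat_parBasis_comm (i k : ParIdx μ) :
    Jhat (parBasis i) * Jhat (parBasis k) - Jhat (parBasis k) * Jhat (parBasis i) ∈
      Submodule.span ℂ (Set.range fun i : ParIdx μ => Jhat (parBasis i)) := by
  rw [Jhat_Jhat_of_projPar (projPar_parBasis i) (projPar_parBasis k)]
  refine Jhat_mem_span _ (mem_span_parBasis ?_)
  have := projPar_lie_projPar (parBasis i) (parBasis k)
  rwa [projPar_parBasis, projPar_parBasis] at this

theorem IsRed.mem_adjoin {k : ℤ} {X : Omega μ} (h : IsRed k X) (hk : k = 0) :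
    X ∈ Algebra.adjoin ℂ (Set.range fun i : ParIdx μ => Jhat (parBasis i)) := by
  induction h with
  | one => exact one_mem _
  | J m hm x hx _ ih =>
    exact mul_mem (Algebra.span_le_adjoin ℂ _
      (Jhat_mem_span _ (mem_span_parBasis (projPar_of_mem_grade hm hx)))) (ih hk)
  | c α hX _ =>
    have := hX.nonneg
    omega

/-- The elements of degree `0` of `Ω_red` are ordered polynomials. -/
theorem exists_ordPoly_parBasis {X : Omega μ} (hX : X ∈ OmegaRed μ) (hk : X ∈ degPiece μ 0) :
    ∃ P, ordPoly (fun i : ParIdx μ => Jhat (parBasis i)) P = X := by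
  refine exists_ordPoly_eq Jhat_parBasis_comm ?_
  have h : redPiece μ 0 ≤ Subalgebra.toSubmodule
      (Algebra.adjoin ℂ (Set.range fun i : ParIdx μ => Jhat (parBasis i))) :=
    Submodule.span_le.2 fun Y hY => IsRed.mem_adjoin hY rfl
  exact h (mem_redPiece hX hk)

/-! ### The symbol of the differential -/

theorem projPar_lie_mem_span (α : Pos μ) (i : ParIdx μ) :
    ∃ a : ParIdx μ → ℂ, ∑ k, a k • parBasis k = projPar ⁅dualRoot α, parBasis i⁆ :=
  (Submodule.mem_span_range_iff_exists_fun ℂ).1 (mem_span_parBasis (projPar_projPar _))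

/-- The coefficients of the action of `g_-` on `g / g_-`. -/
def parCoef (α : Pos μ) (i : ParIdx μ) : ParIdx μ → ℂ := (projPar_lie_mem_span α i).choose

theorem sum_parCoef (α : Pos μ) (i : ParIdx μ) :
    ∑ k, parCoef α i k • parBasis k = projPar ⁅dualRoot α, parBasis i⁆ :=
  (projPar_lie_mem_span α i).choose_spec

/-- The action of `g_-` on polynomials by derivations. -/
def symbDer (α : Pos μ) :
    Derivation ℂ (MvPolynomial (ParIdx μ) ℂ) (MvPolynomial (ParIdx μ) ℂ) :=
  MvPolynomial.mkDerivation ℂ fun i => ∑ k, parCoef α i k • MvPolynomial.X k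

theorem symbDer_X (α : Pos μ) (i : ParIdx μ) :
    symbDer α (MvPolynomial.X i) = ∑ k, parCoef α i k • MvPolynomial.X k :=
  MvPolynomial.mkDerivation_X _ _ _

section Functional

variable (l : Matrix μ.cells μ.cells ℂ →ₗ[ℂ] ℂ)

/-- The evaluation of polynomials at a linear functional. -/
def evalFunctional : MvPolynomial (ParIdx μ) ℂ →+* ℂ := MvPolynomial.eval fun i => l (parBasis i).1

theorem evalFunctional_X (i : ParIdx μ) : evalFunctional l (MvPolynomial.X i) = l (parBasis i).1 :=
  MvPolynomial.eval_X _

theorem evalFunctional_symbDer_X (α : Pos μ) (i : ParIdx μ) :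
    evalFunctional l (symbDer α (MvPolynomial.X i)) = l (projPar ⁅dualRoot α, parBasis i⁆).1 := by
  rw [symbDer_X, ← sum_parCoef, AddSubmonoidClass.coe_finsetSum, map_sum, map_sum]
  refine Finset.sum_congr rfl fun k _ => ?_
  rw [evalFunctional, MvPolynomial.smul_eval, MvPolynomial.eval_X]
  exact (l.map_smul (parCoef α i k) (parBasis k).1).symm

theorem eq_zero_of_evalFunctional {T : MvPolynomial (ParIdx μ) ℂ} (h : ∀ l, evalFunctional l T = 0) : T = 0 := by
  refine MvPolynomial.funext fun y => ?_
  obtain ⟨l, hl⟩ := exists_functional parBasis_linearIndependent y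
  have h2 := h l
  rw [evalFunctional] at h2
  simp_rw [hl] at h2
  rw [h2, map_zero]

theorem evalFunctional_prod_X (w : List (ParIdx μ)) :
    evalFunctional l ((w.map MvPolynomial.X).prod) = ((w.map parBasis).map fun x => l x.1).prod := by
  rw [map_list_prod, List.map_map, List.map_map]
  congr 1
  refine List.map_congr_left fun i _ => ?_
  exact evalFunctional_X l i

/-- On words in the even elements `Ĵ` both sides obey the Leibniz rule, so the formula `symb_d_Jhat`
for a single generator propagates along the word. -/
theorem symb_d_word (w : List (ParIdx μ)) :
    symb l w.length (d μ (hatWord (w.map parBasis))) =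
      ∑ α : Pos μ, evalFunctional l (symbDer α ((w.map MvPolynomial.X).prod)) • cG α := by
  induction w with
  | nil =>
    have h : hatWord (([] : List (ParIdx μ)).map parBasis) = 1 := by simp [hatWord]
    rw [h, d_one, map_zero]
    refine (Finset.sum_eq_zero fun α _ => ?_).symm
    rw [List.map_nil, List.prod_nil, Derivation.map_one_eq_zero, map_zero, zero_smul]
  | cons i w ih =>
    have h := symb_d_hatWord_cons l (parBasis i) (w.map parBasis)
    rw [List.length_map, ih] at h
    rw [List.map_cons, List.length_cons, h, Finset.smul_sum, Finset.smul_sum,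
      ← Finset.sum_add_distrib]
    refine Finset.sum_congr rfl fun α _ => ?_
    rw [List.map_cons, List.prod_cons, Derivation.leibniz, smul_eq_mul, smul_eq_mul, map_add,
      map_mul, map_mul, evalFunctional_symbDer_X, evalFunctional_X, evalFunctional_prod_X, smul_smul, smul_smul, add_smul,
      add_comm]

theorem symb_d_ordMon (m : ParIdx μ →₀ ℕ) :
    symb l m.degree (d μ (ordMon (fun i => Jhat (parBasis i)) m)) =
      ∑ α : Pos μ, evalFunctional l (symbDer α (MvPolynomial.monomial m 1)) • cG α := by
  have h := symb_d_word l (monList m)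
  rw [monList_length, monList_prod_map] at h
  rw [ordMon_Jhat, h, MvPolynomial.monomial_eq, MvPolynomial.C_1, one_mul]

/-- The top symbol of the differential of an ordered polynomial. -/
theorem symb_d_ordPoly (P : MvPolynomial (ParIdx μ) ℂ) {k : ℕ} (hk : P.totalDegree ≤ k) :
    symb l k (d μ (ordPoly (fun i => Jhat (parBasis i)) P)) =
      ∑ α : Pos μ, evalFunctional l (symbDer α (MvPolynomial.homogeneousComponent k P)) • cG α := by
  have hr : ∀ α : Pos μ, evalFunctional l (symbDer α (MvPolynomial.homogeneousComponent k P)) =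
      ∑ m ∈ P.support, if m.degree = k then
        P.coeff m * evalFunctional l (symbDer α (MvPolynomial.monomial m 1)) else 0 := by
    intro α
    rw [MvPolynomial.homogeneousComponent_apply, map_sum, map_sum, Finset.sum_filter]
    refine Finset.sum_congr rfl fun m _ => ?_
    have h : MvPolynomial.monomial m (P.coeff m) =
        P.coeff m • MvPolynomial.monomial m (1 : ℂ) := by
      rw [MvPolynomial.smul_monomial, smul_eq_mul, mul_one]
    rw [h, Derivation.map_smul, evalFunctional, MvPolynomial.smul_eval]
  simp_rw [hr, Finset.sum_smul]
  rw [Finset.sum_comm, ordPoly_eq_sum, map_sum, map_sum]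
  refine Finset.sum_congr rfl fun m hm => ?_
  have hle : m.degree ≤ k := (MvPolynomial.le_totalDegree hm).trans hk
  rw [map_smul, map_smul]
  by_cases h : m.degree = k
  · simp_rw [if_pos h]
    rw [← h, symb_d_ordMon, Finset.smul_sum]
    simp_rw [smul_smul]
  · simp_rw [if_neg h, zero_smul]
    rw [Finset.sum_const_zero, symb_eq_zero_of_lt l (lt_of_le_of_ne hle h), smul_zero]
    have h2 := d_hatWord_mem_fil ((monList m).map parBasis)
    rwa [← ordMon_Jhat, List.length_map, monList_length] at h2

end Functional

theorem symbDer_homogeneousComponent {P : MvPolynomial (ParIdx μ) ℂ} {k : ℕ}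
    (hk : P.totalDegree ≤ k) (h : d μ (ordPoly (fun i => Jhat (parBasis i)) P) = 0) (α : Pos μ) :
    symbDer α (MvPolynomial.homogeneousComponent k P) = 0 := by
  refine eq_zero_of_evalFunctional fun l => ?_
  have h2 := symb_d_ordPoly l P hk
  rw [h, map_zero] at h2
  exact Fintype.linearIndependent_iff.1 cG_linearIndependent _ h2.symm α

/-- `[g_-, g_0] ⊆ g_-` is zero in `g / g_-`. -/
theorem symbDer_X_inl (α : Pos μ) (k : Fin (Module.finrank ℂ (G0 μ))) :
    symbDer α (MvPolynomial.X (Sum.inl k)) = 0 := by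
  refine eq_zero_of_evalFunctional fun l => ?_
  rw [evalFunctional_symbDer_X]
  have h : projPar ⁅dualRoot α, parBasis (Sum.inl k)⁆ = 0 := by
    apply Subtype.ext
    refine Matrix.ext fun i j => ?_
    rw [projPar_apply]
    split_ifs with hij
    · rfl
    · by_contra h2
      have h3 := grade_bracket μ (dualRoot_mem_grade α)
        (mem_grade_zero_of_mem_G0 (basisZero μ k)) i j h2
      have := ht_pos α
      omega
  rw [h]
  exact map_zero l

theorem derivation_sum_apply {ι A M : Type*} [CommRing A] [Algebra ℂ A] [AddCommGroup M]
    [Module A M] [Module ℂ M] (s : Finset ι) (D : ι → Derivation ℂ A M) (a : A) :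
    (∑ i ∈ s, D i) a = ∑ i ∈ s, D i a := by
  have h := map_sum (Derivation.coeFnAddMonoidHom (R := ℂ) (A := A) (M := M)) D s
  have h2 := congrFun h a
  rwa [Finset.sum_apply] at h2

theorem symbDer_eq_sum (α : Pos μ) (T : MvPolynomial (ParIdx μ) ℂ) :
    symbDer α T = ∑ i, symbDer α (MvPolynomial.X i) * MvPolynomial.pderiv i T := by
  have h : symbDer α = ∑ i, symbDer α (MvPolynomial.X i) • MvPolynomial.pderiv i := by
    apply MvPolynomial.derivation_ext
    intro k
    rw [derivation_sum_apply, Finset.sum_eq_single k]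
    · simp
    · intro i _ hi
      simp [MvPolynomial.pderiv_X_of_ne hi.symm]
    · simp
  conv_lhs => rw [h]
  rw [derivation_sum_apply]
  rfl

/-! ### Nondegeneracy of the pairing between `g_-` and `g_+` -/

variable (μ) in
/-- The linear functional given by the grading element. -/
def colFunctional : Matrix μ.cells μ.cells ℂ →ₗ[ℂ] ℂ :=
  ∑ i : μ.cells, (-(col i : ℂ)) • Matrix.entryLinearMap ℂ ℂ i i

theorem colFunctional_apply (x : Matrix μ.cells μ.cells ℂ) :
    colFunctional μ x = ∑ i : μ.cells, -(col i : ℂ) * x i i := by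
  simp [colFunctional, LinearMap.sum_apply]

theorem colFunctional_projPar (x : G μ) : colFunctional μ (projPar x).1 = colFunctional μ x.1 := by
  rw [colFunctional_apply, colFunctional_apply]
  refine Finset.sum_congr rfl fun i _ => ?_
  rw [projPar_apply, if_neg (lt_irrefl _)]

/-- The functional is the trace form with `D = diag(-col)`, which differs from `δ` by a scalar
matrix. By invariance, `Tr (D [t^α, t_β]) = Tr ([D, t^α] t_β)`, and `t^α` has grade `-ht α`. -/
theorem colFunctional_lie (α β : Pos μ) :
    colFunctional μ ⁅dualRoot α, tUp β⁆.1 = if α = β then -(ht α : ℂ) else 0 := by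
  rw [LieAlgebra.SpecialLinear.sl_bracket]
  change colFunctional μ (Matrix.single α.1.2 α.1.1 1 * Matrix.single β.1.1 β.1.2 1 -
    Matrix.single β.1.1 β.1.2 1 * Matrix.single α.1.2 α.1.1 1) = _
  rw [colFunctional_apply]
  by_cases h : α = β
  · subst h
    rw [if_pos rfl, Matrix.single_mul_single_same, Matrix.single_mul_single_same]
    simp_rw [Matrix.sub_apply, mul_sub, Finset.sum_sub_distrib, Matrix.single_apply, and_self]
    simp [ht]
    ring
  · rw [if_neg h]
    refine Finset.sum_eq_zero fun i _ => ?_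
    have h2 : ¬ (α.1.1 = β.1.1 ∧ α.1.2 = β.1.2) := fun h2 => h (Subtype.ext (Prod.ext h2.1 h2.2))
    rw [Matrix.sub_apply]
    by_cases h3 : α.1.1 = β.1.1
    · have h4 : α.1.2 ≠ β.1.2 := fun h4 => h2 ⟨h3, h4⟩
      rw [h3, Matrix.single_mul_single_same, Matrix.single_mul_single_of_ne _ _ _ _ h4.symm,
        Matrix.single_apply, if_neg fun h5 => h4 (h5.1.trans h5.2.symm)]
      simp
    · rw [Matrix.single_mul_single_of_ne _ _ _ _ h3]
      by_cases h4 : α.1.2 = β.1.2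
      · rw [h4, Matrix.single_mul_single_same, Matrix.single_apply,
          if_neg fun h5 => h3 (h5.2.trans h5.1.symm)]
        simp
      · rw [Matrix.single_mul_single_of_ne _ _ _ _ (Ne.symm h4)]
        simp

variable (μ) in
/-- The matrix of the pairing between `g_-` and `g_+` given by a linear functional. -/
def pairingMatrix : Matrix (Pos μ) (Pos μ) (MvPolynomial (ParIdx μ) ℂ) :=
  Matrix.of fun α β => symbDer α (MvPolynomial.X (Sum.inr β))

/-- One nonzero value suffices: at `colFunctional` the matrix is diagonal with entries `-ht α`. -/
theorem pairingMatrix_det_ne_zero : (pairingMatrix μ).det ≠ 0 := by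
  intro h
  have h2 := congrArg (evalFunctional (colFunctional μ)) h
  rw [map_zero, RingHom.map_det] at h2
  have h3 : (evalFunctional (colFunctional μ)).mapMatrix (pairingMatrix μ) =
      Matrix.diagonal fun α : Pos μ => -(ht α : ℂ) := by
    refine Matrix.ext fun α β => ?_
    rw [RingHom.mapMatrix_apply, Matrix.map_apply, Matrix.diagonal_apply, ← colFunctional_lie,
      ← colFunctional_projPar]
    exact evalFunctional_symbDer_X _ α (Sum.inr β)
  rw [h3, Matrix.det_diagonal, Finset.prod_eq_zero_iff] at h2
  obtain ⟨α, -, hα⟩ := h2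
  rw [neg_eq_zero, Int.cast_eq_zero] at hα
  exact (ht_pos α).ne' hα

/-- The equations `symbDer α T = 0` are linear in the partial derivatives of `T`. The variables of
grade `0` do not contribute, and the remaining square system has nonzero determinant over a domain.
-/
theorem pderiv_inr_eq_zero {T : MvPolynomial (ParIdx μ) ℂ} (h : ∀ α, symbDer α T = 0)
    (β : Pos μ) : MvPolynomial.pderiv (Sum.inr β) T = 0 := by
  have h2 : (pairingMatrix μ).mulVec (fun β => MvPolynomial.pderiv (Sum.inr β) T) = 0 := by
    funext α
    have h3 := symbDer_eq_sum α T
    rw [h, Fintype.sum_sum_type] at h3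
    simp_rw [symbDer_X_inl, zero_mul, Finset.sum_const_zero, zero_add] at h3
    exact h3.symm
  exact congrFun (Matrix.eq_zero_of_mulVec_eq_zero pairingMatrix_det_ne_zero h2) β

theorem support_of_pderiv_eq_zero {ι : Type*} {T : MvPolynomial ι ℂ} {i : ι}
    (h : MvPolynomial.pderiv i T = 0) {m : ι →₀ ℕ} (hm : T.coeff m ≠ 0) : m i = 0 := by
  classical
  by_contra hi
  have h2 := MvPolynomial.coeff_pderiv T (m - Finsupp.single i 1) (i := i)
  rw [h, MvPolynomial.coeff_zero, tsub_add_cancel_of_le] at h2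
  · rcases mul_eq_zero.1 h2.symm with h3 | h3
    · exact hm h3
    · exact Nat.cast_add_one_ne_zero _ h3
  · exact Finsupp.single_le_iff.2 (Nat.one_le_iff_ne_zero.2 hi)

/-! ### Components of bidegree `(0, 0)` -/

theorem J_mem_bideg {m : ℤ} {x : G μ} (hx : x ∈ grade μ m) : J x ∈ bideg μ (m, -m) :=
  Submodule.subset_span (IsGen.J m x hx).isMonomial

theorem b_mul_c_mem_bideg (β γ : Pos μ) : b γ * c β ∈ bideg μ (ht β - ht γ, -(ht β - ht γ)) := by
  have h : (ht β - ht γ, -(ht β - ht γ)) = (-ht γ, ht γ - 1) + (ht β, 1 - ht β) := by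
    rw [Prod.mk_add_mk]
    congr 1 <;> ring
  rw [h]
  exact Submodule.subset_span ((IsGen.b γ).isMonomial.mul (IsGen.c β).isMonomial)

theorem Jhat_mem_bideg {m : ℤ} {x : G μ} (hx : x ∈ grade μ m) : Jhat x ∈ bideg μ (m, -m) := by
  rw [Jhat]
  refine add_mem (J_mem_bideg hx) (Submodule.sum_mem _ fun β _ => Submodule.sum_mem _ fun γ _ => ?_)
  by_cases h : structConst x β γ = 0
  · rw [h, zero_smul]
    exact zero_mem _
  · have h2 := grade_bracket μ hx (dualRoot_mem_grade β) _ _ h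
    have h3 : m = ht β - ht γ := by
      simp only [ht] at h2 ⊢
      omega
    rw [h3]
    exact Submodule.smul_mem _ _ (b_mul_c_mem_bideg β γ)

variable (μ) in
/-- The span of the pieces of bidegree `(p, -p)`, `p ≥ 0`. -/
def nonnegPiece : Submodule ℂ (Omega μ) :=
  Submodule.span ℂ {X | ∃ p : ℤ, 0 ≤ p ∧ X ∈ bideg μ (p, -p)}

/-- The component of bidegree `(0, 0)`, as a linear map. -/
def componentZero : Omega μ →ₗ[ℂ] Omega μ where
  toFun := component (0, 0)
  map_add' X Y := by rw [component, DirectSum.decompose_add]; rfl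
  map_smul' r X := by rw [component, DirectSum.decompose_smul]; rfl

theorem componentZero_of_mem {X : Omega μ} (hX : X ∈ bideg μ (0, 0)) : componentZero X = X :=
  DirectSum.decompose_of_mem_same _ hX

theorem componentZero_of_pos {p : ℤ} (hp : 0 < p) {X : Omega μ} (hX : X ∈ bideg μ (p, -p)) :
    componentZero X = 0 := by
  refine DirectSum.decompose_of_mem_ne _ hX fun h => ?_
  have := congrArg Prod.fst h
  exact hp.ne' this

theorem mul_mem_bideg_neg {p q : ℤ} {X Y : Omega μ} (hX : X ∈ bideg μ (p, -p))
    (hY : Y ∈ bideg μ (q, -q)) : X * Y ∈ bideg μ (p + q, -(p + q)) := by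
  have h := bideg_mul hX hY
  rwa [Prod.mk_add_mk, ← neg_add] at h

theorem componentZero_mul_of_mem {p q : ℤ} (hp : 0 ≤ p) (hq : 0 ≤ q) {X Y : Omega μ}
    (hX : X ∈ bideg μ (p, -p)) (hY : Y ∈ bideg μ (q, -q)) :
    componentZero (X * Y) = componentZero X * componentZero Y := by
  have hXY := mul_mem_bideg_neg hX hY
  rcases hp.eq_or_lt with rfl | hp
  · rcases hq.eq_or_lt with rfl | hq
    · rw [add_zero, neg_zero] at hXY
      rw [neg_zero] at hX hY
      rw [componentZero_of_mem hX, componentZero_of_mem hY, componentZero_of_mem hXY]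
    · rw [componentZero_of_pos hq hY, mul_zero, componentZero_of_pos (by omega) hXY]
  · rw [componentZero_of_pos hp hX, zero_mul, componentZero_of_pos (by omega) hXY]

/-- When only `p ≥ 0` occurs, a product reaches `p = 0` only if both factors have `p = 0`. -/
theorem componentZero_mul {X Y : Omega μ} (hX : X ∈ nonnegPiece μ) (hY : Y ∈ nonnegPiece μ) :
    componentZero (X * Y) = componentZero X * componentZero Y := by
  induction hX using Submodule.span_induction with
  | mem X hX =>
    obtain ⟨p, hp, hX⟩ := hX
    induction hY using Submodule.span_induction with
    | mem Y hY =>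
      obtain ⟨q, hq, hY⟩ := hY
      exact componentZero_mul_of_mem hp hq hX hY
    | zero => rw [mul_zero, map_zero, mul_zero]
    | add Y Z _ _ h1 h2 => rw [mul_add, map_add, map_add, mul_add, h1, h2]
    | smul r Y _ h => rw [mul_smul_comm, map_smul, map_smul, mul_smul_comm, h]
  | zero => rw [zero_mul, map_zero, zero_mul]
  | add Y Z _ _ h1 h2 => rw [add_mul, map_add, map_add, add_mul, h1, h2]
  | smul r Y _ h => rw [smul_mul_assoc, map_smul, map_smul, smul_mul_assoc, h]

theorem one_mem_bideg : (1 : Omega μ) ∈ bideg μ (0, 0) := Submodule.subset_span IsMonomial.one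

/-- The grades of the elements of the basis of `g_{≥ 0}`. -/
def parGrade : ParIdx μ → ℤ := Sum.elim (fun _ => 0) ht

theorem parGrade_nonneg (i : ParIdx μ) : 0 ≤ parGrade i := by
  rcases i with k | α
  · exact le_rfl
  · exact (ht_pos α).le

theorem parBasis_mem_grade (i : ParIdx μ) : parBasis i ∈ grade μ (parGrade i) := by
  rcases i with k | α
  · exact (basisZero μ k).2
  · exact tUp_mem_grade α

theorem hatWord_mem_bideg (w : List (ParIdx μ)) : hatWord (w.map parBasis) ∈
    bideg μ ((w.map parGrade).sum, -(w.map parGrade).sum) := by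
  induction w with
  | nil =>
    rw [List.map_nil, List.map_nil, List.sum_nil, neg_zero]
    exact one_mem_bideg
  | cons i w ih =>
    rw [List.map_cons, List.map_cons, List.sum_cons, hatWord_cons]
    exact mul_mem_bideg_neg (Jhat_mem_bideg (parBasis_mem_grade i)) ih

theorem sum_parGrade_nonneg (w : List (ParIdx μ)) : 0 ≤ (w.map parGrade).sum := by
  refine List.sum_nonneg fun x hx => ?_
  obtain ⟨i, _, rfl⟩ := List.mem_map.1 hx
  exact parGrade_nonneg i

theorem sum_parGrade_pos {w : List (ParIdx μ)} {α : Pos μ} (h : Sum.inr α ∈ w) :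
    0 < (w.map parGrade).sum := by
  induction w with
  | nil => exact absurd h List.not_mem_nil
  | cons i w ih =>
    rw [List.map_cons, List.sum_cons]
    rcases List.mem_cons.1 h with rfl | h
    · exact add_pos_of_pos_of_nonneg (ht_pos α) (sum_parGrade_nonneg w)
    · exact add_pos_of_nonneg_of_pos (parGrade_nonneg i) (ih h)

theorem sum_parGrade_eq_zero {w : List (ParIdx μ)} (h : ∀ α, Sum.inr α ∉ w) :
    (w.map parGrade).sum = 0 := by
  refine List.sum_eq_zero fun x hx => ?_
  obtain ⟨k | α, hi, rfl⟩ := List.mem_map.1 hx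
  · rfl
  · exact absurd hi (h α)

/-- The monomial contains only variables of grade `0`. -/
def IsPure (m : ParIdx μ →₀ ℕ) : Prop := ∀ α, m (Sum.inr α) = 0

theorem hatWord_mem_OmegaRedZero {w : List (ParIdx μ)} (h : ∀ α, Sum.inr α ∉ w) :
    hatWord (w.map parBasis) ∈ OmegaRedZero μ := by
  refine Subalgebra.list_prod_mem _ fun x hx => ?_
  rw [List.map_map] at hx
  obtain ⟨k | α, hi, rfl⟩ := List.mem_map.1 hx
  · exact Algebra.subset_adjoin ⟨basisZero μ k, rfl⟩
  · exact absurd hi (h α)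

theorem IsPure.notMem {m : ParIdx μ →₀ ℕ} (h : IsPure m) (α : Pos μ) :
    Sum.inr α ∉ monList m := fun h2 => mem_monList.1 h2 (h α)

theorem IsPure.componentZero {m : ParIdx μ →₀ ℕ} (h : IsPure m) :
    componentZero (ordMon (fun i => Jhat (parBasis i)) m) =
      ordMon (fun i => Jhat (parBasis i)) m := by
  have h2 := hatWord_mem_bideg (monList m)
  rw [← ordMon_Jhat, sum_parGrade_eq_zero h.notMem, neg_zero] at h2
  exact componentZero_of_mem h2

theorem componentZero_of_not_isPure {m : ParIdx μ →₀ ℕ} (h : ¬ IsPure m) :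
    componentZero (ordMon (fun i => Jhat (parBasis i)) m) = 0 := by
  rw [IsPure, not_forall] at h
  obtain ⟨α, hα⟩ := h
  have h2 := hatWord_mem_bideg (monList m)
  rw [← ordMon_Jhat] at h2
  exact componentZero_of_pos (sum_parGrade_pos (mem_monList.2 hα)) h2

open Classical in
/-- The terms of a polynomial which contain only variables of grade `0`. -/
def purePart (P : MvPolynomial (ParIdx μ) ℂ) : MvPolynomial (ParIdx μ) ℂ :=
  ∑ m ∈ P.support, if IsPure m then MvPolynomial.monomial m (P.coeff m) else 0

theorem coeff_purePart (P : MvPolynomial (ParIdx μ) ℂ) {m : ParIdx μ →₀ ℕ} (h : IsPure m) :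
    (purePart P).coeff m = P.coeff m := by
  classical
  rw [purePart, MvPolynomial.coeff_sum, Finset.sum_eq_single m]
  · rw [if_pos h, MvPolynomial.coeff_monomial, if_pos rfl]
  · intro m' _ hm
    split_ifs
    · rw [MvPolynomial.coeff_monomial, if_neg hm]
    · rw [MvPolynomial.coeff_zero]
  · intro hm
    rw [if_pos h, MvPolynomial.coeff_monomial, if_pos rfl, MvPolynomial.notMem_support_iff.1 hm]

theorem componentZero_ordPoly (P : MvPolynomial (ParIdx μ) ℂ) :
    componentZero (ordPoly (fun i => Jhat (parBasis i)) P) =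
      ordPoly (fun i => Jhat (parBasis i)) (purePart P) := by
  classical
  rw [ordPoly_eq_sum, purePart, map_sum, map_sum]
  refine Finset.sum_congr rfl fun m _ => ?_
  rw [map_smul]
  split_ifs with h
  · rw [h.componentZero, ordPoly_monomial]
  · rw [componentZero_of_not_isPure h, smul_zero, map_zero]

theorem ordPoly_mem_nonnegPiece (P : MvPolynomial (ParIdx μ) ℂ) :
    ordPoly (fun i => Jhat (parBasis i)) P ∈ nonnegPiece μ := by
  rw [ordPoly_eq_sum]
  refine Submodule.sum_mem _ fun m _ => Submodule.smul_mem _ _ (Submodule.subset_span ?_)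
  have h2 := hatWord_mem_bideg (monList m)
  rw [← ordMon_Jhat] at h2
  exact ⟨_, sum_parGrade_nonneg _, h2⟩

theorem red_mem_nonnegPiece {X : Omega μ} (hX : X ∈ OmegaRed μ) (hk : X ∈ degPiece μ 0) :
    X ∈ nonnegPiece μ := by
  obtain ⟨P, rfl⟩ := exists_ordPoly_parBasis hX hk
  exact ordPoly_mem_nonnegPiece P

theorem component_mem_OmegaRedZero {X : Omega μ} (hX : X ∈ OmegaRed μ) (hk : X ∈ degPiece μ 0) :
    componentZero X ∈ OmegaRedZero μ := by
  obtain ⟨P, rfl⟩ := exists_ordPoly_parBasis hX hk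
  rw [ordPoly_eq_sum, map_sum]
  refine sum_mem fun m _ => ?_
  rw [map_smul]
  refine Subalgebra.smul_mem _ ?_ _
  by_cases h : IsPure m
  · rw [h.componentZero, ordMon_Jhat]
    exact hatWord_mem_OmegaRedZero h.notMem
  · rw [componentZero_of_not_isPure h]
    exact zero_mem _

/-- A cocycle of degree `0` in `Ω_red` is determined by its component of bidegree `(0, 0)`. -/
theorem red_cocycle_eq_zero {X : Omega μ} (hX : X ∈ OmegaRed μ) (hk : X ∈ degPiece μ 0)
    (hd : d μ X = 0) (h : componentZero X = 0) : X = 0 := by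
  obtain ⟨P, rfl⟩ := exists_ordPoly_parBasis hX hk
  rw [componentZero_ordPoly] at h
  have hP := ordPoly_Jhat_injective parBasis_linearIndependent h
  -- The cocycle condition leaves only variables of grade `0` in the top part, so its terms are
  -- terms of `purePart P`, which is zero by `hP`.
  have hT : MvPolynomial.homogeneousComponent P.totalDegree P = 0 := by
    have h1 := symbDer_homogeneousComponent le_rfl hd
    refine MvPolynomial.ext _ _ fun m => ?_
    rw [MvPolynomial.coeff_zero]
    by_contra hm
    have hpure : IsPure m := fun β => support_of_pderiv_eq_zero (pderiv_inr_eq_zero h1 β) hm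
    rw [MvPolynomial.coeff_homogeneousComponent] at hm
    have h2 := coeff_purePart P hpure
    rw [hP, MvPolynomial.coeff_zero] at h2
    split_ifs at hm with h3
    · exact hm h2.symm
    · exact hm rfl
  rw [homogeneousComponent_totalDegree_eq_zero hT, map_zero]

/-! ### The enveloping algebra of `g_0` -/

variable (μ) in
/-- The inclusion of `g_0`. -/
def inclZero : G0 μ →ₗ[ℂ] G μ where
  toFun x := x
  map_add' _ _ := rfl
  map_smul' _ _ := rfl

theorem projPar_inclZero (x : G0 μ) : projPar (inclZero μ x) = inclZero μ x :=
  projPar_of_mem_grade le_rfl x.2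

variable (μ) in
/-- The homomorphism of `U g_0` into `Ω` given by the hatted generators. -/
def hatZero : UniversalEnvelopingAlgebra ℂ (G0 μ) →ₐ[ℂ] Omega μ :=
  uLift (JhatLin ∘ₗ inclZero μ) fun x y => by
    rw [LinearMap.comp_apply, LinearMap.comp_apply, LinearMap.comp_apply, JhatLin_apply,
      JhatLin_apply, JhatLin_apply,
      Jhat_Jhat_of_projPar (projPar_inclZero x) (projPar_inclZero y)]
    rfl

theorem hatZero_ι (x : G0 μ) : hatZero μ (UniversalEnvelopingAlgebra.ι ℂ x) = Jhat (x : G μ) :=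
  (uLift_ι _ _ x).trans (JhatLin_apply _)

theorem hatZero_range : (hatZero μ).range = OmegaRedZero μ := by
  rw [← Algebra.map_top, ← adjoin_range_ι, AlgHom.map_adjoin, ← Set.range_comp, OmegaRedZero]
  congr 2
  funext x
  exact hatZero_ι x

theorem ι_mem_span (x : G0 μ) : UniversalEnvelopingAlgebra.ι ℂ x ∈
    Submodule.span ℂ (Set.range fun k => UniversalEnvelopingAlgebra.ι ℂ (basisZero μ k)) := by
  rw [← (basisZero μ).sum_repr x, map_sum]
  refine Submodule.sum_mem _ fun k _ => ?_
  rw [map_smul]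
  exact Submodule.smul_mem _ _ (Submodule.subset_span ⟨k, rfl⟩)

theorem hatZero_injective : Function.Injective (hatZero μ) := by
  rw [injective_iff_map_eq_zero]
  intro u hu
  have hmem : u ∈ Algebra.adjoin ℂ
      (Set.range fun k => UniversalEnvelopingAlgebra.ι ℂ (basisZero μ k)) := by
    have h : Algebra.adjoin ℂ (Set.range (UniversalEnvelopingAlgebra.ι ℂ : G0 μ → _)) ≤
        Algebra.adjoin ℂ
          (Set.range fun k => UniversalEnvelopingAlgebra.ι ℂ (basisZero μ k)) := by
      refine Algebra.adjoin_le ?_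
      rintro _ ⟨x, rfl⟩
      exact Algebra.span_le_adjoin ℂ _ (ι_mem_span x)
    rw [adjoin_range_ι] at h
    exact h trivial
  -- An element of `U(g_0)` is an ordered polynomial in a basis, and its image is the same ordered
  -- polynomial in the `Ĵ` of linearly independent elements.
  obtain ⟨P, rfl⟩ := exists_ordPoly_eq (fun i k => by
    rw [← ι_lie]
    exact ι_mem_span _) hmem
  rw [map_ordPoly] at hu
  simp_rw [hatZero_ι] at hu
  have hli : LinearIndependent ℂ fun k => (basisZero μ k : G μ) :=
    parBasis_linearIndependent.comp Sum.inl Sum.inl_injective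
  rw [ordPoly_Jhat_injective hli hu, map_zero]

variable (μ) in
/-- The isomorphism of `U g_0` onto the algebra generated by the `Ĵ` of grade `0`. -/
def hatZeroEquiv : UniversalEnvelopingAlgebra ℂ (G0 μ) ≃ₐ[ℂ] OmegaRedZero μ :=
  (AlgEquiv.ofInjective (hatZero μ) hatZero_injective).trans
    (Subalgebra.equivOfEq _ _ hatZero_range)

theorem hatZeroEquiv_ι (x : G0 μ) :
    (hatZeroEquiv μ (UniversalEnvelopingAlgebra.ι ℂ x) : Omega μ) = Jhat (x : G μ) :=
  hatZero_ι x

/-! ### The Miura map -/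

variable (μ) in
/-- The reduced cocycles of degree `0`. -/
def redCocycles : Subalgebra ℂ (cocycles μ) := (OmegaRed μ).comap (cocycles μ).val

variable (μ) in
/-- The class of a reduced cocycle. -/
def redCls : redCocycles μ →ₐ[ℂ] W μ := (cls (μ := μ)).comp (redCocycles μ).val

theorem cls_eq_iff {X Y : cocycles μ} :
    cls X = cls Y ↔ ∃ Z ∈ degPiece μ (-1), d μ Z = (X : Omega μ) - Y :=
  Ideal.Quotient.eq

theorem redCls_injective : Function.Injective (redCls μ) := by
  intro X Y h
  obtain ⟨Z, hZ, hdZ⟩ := cls_eq_iff.1 h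
  have h2 : ((X : cocycles μ) : Omega μ) - (Y : cocycles μ) = 0 :=
    red_coboundary_eq_zero (sub_mem X.2 Y.2) (sub_mem X.1.2.1 Y.1.2.1) hZ hdZ
  exact Subtype.ext (Subtype.ext (sub_eq_zero.1 h2))

theorem redCls_surjective : Function.Surjective (redCls μ) := by
  intro w
  obtain ⟨Z, rfl⟩ := Ideal.Quotient.mk_surjective w
  obtain ⟨X, hX, hX0, hdX, Y, hY, h⟩ := exists_red_representative Z.2.1 Z.2.2
  exact ⟨⟨⟨X, hX0, hdX⟩, hX⟩, (cls_eq_iff.2 ⟨Y, hY, h⟩).symm⟩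

variable (μ) in
/-- The component of bidegree `(0, 0)` of a reduced cocycle. -/
def redComponent : redCocycles μ →ₐ[ℂ] Omega μ :=
  AlgHom.ofLinearMap
    (componentZero ∘ₗ (cocycles μ).val.toLinearMap ∘ₗ (redCocycles μ).val.toLinearMap)
    (componentZero_of_mem one_mem_bideg) fun X Y =>
      componentZero_mul (red_mem_nonnegPiece X.2 X.1.2.1) (red_mem_nonnegPiece Y.2 Y.1.2.1)

theorem redComponent_injective : Function.Injective (redComponent μ) := by
  rw [injective_iff_map_eq_zero]
  intro X h
  exact Subtype.ext (Subtype.ext (red_cocycle_eq_zero X.2 X.1.2.1 X.1.2.2 h))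

theorem coe_range_redComponent : ((redComponent μ).range : Set (Omega μ)) = miuraImage μ := by
  ext Y
  constructor
  · rintro ⟨X, rfl⟩
    exact ⟨X.1.1, X.1.2, X.2, rfl⟩
  · rintro ⟨X, hX, hX2, rfl⟩
    exact ⟨⟨⟨X, hX⟩, hX2⟩, rfl⟩

theorem range_redComponent_le : (redComponent μ).range ≤ OmegaRedZero μ := by
  rintro _ ⟨X, rfl⟩
  exact component_mem_OmegaRedZero X.2 X.1.2.1

variable (μ) in
/-- The isomorphism of the reduced cocycles onto the `W` algebra. -/
def redClsEquiv : redCocycles μ ≃ₐ[ℂ] W μ :=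
  AlgEquiv.ofBijective (redCls μ) ⟨redCls_injective, redCls_surjective⟩

theorem redClsEquiv_symm_redCls (X : redCocycles μ) : (redClsEquiv μ).symm (redCls μ X) = X :=
  redCls_injective ((redClsEquiv μ).apply_symm_apply (redCls μ X))

variable (μ) in
/-- The isomorphism of the `W` algebra onto `H^0(Ω; d)^{0,0}`. -/
def miuraEquiv : W μ ≃ₐ[ℂ] (redComponent μ).range :=
  (redClsEquiv μ).symm.trans (AlgEquiv.ofInjective (redComponent μ) redComponent_injective)

theorem miuraEquiv_redCls (X : redCocycles μ) :
    (miuraEquiv μ (redCls μ X) : Omega μ) = redComponent μ X :=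
  congrArg (redComponent μ) (redClsEquiv_symm_redCls X)

variable (μ) in
/-- The Miura map into `U g_0`. -/
def miura : W μ →ₐ[ℂ] UniversalEnvelopingAlgebra ℂ (G0 μ) :=
  (hatZeroEquiv μ).symm.toAlgHom.comp
    ((Subalgebra.inclusion range_redComponent_le).comp (miuraEquiv μ).toAlgHom)

theorem hatZeroEquiv_miura (w : W μ) :
    (hatZeroEquiv μ (miura μ w) : Omega μ) = (miuraEquiv μ w : Omega μ) :=
  congrArg Subtype.val ((hatZeroEquiv μ).apply_symm_apply
    (Subalgebra.inclusion range_redComponent_le (miuraEquiv μ w)))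

theorem miura_injective : Function.Injective (miura μ) := by
  intro w w' h
  apply (miuraEquiv μ).injective
  apply Subtype.ext
  rw [← hatZeroEquiv_miura, ← hatZeroEquiv_miura, h]

/-! ### Principal embeddings -/

/-- The vectors supported on the first row. -/
def firstRow (μ : YoungDiagram) : Submodule ℂ (μ.cells → ℂ) where
  carrier := {v | ∀ i, row i ≠ 0 → v i = 0}
  zero_mem' := fun _ _ => rfl
  add_mem' := fun {v w} hv hw i hi => by rw [Pi.add_apply, hv i hi, hw i hi, add_zero]
  smul_mem' := fun r v hv i hi => by rw [Pi.smul_apply, hv i hi, smul_zero]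

theorem mulVec_mem_firstRow {M : Matrix μ.cells μ.cells ℂ}
    (hM : ∀ i j, M i j ≠ 0 → row i = row j) {v : μ.cells → ℂ} (hv : v ∈ firstRow μ) :
    M.mulVec v ∈ firstRow μ := by
  intro i hi
  refine Finset.sum_eq_zero fun j _ => ?_
  change M i j * v j = 0
  by_cases h : M i j = 0
  · rw [h, zero_mul]
  · rw [hv j (hM i j h ▸ hi), mul_zero]

/-- The embedded `sl₂` preserves rows, so the vectors supported on the first row form an invariant
subspace. It is nonzero because a nonempty diagram contains the cell `(0, 0)`, hence by
irreducibility it is everything. -/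
theorem IsPrincipal.row_eq_zero (h : IsPrincipal μ) (i : μ.cells) : row i = 0 := by
  have h2 := h.2 (firstRow μ) fun v hv => by
    refine ⟨mulVec_mem_firstRow ?_ hv, mulVec_mem_firstRow ?_ hv, mulVec_mem_firstRow ?_ hv⟩
    · intro i j hij
      by_contra hr
      exact hij (if_neg fun h3 => hr h3.1)
    · intro i j hij
      by_contra hr
      exact hij (Matrix.diagonal_apply_ne _ fun h3 => hr (congrArg _ h3))
    · intro i j hij
      by_contra hr
      exact hij (if_neg fun h3 => hr h3.1)
  rcases h2 with h2 | h2
  · have h0 : ((0, 0) : ℕ × ℕ) ∈ μ.cells := μ.up_left_mem (Nat.zero_le _) (Nat.zero_le _) i.2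
    have hv : Pi.single (⟨(0, 0), h0⟩ : μ.cells) (1 : ℂ) ∈ firstRow μ := by
      intro j hj
      refine Pi.single_eq_of_ne (fun h3 => hj ?_) _
      rw [h3]
    rw [h2, Submodule.mem_bot] at hv
    have := congrFun hv ⟨(0, 0), h0⟩
    rw [Pi.single_eq_same] at this
    exact absurd this one_ne_zero
  · by_contra hi
    have hv : Pi.single i (1 : ℂ) ∈ firstRow μ := by rw [h2]; trivial
    have := hv i hi
    rw [Pi.single_eq_same] at this
    exact one_ne_zero this

/-- In a single row distinct cells have distinct columns, so `g_0` consists of diagonal matrices. -/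
theorem IsPrincipal.lie_eq_zero (h : IsPrincipal μ) (x y : G0 μ) : ⁅x, y⁆ = 0 := by
  have hc : ∀ i j : μ.cells, i ≠ j → col i ≠ col j := fun i j hij hcol => hij
    (Subtype.ext (Prod.ext ((h.row_eq_zero i).trans (h.row_eq_zero j).symm) hcol))
  have hd : ∀ x : G0 μ, (x : G μ).1 = Matrix.diagonal fun i => (x : G μ).1 i i := by
    intro x
    refine Matrix.ext fun i j => ?_
    rw [Matrix.diagonal_apply]
    split_ifs with hij
    · rw [hij]
    · exact grade_zero_apply (mem_grade_zero_of_mem_G0 x) (hc i j hij)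
  apply Subtype.ext
  apply Subtype.ext
  change (⁅(x : G μ), (y : G μ)⁆ : G μ).1 = 0
  rw [LieAlgebra.SpecialLinear.sl_bracket, hd x, hd y, Matrix.diagonal_mul_diagonal,
    Matrix.diagonal_mul_diagonal, sub_eq_zero]
  congr 1
  funext i
  exact mul_comm _ _

theorem uea_mul_comm {L : Type*} [LieRing L] [LieAlgebra ℂ L] (h : ∀ x y : L, ⁅x, y⁆ = 0)
    (u v : UniversalEnvelopingAlgebra ℂ L) : u * v = v * u := by
  have h1 : ∀ (x : L) (u : UniversalEnvelopingAlgebra ℂ L),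
      UniversalEnvelopingAlgebra.ι ℂ x * u = u * UniversalEnvelopingAlgebra.ι ℂ x := by
    intro x u
    have h2 : Algebra.adjoin ℂ (Set.range (UniversalEnvelopingAlgebra.ι ℂ : L → _)) ≤
        Subalgebra.centralizer ℂ {UniversalEnvelopingAlgebra.ι ℂ x} := by
      refine Algebra.adjoin_le ?_
      rintro _ ⟨y, rfl⟩
      refine Subalgebra.mem_centralizer_iff ℂ |>.2 ?_
      rintro _ rfl
      rw [← sub_eq_zero, ← ι_lie, h, map_zero]
    rw [adjoin_range_ι] at h2
    exact (Subalgebra.mem_centralizer_iff ℂ).1 (h2 (trivial : u ∈ ⊤)) _ rfl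
  have h2 : Algebra.adjoin ℂ (Set.range (UniversalEnvelopingAlgebra.ι ℂ : L → _)) ≤
      Subalgebra.centralizer ℂ {u} := by
    refine Algebra.adjoin_le ?_
    rintro _ ⟨y, rfl⟩
    refine Subalgebra.mem_centralizer_iff ℂ |>.2 ?_
    rintro _ rfl
    exact (h1 y _).symm
  rw [adjoin_range_ι] at h2
  exact (Subalgebra.mem_centralizer_iff ℂ).1 (h2 (trivial : v ∈ ⊤)) _ rfl

theorem IsPrincipal.mul_comm (h : IsPrincipal μ) (w w' : W μ) : w * w' = w' * w := by
  apply miura_injective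
  rw [map_mul, map_mul]
  exact uea_mul_comm h.lie_eq_zero _ _

end FiniteW

end

/-! ### The quantum Miura transformation -/

theorem mainTheorem2 (μ : YoungDiagram) :
    -- every class has exactly one representative in the reduced complex
    (∀ w : FiniteW.W μ, ∃! X : FiniteW.cocycles μ,
      (X : FiniteW.Omega μ) ∈ FiniteW.OmegaRed μ ∧ FiniteW.cls X = w) ∧
    -- `H^0(Ω; d)^{0,0}` is a subalgebra, contained in the one generated by the `Ĵ^a` of grade `0`
    ∃ A : Subalgebra ℂ (FiniteW.Omega μ),
      (A : Set (FiniteW.Omega μ)) = FiniteW.miuraImage μ ∧ A ≤ FiniteW.OmegaRedZero μ ∧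
    -- the Miura map is an algebra isomorphism of the `W` algebra onto `H^0(Ω; d)^{0,0}`
    ∃ Φ : FiniteW.W μ ≃ₐ[ℂ] A,
      (∀ X : FiniteW.cocycles μ, (X : FiniteW.Omega μ) ∈ FiniteW.OmegaRed μ →
        (Φ (FiniteW.cls X) : FiniteW.Omega μ) = FiniteW.component (0, 0) (X : FiniteW.Omega μ)) ∧
    -- the `Ĵ^a` of grade `0` generate a copy of `U(g_0)`
    ∃ e : UniversalEnvelopingAlgebra ℂ (FiniteW.G0 μ) ≃ₐ[ℂ] FiniteW.OmegaRedZero μ,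
      (∀ x : FiniteW.G0 μ, (e (UniversalEnvelopingAlgebra.ι ℂ x) : FiniteW.Omega μ) =
        FiniteW.Jhat (x : FiniteW.G μ)) ∧
    -- hence the `W` algebra embeds into `U(g_0)`
    ∃ ψ : FiniteW.W μ →ₐ[ℂ] UniversalEnvelopingAlgebra ℂ (FiniteW.G0 μ),
      Function.Injective ψ ∧
      (∀ w : FiniteW.W μ, (e (ψ w) : FiniteW.Omega μ) = (Φ w : FiniteW.Omega μ)) ∧
    -- it is commutative for principal embeddings
      (FiniteW.IsPrincipal μ → ∀ w w' : FiniteW.W μ, w * w' = w' * w) ∧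
    -- every `g_0`-module is, through the Miura map, a module over the `W` algebra
      (∀ (V : Type*) [AddCommGroup V] [Module ℂ V] [LieRingModule (FiniteW.G0 μ) V]
        [LieModule ℂ (FiniteW.G0 μ) V],
        ∃ _ : Module (FiniteW.W μ) V, ∀ (w : FiniteW.W μ) (v : V),
          w • v = UniversalEnvelopingAlgebra.lift ℂ
            (LieModule.toEnd ℂ (FiniteW.G0 μ) V) (ψ w) v) := by
  refine ⟨fun w => ?_, (FiniteW.redComponent μ).range, FiniteW.coe_range_redComponent,
    FiniteW.range_redComponent_le, FiniteW.miuraEquiv μ,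
    fun X hX => FiniteW.miuraEquiv_redCls ⟨X, hX⟩, FiniteW.hatZeroEquiv μ, FiniteW.hatZeroEquiv_ι,
    FiniteW.miura μ, FiniteW.miura_injective, FiniteW.hatZeroEquiv_miura,
    FiniteW.IsPrincipal.mul_comm, ?_⟩
  · obtain ⟨X, rfl⟩ := FiniteW.redCls_surjective w
    refine ⟨X, ⟨X.2, rfl⟩, fun Y hY => ?_⟩
    exact congrArg Subtype.val (FiniteW.redCls_injective (a₁ := ⟨Y, hY.1⟩) (a₂ := X) hY.2)
  · intro V _ _ _ _
    exact ⟨Module.compHom V ((UniversalEnvelopingAlgebra.lift ℂ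
      (LieModule.toEnd ℂ (FiniteW.G0 μ) V)).comp (FiniteW.miura μ)).toRingHom, fun _ _ => rfl⟩
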